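/- Let $k$ be an algebraically closed field of characteristic $0$ and let $Q$ be a finite quiver, with vertex set $Q_0$ and set of arrows $Q_1$, whose underlying graph is extended Dynkin of type $\widetilde{A_{n-1}}$ ($n\ge 2$), $\widetilde{D_{n-1}}$ ($n\ge 5$) or $\widetilde{E_6},\widetilde{E_7},\widetilde{E_8}$. Let $\bar Q$ be the double of $Q$, obtained by adding an arrow $\alpha^\ast$ opposite to each arrow $\alpha$ of $Q$, and let $$A=\Pi(Q)=k\bar Q\Big/\Big(\sum_{\alpha\in Q_1}(\alpha\alpha^\ast-\alpha^\ast\alpha)\Big)$$ be the preprojective algebra, graded by path length, with idempotents $e_v$ ($v\in Q_0$) given by the trivial paths. Put $\mathfrak m=A_{\ge1}$, and for a graded right $A$-module $M$ let $H^n_{\mathfrak m}(M)=\varinjlim_r\underline{\mathrm{Ext}}^n_A(A/A_{\ge r},M)$, where $\underline{\mathrm{Ext}}$ is the graded Ext of graded right modules. Let $g$ be a graded automorphism of $A$ which fixes every $e_v$ and scales the arrows: $g(\alpha)=c_\alpha\alpha$ and $g(\alpha^\ast)=t_\alpha\alpha^\ast$ for all $\alpha\in Q_1$, with $c_\alpha,t_\alpha\in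 k^\times$. A $k$-linear map $f:M\to M$ of degree zero is called $g$-linear if $f(ma)=f(m)g(a)$; it induces $g$-linear maps $H^n_{\mathfrak m}(f)$ on $H^n_{\mathfrak m}(M)$. Write $$\mathrm{Tr}_M(f,t)=\sum_{j\in\mathbb Z}\mathrm{tr}(f|_{M_j})\,t^j,\qquad \mathrm{Br}_M(f,t)=\sum_{n\ge0}(-1)^n\,\mathrm{Tr}_{H^n_{\mathfrak m}(M)}\big(H^n_{\mathfrak m}(f),t\big),$$ and write $\mathrm{Tr}_{e_iA}(g,t)$ and $\mathrm{Br}_{e_iA}(g,t)$ for these series with $M=e_iA$ and $f=g|_{e_iA}$. Let $A^\vee=\bigoplus_p\mathrm{Hom}_k(A_{-p},k)$ be the graded dual, a right module by $(\varphi a)(b)=\varphi(ab)$, with its summands $e_vA^\vee=\underline{\mathrm{Hom}}_k(Ae_v,k)$. The homological determinant $\mathrm{Hdet}(g)$ is the diagonal matrix with entries $\mathrm{Hdet}(g)_{vv}=\lambda_v^{-1}$, where the $\lambda_v\in k^\times$ are such that, under some isomorphism $H^2_{\mathfrak m}(A)\cong A^\vee[2]$ of graded right $A$-modules, $H^2_{\mathfrak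 m}(g)$ becomes $\varphi\mapsto\lambda_v\,\varphi\circ g^{-1}$ on $e_vA^\vee$ for each $v\in Q_0$. Then $\mathrm{Hdet}(g)$ is well defined (such an isomorphism and such scalars exist, and the scalars are unique). For every vertex $i$, the module $e_iA$ is locally finite and left bounded, $H^n_{\mathfrak m}(e_iA)=0$ for large $n$, each $H^n_{\mathfrak m}(e_iA)$ is locally finite and right bounded, the series $\mathrm{Tr}_{e_iA}(g,t)\in k((t))$ and $\mathrm{Br}_{e_iA}(g,t)\in k((t^{-1}))$ are expansions of rational functions over $k$, and, for every arrow $\alpha\in Q_1$, $$\mathrm{Br}_{e_iA}(g,t)=\mathrm{Hdet}(g)_{ii}^{-1}\,c_\alpha t_\alpha\,\mathrm{Tr}_{e_iA}(g,t)$$ as rational functions over $k$. -/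

import Mathlib

set_option linter.unusedSectionVars false

noncomputable section

open MulOpposite

/-! ## Graded right modules over an `ℕ`-graded algebra

Throughout, `𝒜 : ℕ → Submodule k A` is the grading of a `k`-algebra `A`.  Right `A`-modules are
modules over `Aᵐᵒᵖ`: the element `m a` is written `op a • m`.  A `ℤ`-grading of a right module `M`
is a family `ℳ : ℤ → Submodule k M`. -/

namespace GradedRight

section Ext

variable {k A : Type*} [Field k] [Ring A] [Algebra k A] (𝒜 : ℕ → Submodule k A)
variable {N N' N'' M M' : Type*}
  [AddCommGroup N] [Module k N] [Module Aᵐᵒᵖ N]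
  [AddCommGroup N'] [Module k N'] [Module Aᵐᵒᵖ N']
  [AddCommGroup M] [Module k M] [Module Aᵐᵒᵖ M] [IsScalarTower k Aᵐᵒᵖ M]
  [AddCommGroup M'] [Module k M'] [Module Aᵐᵒᵖ M'] [IsScalarTower k Aᵐᵒᵖ M']

/-- The cochains `C^n(N, M)_ℓ`: the `k`-multilinear maps `φ : N × A^n → M`, that is, the `k`-linear
maps `N ⊗ A^{⊗ n} → M`, which are homogeneous of degree `ℓ`.  They are the homogeneous
right `A`-module maps of degree `ℓ` from the `n`-th term `N ⊗ A^{⊗ n} ⊗ A` of the graded free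
(bar) resolution of `N` to `M`. -/
def cochains (𝒩 : ℤ → Submodule k N) (ℳ : ℤ → Submodule k M) (n : ℕ) (ℓ : ℤ) :
    Submodule k (N → (Fin n → A) → M) where
  carrier := {φ |
    (∃ Φ : N →ₗ[k] MultilinearMap k (fun _ : Fin n => A) M, ∀ x a, φ x a = Φ x a) ∧
    ∀ (p : ℤ) (d : Fin n → ℕ) (x : N) (a : Fin n → A), x ∈ 𝒩 p → (∀ i, a i ∈ 𝒜 (d i)) →
      φ x a ∈ ℳ (p + ∑ i, (d i : ℤ) + ℓ)}
  add_mem' := by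
    rintro φ ψ ⟨⟨Φ, hΦ⟩, h1⟩ ⟨⟨Ψ, hΨ⟩, h2⟩
    refine ⟨⟨Φ + Ψ, fun x a => by simp [hΦ, hΨ]⟩, fun p d x a hx ha => ?_⟩
    exact (ℳ _).add_mem (h1 p d x a hx ha) (h2 p d x a hx ha)
  zero_mem' := ⟨⟨0, fun x a => by simp⟩, fun p d x a _ _ => (ℳ _).zero_mem⟩
  smul_mem' := by
    rintro c φ ⟨⟨Φ, hΦ⟩, h1⟩
    refine ⟨⟨c • Φ, fun x a => by simp [hΦ]⟩, fun p d x a hx ha => ?_⟩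
    exact (ℳ _).smul_mem c (h1 p d x a hx ha)

variable (k A N M) in
/-- The differential of the bar complex,
`(dφ)(x, a₁, …, aₙ₊₁) = φ(x a₁, a₂, …) + ∑_{j=1}^{n} (-1)^j φ(x, …, a_j a_{j+1}, …)
  + (-1)^{n+1} φ(x, a₁, …, aₙ) aₙ₊₁`. -/
def barD (n : ℕ) : (N → (Fin n → A) → M) →ₗ[k] (N → (Fin (n + 1) → A) → M) where
  toFun φ x a :=
    φ (op (a 0) • x) (fun i => a i.succ)
      + ∑ j : Fin n, (-1 : k) ^ ((j : ℕ) + 1) • φ x (Fin.contractNth j.castSucc (· * ·) a)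
      + (-1 : k) ^ (n + 1) • (op (a (Fin.last n)) • φ x (fun i => a i.castSucc))
  map_add' φ ψ := by
    funext x a
    simp only [Pi.add_apply, smul_add, Finset.sum_add_distrib]
    abel
  map_smul' c φ := by
    funext x a
    simp only [Pi.smul_apply, RingHom.id_apply, smul_add, Finset.smul_sum]
    congr 1
    · congr 1
      exact Finset.sum_congr rfl fun j _ => smul_comm _ _ _
    · rw [smul_comm (op _) c, smul_comm _ c]

/-- Degree `ℓ` cocycles of the bar complex. -/
def cocycles (𝒩 : ℤ → Submodule k N) (ℳ : ℤ → Submodule k M) (n : ℕ) (ℓ : ℤ) :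
    Submodule k (N → (Fin n → A) → M) :=
  cochains 𝒜 𝒩 ℳ n ℓ ⊓ LinearMap.ker (barD k A N M n)

/-- Degree `ℓ` coboundaries of the bar complex. -/
def coboundaries (𝒩 : ℤ → Submodule k N) (ℳ : ℤ → Submodule k M) :
    (n : ℕ) → (ℓ : ℤ) → Submodule k (N → (Fin n → A) → M)
  | 0, _ => ⊥
  | n + 1, ℓ => (cochains 𝒜 𝒩 ℳ n ℓ).map (barD k A N M n)

/-- The degree `ℓ` piece of the graded Ext group `\underline{Ext}^n_A(N, M)` of graded right
`A`-modules, that is, `Ext^n` from `N` to `M[ℓ]` in the category of graded right modules. -/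
abbrev Ext (𝒩 : ℤ → Submodule k N) (ℳ : ℤ → Submodule k M) (n : ℕ) (ℓ : ℤ) : Type _ :=
  cocycles 𝒜 𝒩 ℳ n ℓ ⧸ (coboundaries 𝒜 𝒩 ℳ n ℓ).submoduleOf (cocycles 𝒜 𝒩 ℳ n ℓ)

/-- A change of coefficients along a graded ring endomorphism `γ` of `A`: a `γ`-semilinear map
`u : N' → N` which is homogeneous of degree `j`, and a degree zero map `f : M → M'` with
`f (m γ(a)) = f(m) a`. -/
structure CoeffMap (𝒩 : ℤ → Submodule k N) (ℳ : ℤ → Submodule k M)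
    (𝒩' : ℤ → Submodule k N') (ℳ' : ℤ → Submodule k M') (j : ℤ) where
  γ : A →ₐ[k] A
  u : N' →ₗ[k] N
  f : M →ₗ[k] M'
  γ_mem : ∀ n a, a ∈ 𝒜 n → γ a ∈ 𝒜 n
  u_smul : ∀ (a : A) (x : N'), u (op a • x) = op (γ a) • u x
  u_mem : ∀ p x, x ∈ 𝒩' p → u x ∈ 𝒩 (p + j)
  f_smul : ∀ (a : A) (m : M), f (op (γ a) • m) = op a • f m
  f_mem : ∀ p m, m ∈ ℳ p → f m ∈ ℳ' p

namespace CoeffMap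

variable {𝒜}
variable {𝒩 : ℤ → Submodule k N} {ℳ : ℤ → Submodule k M}
  {𝒩' : ℤ → Submodule k N'} {ℳ' : ℤ → Submodule k M'} {j : ℤ}
  (T : CoeffMap 𝒜 𝒩 ℳ 𝒩' ℳ' j)

/-- The cochain map `φ ↦ f ∘ φ ∘ (u, γ, …, γ)`. -/
def onCochains (n : ℕ) : (N → (Fin n → A) → M) →ₗ[k] (N' → (Fin n → A) → M') where
  toFun φ x a := T.f (φ (T.u x) (fun i => T.γ (a i)))
  map_add' φ ψ := by funext x a; simp
  map_smul' c φ := by funext x a; simp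

theorem onCochains_mem (n : ℕ) (ℓ ℓ' : ℤ) (h : ℓ' = ℓ + j) (φ : N → (Fin n → A) → M)
    (hφ : φ ∈ cochains 𝒜 𝒩 ℳ n ℓ) : T.onCochains n φ ∈ cochains 𝒜 𝒩' ℳ' n ℓ' := by
  obtain ⟨⟨Φ, hΦ⟩, h1⟩ := hφ
  refine ⟨⟨(LinearMap.compMultilinearMapₗ k T.f).comp
    ((MultilinearMap.compLinearMapₗ (fun _ : Fin n => T.γ.toLinearMap)).comp (Φ.comp T.u)),
      fun x a => ?_⟩, fun p d x a hx ha => ?_⟩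
  · simp [onCochains, hΦ]
  · have := T.f_mem _ _ (h1 (p + j) d (T.u x) (fun i => T.γ (a i)) (T.u_mem p x hx)
      (fun i => T.γ_mem _ _ (ha i)))
    have e : p + j + ∑ i, (d i : ℤ) + ℓ = p + ∑ i, (d i : ℤ) + ℓ' := by rw [h]; ring
    rw [e] at this
    exact this

theorem barD_onCochains (n : ℕ) (φ : N → (Fin n → A) → M) :
    barD k A N' M' n (T.onCochains n φ) = T.onCochains (n + 1) (barD k A N M n φ) := by
  funext x a
  have hc : ∀ i : Fin n, (fun r => T.γ (Fin.contractNth i.castSucc (· * ·) a r))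
      = Fin.contractNth i.castSucc (· * ·) (fun r => T.γ (a r)) := by
    intro i
    funext r
    unfold Fin.contractNth
    split_ifs <;> simp
  simp only [barD, onCochains, LinearMap.coe_mk, AddHom.coe_mk, map_add, map_sum, map_smul,
    T.u_smul, T.f_smul, hc]

theorem onCochains_cocycles (n : ℕ) (ℓ ℓ' : ℤ) (h : ℓ' = ℓ + j) (φ : N → (Fin n → A) → M)
    (hφ : φ ∈ cocycles 𝒜 𝒩 ℳ n ℓ) : T.onCochains n φ ∈ cocycles 𝒜 𝒩' ℳ' n ℓ' := by
  refine ⟨T.onCochains_mem n ℓ ℓ' h φ hφ.1, ?_⟩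
  have h2 : barD k A N M n φ = 0 := hφ.2
  change barD k A N' M' n (T.onCochains n φ) = 0
  rw [barD_onCochains, h2, map_zero]

theorem onCochains_coboundaries (n : ℕ) (ℓ ℓ' : ℤ) (h : ℓ' = ℓ + j) (φ : N → (Fin n → A) → M)
    (hφ : φ ∈ coboundaries 𝒜 𝒩 ℳ n ℓ) : T.onCochains n φ ∈ coboundaries 𝒜 𝒩' ℳ' n ℓ' := by
  cases n with
  | zero =>
    have : φ = 0 := hφ
    rw [this, map_zero]
    exact Submodule.zero_mem _
  | succ n =>
    obtain ⟨ψ, hψ, rfl⟩ := hφ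
    exact ⟨T.onCochains n ψ, T.onCochains_mem n ℓ ℓ' h ψ hψ, T.barD_onCochains n ψ⟩

/-- The map induced on graded Ext groups. -/
def onExt (n : ℕ) (ℓ ℓ' : ℤ) (h : ℓ' = ℓ + j) :
    Ext 𝒜 𝒩 ℳ n ℓ →ₗ[k] Ext 𝒜 𝒩' ℳ' n ℓ' :=
  Submodule.mapQ _ _
    ((T.onCochains n).restrict (T.onCochains_cocycles n ℓ ℓ' h))
    (fun x hx => T.onCochains_coboundaries n ℓ ℓ' h x.1 hx)

end CoeffMap

end Ext

section LocalCohomology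

variable {k A : Type*} [Field k] [Ring A] [Algebra k A] (𝒜 : ℕ → Submodule k A)

/-- The grading of `A`, extended by zero to negative degrees. -/
def zgr : ℤ → Submodule k A
  | Int.ofNat n => 𝒜 n
  | Int.negSucc _ => ⊥

/-- The ideal `A_{≥ r}`, as a right ideal. -/
def geq (r : ℕ) : Submodule Aᵐᵒᵖ A := Submodule.span Aᵐᵒᵖ {a | ∃ s, r ≤ s ∧ a ∈ 𝒜 s}

/-- The grading of the right module `A / A_{≥ r}`. -/
def quotGr (r : ℕ) (p : ℤ) : Submodule k (A ⧸ geq 𝒜 r) :=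
  (zgr 𝒜 p).map ((geq 𝒜 r).mkQ.restrictScalars k)

variable {𝒜} in
/-- The map `A / A_{≥ r'} → A / A_{≥ r}` induced by a `k`-linear map `A → A`. -/
def quotMap {r' r : ℕ} (F : A →ₗ[k] A) (hF : ∀ x ∈ geq 𝒜 r', F x ∈ geq 𝒜 r) :
    (A ⧸ geq 𝒜 r') →ₗ[k] (A ⧸ geq 𝒜 r) :=
  ((Submodule.Quotient.restrictScalarsEquiv k (geq 𝒜 r)).toLinearMap.comp
    (Submodule.mapQ ((geq 𝒜 r').restrictScalars k) ((geq 𝒜 r).restrictScalars k) F hF)).comp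
    (Submodule.Quotient.restrictScalarsEquiv k (geq 𝒜 r')).symm.toLinearMap

variable {𝒜} in
theorem quotMap_mk {r' r : ℕ} (F : A →ₗ[k] A) (hF : ∀ x ∈ geq 𝒜 r', F x ∈ geq 𝒜 r) (x : A) :
    quotMap F hF (Submodule.Quotient.mk x) = Submodule.Quotient.mk (F x) := rfl

theorem geq_anti {r r' : ℕ} (h : r ≤ r') : geq 𝒜 r' ≤ geq 𝒜 r :=
  Submodule.span_mono fun _ ⟨s, hs, ha⟩ => ⟨s, h.trans hs, ha⟩

theorem mul_zgr [SetLike.GradedMonoid 𝒜] {j : ℕ} {a b : A} (ha : a ∈ 𝒜 j) {p : ℤ}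
    (hb : b ∈ zgr 𝒜 p) : a * b ∈ zgr 𝒜 (p + j) := by
  cases p with
  | ofNat n =>
    have : a * b ∈ 𝒜 (n + j) := by rw [add_comm]; exact SetLike.mul_mem_graded ha hb
    exact this
  | negSucc n =>
    have : b = 0 := hb
    rw [this, mul_zero]
    exact Submodule.zero_mem _

theorem mul_geq [SetLike.GradedMonoid 𝒜] {j : ℕ} {a : A} (ha : a ∈ 𝒜 j) (r : ℕ) :
    ∀ x ∈ geq 𝒜 r, a * x ∈ geq 𝒜 r := by
  intro x hx
  induction hx using Submodule.span_induction with
  | mem x h =>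
    obtain ⟨s, hs, hx⟩ := h
    exact Submodule.subset_span ⟨j + s, by omega, SetLike.mul_mem_graded ha hx⟩
  | zero => rw [mul_zero]; exact Submodule.zero_mem _
  | add x y _ _ h1 h2 => rw [mul_add]; exact Submodule.add_mem _ h1 h2
  | smul b x _ h => rw [mul_smul_comm]; exact Submodule.smul_mem _ b h

/-- A graded automorphism of `A`: a `k`-algebra automorphism with `g(A_n) = A_n` for all `n`. -/
structure GradedAut where
  toEquiv : A ≃ₐ[k] A
  mem_iff : ∀ n a, toEquiv a ∈ 𝒜 n ↔ a ∈ 𝒜 n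

variable {𝒜} in
theorem GradedAut.symm_mem (g : GradedAut 𝒜) (n : ℕ) (a : A) (ha : a ∈ 𝒜 n) :
    g.toEquiv.symm a ∈ 𝒜 n := by
  rw [← g.mem_iff]; simpa using ha

variable {𝒜} in
theorem GradedAut.zgr_mem (g : GradedAut 𝒜) (p : ℤ) (a : A) (ha : a ∈ zgr 𝒜 p) :
    g.toEquiv a ∈ zgr 𝒜 p := by
  cases p with
  | ofNat n => exact (g.mem_iff n a).2 ha
  | negSucc n =>
    have : a = 0 := ha
    rw [this, map_zero]; exact Submodule.zero_mem _

variable {𝒜} in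
theorem GradedAut.symm_zgr_mem (g : GradedAut 𝒜) (p : ℤ) (a : A) (ha : a ∈ zgr 𝒜 p) :
    g.toEquiv.symm a ∈ zgr 𝒜 p := by
  cases p with
  | ofNat n => exact g.symm_mem n a ha
  | negSucc n =>
    have : a = 0 := ha
    rw [this, map_zero]; exact Submodule.zero_mem _

variable {𝒜} in
theorem GradedAut.symm_geq (g : GradedAut 𝒜) (r : ℕ) :
    ∀ x ∈ geq 𝒜 r, g.toEquiv.symm x ∈ geq 𝒜 r := by
  intro x hx
  induction hx using Submodule.span_induction with
  | mem x h =>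
    obtain ⟨s, hs, hx⟩ := h
    exact Submodule.subset_span ⟨s, hs, g.symm_mem s x hx⟩
  | zero => rw [map_zero]; exact Submodule.zero_mem _
  | add x y _ _ h1 h2 => rw [map_add]; exact Submodule.add_mem _ h1 h2
  | smul b x _ h =>
    have : g.toEquiv.symm (b • x) = op (g.toEquiv.symm b.unop) • g.toEquiv.symm x := by
      rw [← MulOpposite.op_unop b]; simp
    rw [this]; exact Submodule.smul_mem _ _ h

variable {M : Type*} [AddCommGroup M] [Module k M] [Module Aᵐᵒᵖ M] [IsScalarTower k Aᵐᵒᵖ M]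
  (ℳ : ℤ → Submodule k M)

/-- The projection `A / A_{≥ r'} → A / A_{≥ r}` for `r ≤ r'`, as a change of coefficients. -/
def projCoeff {r r' : ℕ} (h : r ≤ r') :
    CoeffMap 𝒜 (quotGr 𝒜 r) ℳ (quotGr 𝒜 r') ℳ 0 where
  γ := AlgHom.id k A
  u := quotMap LinearMap.id (geq_anti 𝒜 h)
  f := LinearMap.id
  γ_mem _ _ ha := ha
  u_smul a x := by
    induction x using Submodule.Quotient.induction_on with
    | _ x => rfl
  u_mem p x hx := by
    obtain ⟨y, hy, rfl⟩ := hx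
    rw [add_zero]
    exact ⟨y, hy, rfl⟩
  f_smul _ _ := rfl
  f_mem _ _ hm := hm

/-- Left multiplication by `a ∈ A_j` on `A / A_{≥ r}`, as a change of coefficients. -/
def mulCoeff [SetLike.GradedMonoid 𝒜] {j : ℕ} {a : A} (ha : a ∈ 𝒜 j) (r : ℕ) :
    CoeffMap 𝒜 (quotGr 𝒜 r) ℳ (quotGr 𝒜 r) ℳ (j : ℤ) where
  γ := AlgHom.id k A
  u := quotMap (LinearMap.mulLeft k a) (mul_geq 𝒜 ha r)
  f := LinearMap.id
  γ_mem _ _ ha := ha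
  u_smul b x := by
    induction x using Submodule.Quotient.induction_on with
    | _ x =>
      change Submodule.Quotient.mk (a * (x * b)) = Submodule.Quotient.mk ((a * x) * b)
      rw [mul_assoc]
  u_mem p x hx := by
    obtain ⟨y, hy, rfl⟩ := hx
    exact ⟨a * y, mul_zgr 𝒜 ha hy, rfl⟩
  f_smul _ _ := rfl
  f_mem _ _ hm := hm

variable {𝒜} in
/-- A graded `g`-linear endomorphism `f` of a graded right `A`-module `M`:
`f (m a) = f(m) g(a)`. -/
structure TwistedEnd (g : GradedAut 𝒜) where
  toMap : M →ₗ[k] M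
  map_smul : ∀ (a : A) (m : M), toMap (op a • m) = op (g.toEquiv a) • toMap m
  map_mem : ∀ p m, m ∈ ℳ p → toMap m ∈ ℳ p

variable {𝒜} {ℳ} in
/-- For a `g`-linear `f : M → M`, the pair of `g⁻¹ : A / A_{≥ r} → A / A_{≥ r}` and `f`.  On Ext it
induces the composite of `f_* : Ext(A / A_{≥ r}, M) → Ext(A / A_{≥ r}, M^g)` with the
identification of `Ext(A / A_{≥ r}, M^g)` and `Ext(A / A_{≥ r}, M)^g` given by `g`. -/
def TwistedEnd.coeff {g : GradedAut 𝒜} (f : TwistedEnd ℳ g) (r : ℕ) :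
    CoeffMap 𝒜 (quotGr 𝒜 r) ℳ (quotGr 𝒜 r) ℳ 0 where
  γ := g.toEquiv.symm
  u := quotMap g.toEquiv.symm.toLinearMap (g.symm_geq r)
  f := f.toMap
  γ_mem := g.symm_mem
  u_smul a x := by
    induction x using Submodule.Quotient.induction_on with
    | _ x =>
      change Submodule.Quotient.mk (g.toEquiv.symm (x * a)) =
        Submodule.Quotient.mk (g.toEquiv.symm x * g.toEquiv.symm a)
      rw [map_mul]
  u_mem p x hx := by
    obtain ⟨y, hy, rfl⟩ := hx
    rw [add_zero]
    exact ⟨_, g.symm_zgr_mem p y hy, rfl⟩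
  f_smul a m := by simpa using f.map_smul (g.toEquiv.symm a) m
  f_mem := f.map_mem

/-- The transition maps `Ext^n(A / A_{≥ r}, M)_ℓ → Ext^n(A / A_{≥ r'}, M)_ℓ`. -/
def trans (n : ℕ) (ℓ : ℤ) (r r' : ℕ) (h : r ≤ r') :
    Ext 𝒜 (quotGr 𝒜 r) ℳ n ℓ →ₗ[k] Ext 𝒜 (quotGr 𝒜 r') ℳ n ℓ :=
  (projCoeff 𝒜 ℳ h).onExt n ℓ ℓ (add_zero ℓ).symm

/-- The degree `ℓ` piece of the local cohomology module
`H^n_𝔪(M) = colim_r \underline{Ext}^n_A(A / A_{≥ r}, M)`, where `𝔪 = A_{≥ 1}`. -/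
abbrev LocalCohomology (n : ℕ) (ℓ : ℤ) : Type _ :=
  Module.DirectLimit (fun r : ℕ => Ext 𝒜 (quotGr 𝒜 r) ℳ n ℓ) (trans 𝒜 ℳ n ℓ)

/-- The right `A`-module structure of `H^n_𝔪(M)`: the map `H^n_𝔪(M)_ℓ → H^n_𝔪(M)_{ℓ + j}`,
`x ↦ x a`, for `a ∈ A_j`.  It is induced by left multiplication with `a` on `A / A_{≥ r}`. -/
def LocalCohomology.act [SetLike.GradedMonoid 𝒜] {j : ℕ} {a : A} (ha : a ∈ 𝒜 j) (n : ℕ) (ℓ : ℤ) :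
    LocalCohomology 𝒜 ℳ n ℓ →ₗ[k] LocalCohomology 𝒜 ℳ n (ℓ + j) :=
  Module.DirectLimit.map (fun r => (mulCoeff 𝒜 ℳ ha r).onExt n ℓ (ℓ + j) rfl) (by
    intro r r' h
    ext φ
    apply congrArg (Submodule.Quotient.mk)
    apply Subtype.ext
    funext x b
    induction x using Submodule.Quotient.induction_on with
    | _ x => rfl)

variable {𝒜} {ℳ} in
/-- The map `H^n_𝔪(f)` in degree `ℓ`, for a graded `g`-linear `f : M → M`. -/
def TwistedEnd.onCohomology {g : GradedAut 𝒜} (f : TwistedEnd ℳ g) (n : ℕ) (ℓ : ℤ) :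
    LocalCohomology 𝒜 ℳ n ℓ →ₗ[k] LocalCohomology 𝒜 ℳ n ℓ :=
  Module.DirectLimit.map (fun r => (f.coeff r).onExt n ℓ ℓ (add_zero ℓ).symm) (by
    intro r r' h
    ext φ
    apply congrArg (Submodule.Quotient.mk)
    apply Subtype.ext
    funext x b
    induction x using Submodule.Quotient.induction_on with
    | _ x => rfl)

variable {𝒜} {ℳ} in
/-- The coefficient of `t^j` in the trace series `Tr_M(f, t) = ∑_j tr(f|_{M_j}) t^j`. -/
def TwistedEnd.trCoeff {g : GradedAut 𝒜} (f : TwistedEnd ℳ g) (j : ℤ) : k :=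
  LinearMap.trace k (ℳ j) (f.toMap.restrict (f.map_mem j))

variable {𝒜} {ℳ} in
/-- The coefficient of `t^j` in `Br_M(f, t) = ∑_i (-1)^i Tr_{H^i_𝔪(M)}(H^i_𝔪(f), t)`. -/
def TwistedEnd.brCoeff {g : GradedAut 𝒜} (f : TwistedEnd ℳ g) (j : ℤ) : k :=
  ∑ᶠ i : ℕ, (-1 : k) ^ i * LinearMap.trace k (LocalCohomology 𝒜 ℳ i j) (f.onCohomology i j)

/-- `M` is left bounded and locally finite, so that `Tr_M(f, t)` is defined. -/
def TrDefined (ℳ : ℤ → Submodule k M) : Prop :=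
  (∃ P : ℤ, ∀ p ≤ P, ℳ p = ⊥) ∧ ∀ p, Module.Finite k (ℳ p)

/-- `H^i_𝔪(M)` is zero for large `i`, and each `H^i_𝔪(M)` is locally finite and right bounded, so
that `Br_M(f, t)` is defined. -/
def BrDefined : Prop :=
  (∃ n₀ : ℕ, ∀ n ≥ n₀, ∀ p, Subsingleton (LocalCohomology 𝒜 ℳ n p)) ∧
  ∀ n, (∀ p, Module.Finite k (LocalCohomology 𝒜 ℳ n p)) ∧
    ∃ P : ℤ, ∀ p ≥ P, Subsingleton (LocalCohomology 𝒜 ℳ n p)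

end LocalCohomology

section Hdet

variable {k A : Type*} [Field k] [Ring A] [Algebra k A] {𝒜 : ℕ → Submodule k A}

/-- The automorphism `g` itself, as a `g`-linear endomorphism of the right module `A`. -/
def GradedAut.regular (g : GradedAut 𝒜) : TwistedEnd (zgr 𝒜) g where
  toMap := g.toEquiv.toLinearMap
  map_smul a m := by simp
  map_mem := g.zgr_mem

/-- The right module `e A`. -/
def eA (e : A) : Submodule Aᵐᵒᵖ A := Submodule.span Aᵐᵒᵖ {e}

variable (𝒜) in
/-- The grading `(e A)_p = e A ∩ A_p` of `e A`. -/
def eAGr (e : A) (p : ℤ) : Submodule k (eA e) :=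
  (zgr 𝒜 p).comap ((eA e).subtype.restrictScalars k)

theorem GradedAut.eA_mem (g : GradedAut 𝒜) {e : A} (he : g.toEquiv e = e) (x : A) (hx : x ∈ eA e) :
    g.toEquiv x ∈ eA e := by
  obtain ⟨b, rfl⟩ := Submodule.mem_span_singleton.1 hx
  refine Submodule.mem_span_singleton.2 ⟨op (g.toEquiv b.unop), ?_⟩
  rw [← MulOpposite.op_unop b]
  simp [he]

/-- The restriction of `g` to `e A`, when `g(e) = e`. -/
def GradedAut.onEA (g : GradedAut 𝒜) (e : A) (he : g.toEquiv e = e) : TwistedEnd (eAGr 𝒜 e) g where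
  toMap :=
    { toFun := fun x => ⟨g.toEquiv x, g.eA_mem he x x.2⟩
      map_add' := fun x y => Subtype.ext (by simp)
      map_smul' := fun c x => Subtype.ext (by simp) }
  map_smul a m := Subtype.ext (by simp)
  map_mem p m hm := g.zgr_mem p m hm

/-- Let `e_v` (`v ∈ V`) be the primitive idempotents of `A`.  `HasHdetScalars e g N s μ` says that
there is an isomorphism `θ : H^N_𝔪(A) ≅ A^∨[s]` of graded right `A`-modules, where
`A^∨ = ⨁_p Hom_k(A_{-p}, k)` is the graded dual with `(φ a)(b) = φ(a b)`, such that under `θ` the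
map `H^N_𝔪(g)` becomes `μ_v (g⁻¹)^*` on the summand `e_v A^∨ = \underline{Hom}_k(A e_v, k)`, for
each `v`. -/
def HasHdetScalars [SetLike.GradedMonoid 𝒜] {V : Type*} (e : V → A) (g : GradedAut 𝒜)
    (N : ℕ) (s : ℤ) (μ : V → kˣ) : Prop :=
  ∃ θ : ∀ p : ℤ, LocalCohomology 𝒜 (zgr 𝒜) N p ≃ₗ[k] Module.Dual k (zgr 𝒜 (-(p + s))),
    -- `θ (x a) = θ(x) a`
    (∀ (j : ℕ) (a : A) (ha : a ∈ 𝒜 j) (p : ℤ) (x : LocalCohomology 𝒜 (zgr 𝒜) N p) (b : A)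
      (hb : b ∈ zgr 𝒜 (-(p + j + s))) (hab : a * b ∈ zgr 𝒜 (-(p + s))),
      θ (p + j) (LocalCohomology.act 𝒜 (zgr 𝒜) ha N p x) ⟨b, hb⟩ = θ p x ⟨a * b, hab⟩) ∧
    -- `θ (H(g) x) = μ_v • (θ(x) ∘ g⁻¹)` on `A e_v`
    ∀ (v : V) (p : ℤ) (x : LocalCohomology 𝒜 (zgr 𝒜) N p) (b : A) (hb : b ∈ zgr 𝒜 (-(p + s))),
      b * e v = b →
      θ p (g.regular.onCohomology N p x) ⟨b, hb⟩
        = (μ v : k) * θ p x ⟨g.toEquiv.symm b, g.symm_zgr_mem _ b hb⟩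

/-- `D` is a homological determinant of `g`: the diagonal matrix of the inverses of the scalars. -/
def IsHdet [SetLike.GradedMonoid 𝒜] {V : Type*} [DecidableEq V] (e : V → A) (g : GradedAut 𝒜)
    (N : ℕ) (s : ℤ) (D : Matrix V V k) : Prop :=
  ∃ μ : V → kˣ, HasHdetScalars e g N s μ ∧ D = Matrix.diagonal fun v => ((μ v : k))⁻¹

open Classical in
/-- The homological determinant `Hdet(g)`; it is given the value zero if the isomorphism and the
scalars defining it do not exist. -/
def Hdet [SetLike.GradedMonoid 𝒜] {V : Type*} [DecidableEq V] (e : V → A) (g : GradedAut 𝒜)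
    (N : ℕ) (s : ℤ) : Matrix V V k :=
  if h : ∃ D, IsHdet e g N s D then h.choose else 0

end Hdet

section Expansion

variable {k : Type*} [Field k]

/-- The formal series `∑_j c_j t^j` is the expansion of the rational function `R` in `k((t))`. -/
def IsExpansionAtZero (R : RatFunc k) (c : ℤ → k) : Prop :=
  ∀ j : ℤ, (R : LaurentSeries k).coeff j = c j

/-- The formal series `∑_j c_j t^j` is the expansion of the rational function `R` in `k((t⁻¹))`:
the Laurent series of `R(u⁻¹)` in the variable `u = t⁻¹` has the coefficients `c_{-j}`. -/
def IsExpansionAtInfty (R : RatFunc k) (c : ℤ → k) : Prop :=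
  ∀ j : ℤ, ((RatFunc.eval RatFunc.C (RatFunc.X)⁻¹ R : RatFunc k) : LaurentSeries k).coeff j = c (-j)

end Expansion

end GradedRight

/-! ## Preprojective algebras -/

/-- A quiver with set of vertices `V` and set of arrows `E`. -/
structure FinQuiver (V E : Type*) where
  src : E → V
  tgt : E → V

namespace FinQuiver

variable {V E : Type*}

/-- The double of `Q`: the arrow `inl α` is `α`, the arrow `inr α` is `α^*`. -/
def double (Q : FinQuiver V E) : FinQuiver V (E ⊕ E) where
  src := Sum.elim Q.src Q.tgt
  tgt := Sum.elim Q.tgt Q.src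

/-- The underlying graph of `Q` is the multigraph with vertices `0, …, n-1` and edge list `L`. -/
def HasShape (Q : FinQuiver V E) (n : ℕ) (L : List (ℕ × ℕ)) : Prop :=
  ∃ (v : V ≃ Fin n) (e : E ≃ Fin L.length), ∀ α : E,
    s((v (Q.src α) : ℕ), (v (Q.tgt α) : ℕ)) = s((L.get (e α)).1, (L.get (e α)).2)

/-- `Q` is an extended Dynkin quiver: its underlying graph is of type `Ã_{n-1}` with `n ≥ 2`
(a cycle with `n` vertices, which is a double edge for `n = 2`), of type `D̃_{n-1}` with `n ≥ 5`,
or of type `Ẽ_6`, `Ẽ_7`, `Ẽ_8`. -/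
def IsExtendedDynkin (Q : FinQuiver V E) : Prop :=
  (∃ n, 2 ≤ n ∧ Q.HasShape n ((List.range n).map fun i => (i, (i + 1) % n))) ∨
  (∃ n, 5 ≤ n ∧ Q.HasShape n
    ((0, 2) :: (n - 3, n - 1) :: (List.range (n - 3)).map fun i => (i + 1, i + 2))) ∨
  Q.HasShape 7 [(0, 1), (1, 2), (2, 3), (3, 4), (2, 5), (5, 6)] ∨
  Q.HasShape 8 [(0, 1), (1, 2), (2, 3), (3, 4), (4, 5), (5, 6), (3, 7)] ∨
  Q.HasShape 9 [(0, 1), (1, 2), (2, 3), (3, 4), (4, 5), (5, 6), (6, 7), (5, 8)]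

end FinQuiver

section PathAlgebra

variable (k : Type*) [Field k] {V E : Type*} [Fintype V]

/-- The relations of the path algebra: the trivial paths `e_v` are orthogonal idempotents with sum
`1`, and `e_{s(α)} α = α = α e_{t(α)}` for each arrow `α`. -/
inductive PathRel (Q : FinQuiver V E) : FreeAlgebra k (V ⊕ E) → FreeAlgebra k (V ⊕ E) → Prop
  | idem (v : V) : PathRel Q (FreeAlgebra.ι k (Sum.inl v) * FreeAlgebra.ι k (Sum.inl v))
      (FreeAlgebra.ι k (Sum.inl v))
  | orth (v w : V) (h : v ≠ w) :
      PathRel Q (FreeAlgebra.ι k (Sum.inl v) * FreeAlgebra.ι k (Sum.inl w)) 0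
  | one : PathRel Q (∑ v, FreeAlgebra.ι k (Sum.inl v)) 1
  | src (α : E) : PathRel Q (FreeAlgebra.ι k (Sum.inl (Q.src α)) * FreeAlgebra.ι k (Sum.inr α))
      (FreeAlgebra.ι k (Sum.inr α))
  | tgt (α : E) : PathRel Q (FreeAlgebra.ι k (Sum.inr α) * FreeAlgebra.ι k (Sum.inl (Q.tgt α)))
      (FreeAlgebra.ι k (Sum.inr α))

/-- The path algebra `kQ`; paths are composed from left to right. -/
def PathAlgebra (Q : FinQuiver V E) : Type _ := RingQuot (PathRel k Q)

instance (Q : FinQuiver V E) : Ring (PathAlgebra k Q) :=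
  inferInstanceAs (Ring (RingQuot (PathRel k Q)))

instance (Q : FinQuiver V E) : Algebra k (PathAlgebra k Q) :=
  inferInstanceAs (Algebra k (RingQuot (PathRel k Q)))

/-- The class of a generator in the path algebra. -/
def PathAlgebra.gen (Q : FinQuiver V E) (x : V ⊕ E) : PathAlgebra k Q :=
  RingQuot.mkAlgHom k (PathRel k Q) (FreeAlgebra.ι k x)

variable [Fintype E]

/-- The single relation `∑_α (α α^* - α^* α) = 0` on the path algebra of the double of `Q`. -/
inductive PreprojRel (Q : FinQuiver V E) : PathAlgebra k Q.double → PathAlgebra k Q.double → Prop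
  | rel : PreprojRel Q
      (∑ α : E, (PathAlgebra.gen k Q.double (Sum.inr (Sum.inl α)) *
          PathAlgebra.gen k Q.double (Sum.inr (Sum.inr α)) -
        PathAlgebra.gen k Q.double (Sum.inr (Sum.inr α)) *
          PathAlgebra.gen k Q.double (Sum.inr (Sum.inl α)))) 0

/-- The preprojective algebra `Π(Q)`. -/
def Preproj (Q : FinQuiver V E) : Type _ := RingQuot (PreprojRel k Q)

instance (Q : FinQuiver V E) : Ring (Preproj k Q) :=
  inferInstanceAs (Ring (RingQuot (PreprojRel k Q)))

instance (Q : FinQuiver V E) : Algebra k (Preproj k Q) :=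
  inferInstanceAs (Algebra k (RingQuot (PreprojRel k Q)))

namespace Preproj

/-- The quotient map from the path algebra of the double of `Q`. -/
def mk (Q : FinQuiver V E) : PathAlgebra k Q.double →ₐ[k] Preproj k Q :=
  RingQuot.mkAlgHom k (PreprojRel k Q)

/-- The idempotent `e_v`. -/
def vert (Q : FinQuiver V E) (v : V) : Preproj k Q := mk k Q (PathAlgebra.gen k Q.double (Sum.inl v))

/-- The arrows of the double of `Q`, in `Π(Q)`. -/
def dbl (Q : FinQuiver V E) (β : E ⊕ E) : Preproj k Q :=
  mk k Q (PathAlgebra.gen k Q.double (Sum.inr β))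

/-- The arrow `α`. -/
def arrow (Q : FinQuiver V E) (α : E) : Preproj k Q := dbl k Q (Sum.inl α)

/-- The arrow `α^*`. -/
def star (Q : FinQuiver V E) (α : E) : Preproj k Q := dbl k Q (Sum.inr α)

/-- The span of the trivial paths. -/
def deg0 (Q : FinQuiver V E) : Submodule k (Preproj k Q) := Submodule.span k (Set.range (vert k Q))

/-- The span of the arrows of the double of `Q`. -/
def deg1 (Q : FinQuiver V E) : Submodule k (Preproj k Q) := Submodule.span k (Set.range (dbl k Q))

/-- The grading of `Π(Q)` by path length: `A_n` is spanned by the classes of the products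
`e_v β₁ ⋯ βₙ` with `n` arrows, that is, by the paths of length `n` of the double of `Q`. -/
def grading (Q : FinQuiver V E) (n : ℕ) : Submodule k (Preproj k Q) := deg0 k Q * deg1 k Q ^ n

theorem vert_idem (Q : FinQuiver V E) (v : V) : vert k Q v * vert k Q v = vert k Q v := by
  have h := RingQuot.mkAlgHom_rel k (PathRel.idem (k := k) (Q := Q.double) v)
  rw [map_mul] at h
  have h2 := congrArg (mk k Q) h
  exact (map_mul (mk k Q) _ _).symm.trans h2

theorem vert_orth (Q : FinQuiver V E) {v w : V} (hvw : v ≠ w) : vert k Q v * vert k Q w = 0 := by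
  have h := RingQuot.mkAlgHom_rel k (PathRel.orth (k := k) (Q := Q.double) v w hvw)
  rw [map_mul, map_zero] at h
  have h2 := congrArg (mk k Q) h
  exact (map_mul (mk k Q) _ _).symm.trans (h2.trans (map_zero (mk k Q)))

theorem sum_vert (Q : FinQuiver V E) : ∑ v, vert k Q v = 1 := by
  have h := RingQuot.mkAlgHom_rel k (PathRel.one (k := k) (Q := Q.double))
  rw [map_sum, map_one] at h
  have h2 := congrArg (mk k Q) h
  exact (map_sum (mk k Q) _ _).symm.trans (h2.trans (map_one (mk k Q)))

theorem vert_dbl (Q : FinQuiver V E) (β : E ⊕ E) :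
    vert k Q (Q.double.src β) * dbl k Q β = dbl k Q β := by
  have h := RingQuot.mkAlgHom_rel k (PathRel.src (k := k) (Q := Q.double) β)
  rw [map_mul] at h
  have h2 := congrArg (mk k Q) h
  exact (map_mul (mk k Q) _ _).symm.trans h2

theorem dbl_vert (Q : FinQuiver V E) (β : E ⊕ E) :
    dbl k Q β * vert k Q (Q.double.tgt β) = dbl k Q β := by
  have h := RingQuot.mkAlgHom_rel k (PathRel.tgt (k := k) (Q := Q.double) β)
  rw [map_mul] at h
  have h2 := congrArg (mk k Q) h
  exact (map_mul (mk k Q) _ _).symm.trans h2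

theorem one_mem_deg0 (Q : FinQuiver V E) : (1 : Preproj k Q) ∈ deg0 k Q := by
  rw [← sum_vert]
  exact Submodule.sum_mem _ fun v _ => Submodule.subset_span ⟨v, rfl⟩

theorem deg0_mul_deg0 (Q : FinQuiver V E) : deg0 k Q * deg0 k Q = deg0 k Q := by
  apply le_antisymm
  · rw [deg0, Submodule.span_mul_span, Submodule.span_le]
    rintro _ ⟨_, ⟨v, rfl⟩, _, ⟨w, rfl⟩, rfl⟩
    by_cases h : v = w
    · subst h
      change vert k Q v * vert k Q v ∈ _
      rw [vert_idem]
      exact Submodule.subset_span ⟨v, rfl⟩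
    · change vert k Q v * vert k Q w ∈ _
      rw [vert_orth k Q h]
      exact Submodule.zero_mem _
  · intro x hx
    simpa using Submodule.mul_mem_mul (one_mem_deg0 k Q) hx

theorem vert_mul_dbl_mem (Q : FinQuiver V E) (v : V) (β : E ⊕ E) :
    vert k Q v * dbl k Q β ∈ deg1 k Q := by
  rw [← vert_dbl, ← mul_assoc]
  by_cases h : v = Q.double.src β
  · rw [h, vert_idem, vert_dbl]
    exact Submodule.subset_span ⟨β, rfl⟩
  · rw [vert_orth k Q h, zero_mul]
    exact Submodule.zero_mem _

theorem dbl_mul_vert_mem (Q : FinQuiver V E) (v : V) (β : E ⊕ E) :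
    dbl k Q β * vert k Q v ∈ deg1 k Q := by
  rw [← dbl_vert, mul_assoc]
  by_cases h : Q.double.tgt β = v
  · rw [h, vert_idem, ← h, dbl_vert]
    exact Submodule.subset_span ⟨β, rfl⟩
  · rw [vert_orth k Q h, mul_zero]
    exact Submodule.zero_mem _

theorem deg0_mul_deg1 (Q : FinQuiver V E) : deg0 k Q * deg1 k Q = deg1 k Q := by
  apply le_antisymm
  · rw [deg0, deg1, Submodule.span_mul_span, Submodule.span_le]
    rintro _ ⟨_, ⟨v, rfl⟩, _, ⟨β, rfl⟩, rfl⟩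
    exact vert_mul_dbl_mem k Q v β
  · intro x hx
    simpa using Submodule.mul_mem_mul (one_mem_deg0 k Q) hx

theorem deg1_mul_deg0 (Q : FinQuiver V E) : deg1 k Q * deg0 k Q = deg1 k Q := by
  apply le_antisymm
  · rw [deg0, deg1, Submodule.span_mul_span, Submodule.span_le]
    rintro _ ⟨_, ⟨β, rfl⟩, _, ⟨v, rfl⟩, rfl⟩
    exact dbl_mul_vert_mem k Q v β
  · intro x hx
    simpa using Submodule.mul_mem_mul hx (one_mem_deg0 k Q)

theorem deg0_mul_pow_mul_deg0 (Q : FinQuiver V E) (n : ℕ) :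
    deg0 k Q * deg1 k Q ^ n * deg0 k Q = deg0 k Q * deg1 k Q ^ n := by
  cases n with
  | zero => rw [pow_zero, mul_one, deg0_mul_deg0]
  | succ n => rw [pow_succ, mul_assoc, mul_assoc, deg1_mul_deg0]

instance (Q : FinQuiver V E) : SetLike.GradedMonoid (grading k Q) where
  one_mem := by
    rw [grading, pow_zero, mul_one]
    exact one_mem_deg0 k Q
  mul_mem i j a b ha hb := by
    have h := Submodule.mul_mem_mul ha hb
    rw [grading, grading, ← mul_assoc, deg0_mul_pow_mul_deg0, mul_assoc, ← pow_add] at h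
    exact h

end Preproj

end PathAlgebra

/-! The proof shows that `g` multiplies the preprojective relation by a single scalar `q = c_α t_α`,
that `Hdet(g)` is `q` times the identity, and that the two trace series expand one and the same
rational function. The factor in the formula is thus equal to `1`.

Everything rests on the Koszul complex `A → ⨁_β A e_{t(β)} → A`, where `β` runs over the arrows of
the double, with maps `x ↦ (x β)_β` and `(y_β) ↦ ∑ ± y_β β^*`; the cokernel of the last map is
`A_0`. Exactness in the middle holds for every quiver (`exists_eq_mul_dbl`): the universal property
makes `A` act on an extension of `k^V` by the cokernel of the first map, and a syzygy applied to
`(0, 1)` becomes its own class in that cokernel. Exactness on the left says that `A` has no socle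
(`eq_zero_of_mul_dbl`), and this is where the graph enters. A socle element of least degree `N` in
`e_i A` gives an endomorphism of `e_i A` in the degrees `N`, `N + 1` which is nonzero on the first
and zero on the second. Middle exactness carries such endomorphisms down to degree zero, so they are
scalars and `e_i A_{N+1} = 0`. But the positive vector `δ` in the radical of the Tits form gives
`e_i A_{N+1}` the weighted dimension `(N + 2) δ_i`, which is nonzero in characteristic zero.

Applying `g` to `e_v` times the relation gives another relation among the arrows at `v`. By
exactness it is proportional to the first, so `c_α t_α` is constant around each vertex, and
connectedness makes it constant (`scalesArrows_of_connected`).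

Traces of `g` along the Koszul complex give a three-term recursion (`cornerTrace_recursion`): the
matrix `P(t)` of traces on `e_i A e_j` is inverse to `1 - C t + q t²`. For `g⁻¹` the scalar is `q⁻¹`
and the matrix is `q⁻¹ Cᵀ`, whence the functional equation `P(t⁻¹) = q⁻¹ t² P'(t)ᵀ`
(`exists_rational_resolvent`).

Local cohomology is computed with bar cochains on `A` that vanish on `A_{≥ r}`. A contraction of the
right Koszul complex computes the case `r = 1`, and an induction on `r` does the rest. For `M = A`
and `M = e_i A` only `H²` survives, and the residue `x ↦ ∑_β z(x, b_β, b'_β)` identifies `H²(M)_ℓ`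
with the maps `A_{-ℓ-2} → M_0` compatible with the idempotents (`exists_residueEquiv`). As `b_β ⊗
b'_β` is scaled by `q`, the induced map on residues is `φ ↦ q⁻¹ f φ g⁻¹` (`residue_conj`). For `M =
A` this gives `λ_v = q⁻¹`. For `M = e_i A` it makes the coefficient of `t^p` in `Br` equal to `q⁻¹
∑_v tr(g⁻¹ | e_v A_{-p-2} e_i)`, exactly what the functional equation gives for the expansion of
`Tr` at infinity. -/

namespace Preproj

/-! ### Universal property of the preprojective algebra -/

section Universal

variable {k : Type*} [Field k] {V E : Type*} [Fintype V] [Fintype E] (Q : FinQuiver V E)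

/-- The defining relations of the preprojective algebra, for elements of an algebra. -/
structure Rels {B : Type*} [Ring B] [Algebra k B] (e : V → B) (d : E ⊕ E → B) : Prop where
  idem : ∀ v, e v * e v = e v
  orth : ∀ v w, v ≠ w → e v * e w = 0
  one : ∑ v, e v = 1
  src : ∀ β, e (Q.double.src β) * d β = d β
  tgt : ∀ β, d β * e (Q.double.tgt β) = d β
  rel : ∑ α : E, (d (Sum.inl α) * d (Sum.inr α) - d (Sum.inr α) * d (Sum.inl α)) = 0

variable {Q}
variable {B : Type*} [Ring B] [Algebra k B] {e : V → B} {d : E ⊕ E → B}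

/-- The algebra map out of the path algebra of the double given by elements satisfying the
relations. -/
def pathLift (h : Rels (k := k) Q e d) : PathAlgebra k Q.double →ₐ[k] B :=
  RingQuot.liftAlgHom k (s := PathRel k Q.double) ⟨FreeAlgebra.lift k (Sum.elim e d), by
    intro x y hxy
    induction hxy with
    | idem v => simpa using h.idem v
    | orth v w hvw => simpa using h.orth v w hvw
    | one => simpa using h.one
    | src α => simpa using h.src α
    | tgt α => simpa using h.tgt α⟩

theorem pathLift_gen (h : Rels (k := k) Q e d) (x : V ⊕ (E ⊕ E)) :
    pathLift h (PathAlgebra.gen k Q.double x) = Sum.elim e d x := by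
  have := RingQuot.liftAlgHom_mkAlgHom_apply (S := k) (FreeAlgebra.lift k (Sum.elim e d))
    (s := PathRel k Q.double) (w := by
    intro x y hxy
    induction hxy with
    | idem v => simpa using h.idem v
    | orth v w hvw => simpa using h.orth v w hvw
    | one => simpa using h.one
    | src α => simpa using h.src α
    | tgt α => simpa using h.tgt α) (FreeAlgebra.ι k x)
  rw [FreeAlgebra.lift_ι_apply] at this
  exact this

/-- The universal property of the preprojective algebra. -/
def lift (h : Rels (k := k) Q e d) : Preproj k Q →ₐ[k] B :=
  RingQuot.liftAlgHom k (s := PreprojRel k Q) ⟨pathLift h, by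
    intro x y hxy
    induction hxy with
    | rel => simpa [pathLift_gen] using h.rel⟩

theorem lift_mk (h : Rels (k := k) Q e d) (x : PathAlgebra k Q.double) :
    lift h (mk k Q x) = pathLift h x :=
  RingQuot.liftAlgHom_mkAlgHom_apply (S := k) (pathLift h) (s := PreprojRel k Q) _ x

@[simp] theorem lift_vert (h : Rels (k := k) Q e d) (v : V) : lift h (vert k Q v) = e v := by
  rw [vert, lift_mk, pathLift_gen]; rfl

@[simp] theorem lift_dbl (h : Rels (k := k) Q e d) (β : E ⊕ E) : lift h (dbl k Q β) = d β := by
  rw [dbl, lift_mk, pathLift_gen]; rfl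

variable (k Q) in
theorem sum_dbl_rel : ∑ α : E, (dbl k Q (Sum.inl α) * dbl k Q (Sum.inr α)
    - dbl k Q (Sum.inr α) * dbl k Q (Sum.inl α)) = 0 := by
  have h := RingQuot.mkAlgHom_rel k (PreprojRel.rel (k := k) (Q := Q))
  have h2 : mk k Q (∑ α : E, (PathAlgebra.gen k Q.double (Sum.inr (Sum.inl α)) *
          PathAlgebra.gen k Q.double (Sum.inr (Sum.inr α)) -
        PathAlgebra.gen k Q.double (Sum.inr (Sum.inr α)) *
          PathAlgebra.gen k Q.double (Sum.inr (Sum.inl α)))) = mk k Q 0 := h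
  simpa [dbl] using h2

/-- Induction over the generators of the preprojective algebra. -/
theorem induction_subalgebra (S : Subalgebra k (Preproj k Q)) (hv : ∀ v, vert k Q v ∈ S)
    (hd : ∀ β, dbl k Q β ∈ S) (a : Preproj k Q) : a ∈ S := by
  obtain ⟨p, rfl⟩ := RingQuot.mkAlgHom_surjective k (PreprojRel k Q) a
  change mk k Q p ∈ S
  obtain ⟨x, rfl⟩ := RingQuot.mkAlgHom_surjective k (PathRel k Q.double) p
  induction x using FreeAlgebra.induction with
  | grade0 r =>
    have : RingQuot.mkAlgHom k (PathRel k Q.double) (algebraMap k _ r)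
      = algebraMap k (PathAlgebra k Q.double) r := AlgHom.commutes _ r
    rw [this, AlgHom.commutes]
    exact S.algebraMap_mem r
  | grade1 x =>
    cases x with
    | inl v => exact hv v
    | inr β => exact hd β
  | mul x y hx hy =>
    have : mk k Q (RingQuot.mkAlgHom k (PathRel k Q.double) (x * y))
      = mk k Q (RingQuot.mkAlgHom k (PathRel k Q.double) x)
        * mk k Q (RingQuot.mkAlgHom k (PathRel k Q.double) y) := by
      rw [map_mul]; exact map_mul (mk k Q) _ _
    rw [this]; exact S.mul_mem hx hy
  | add x y hx hy =>
    have : mk k Q (RingQuot.mkAlgHom k (PathRel k Q.double) (x + y))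
      = mk k Q (RingQuot.mkAlgHom k (PathRel k Q.double) x)
        + mk k Q (RingQuot.mkAlgHom k (PathRel k Q.double) y) := by
      rw [map_add]; exact map_add (mk k Q) _ _
    rw [this]; exact S.add_mem hx hy

end Universal

end Preproj

namespace Preproj

/-! ### Signed opposite arrows, grading, augmentation and anti-involution -/

section Structure

variable (k : Type*) [Field k] {V E : Type*} [Fintype V] [Fintype E] (Q : FinQuiver V E)

/-- The sign of an arrow of the double in the preprojective relation. -/
def sgn : E ⊕ E → k := Sum.elim (fun _ => 1) (fun _ => -1)

theorem sgn_mul_sgn (β : E ⊕ E) : sgn k β * sgn k β = 1 := by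
  cases β <;> simp [sgn]

/-- The signed opposite arrow, so that the preprojective relation is `∑ β, dbl β * codbl β = 0`. -/
def codbl (β : E ⊕ E) : Preproj k Q := sgn k β • dbl k Q β.swap

theorem _root_.FinQuiver.double_src_swap {V E : Type*} (Q : FinQuiver V E) (β : E ⊕ E) :
    Q.double.src β.swap = Q.double.tgt β := by
  cases β <;> rfl

theorem _root_.FinQuiver.double_tgt_swap {V E : Type*} (Q : FinQuiver V E) (β : E ⊕ E) :
    Q.double.tgt β.swap = Q.double.src β := by
  cases β <;> rfl

theorem dbl_swap (β : E ⊕ E) : dbl k Q β.swap = sgn k β • codbl k Q β := by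
  rw [codbl, smul_smul, sgn_mul_sgn, one_smul]

theorem sum_dbl_codbl : ∑ β, dbl k Q β * codbl k Q β = 0 := by
  rw [Fintype.sum_sum_type, ← Finset.sum_add_distrib, ← sum_dbl_rel k Q]
  refine Finset.sum_congr rfl fun α _ => ?_
  simp [codbl, sgn, sub_eq_add_neg]

theorem vert_codbl (β : E ⊕ E) : vert k Q (Q.double.tgt β) * codbl k Q β = codbl k Q β := by
  rw [codbl, mul_smul_comm, ← FinQuiver.double_src_swap, vert_dbl]

theorem codbl_vert (β : E ⊕ E) : codbl k Q β * vert k Q (Q.double.src β) = codbl k Q β := by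
  rw [codbl, smul_mul_assoc, ← FinQuiver.double_tgt_swap, dbl_vert]

theorem vert_mul_vert [DecidableEq V] (v w : V) :
    vert k Q v * vert k Q w = if v = w then vert k Q v else 0 := by
  split_ifs with h
  · rw [← h, vert_idem]
  · exact vert_orth k Q h

theorem vert_mul_dbl [DecidableEq V] (v : V) (β : E ⊕ E) :
    vert k Q v * dbl k Q β = if v = Q.double.src β then dbl k Q β else 0 := by
  rw [← vert_dbl, ← mul_assoc, vert_mul_vert]
  split_ifs with h
  · rw [h]
  · rw [zero_mul]

theorem codbl_mul_vert [DecidableEq V] (v : V) (β : E ⊕ E) :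
    codbl k Q β * vert k Q v = if Q.double.src β = v then codbl k Q β else 0 := by
  rw [← codbl_vert, mul_assoc, vert_mul_vert]
  split_ifs with h
  · rfl
  · rw [mul_zero]

theorem grading_zero : grading k Q 0 = deg0 k Q := by rw [grading, pow_zero, mul_one]

theorem grading_one : grading k Q 1 = deg1 k Q := by rw [grading, pow_one, deg0_mul_deg1]

theorem vert_mem (v : V) : vert k Q v ∈ grading k Q 0 := by
  rw [grading_zero]; exact Submodule.subset_span ⟨v, rfl⟩

theorem dbl_mem (β : E ⊕ E) : dbl k Q β ∈ grading k Q 1 := by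
  rw [grading_one]; exact Submodule.subset_span ⟨β, rfl⟩

theorem codbl_mem (β : E ⊕ E) : codbl k Q β ∈ grading k Q 1 :=
  Submodule.smul_mem _ _ (dbl_mem k Q _)

theorem grading_finite (n : ℕ) : Module.Finite k (grading k Q n) := by
  rw [Module.Finite.iff_fg]
  refine Submodule.FG.mul (Submodule.fg_span (Set.finite_range _)) ?_
  exact Submodule.FG.pow (Submodule.fg_span (Set.finite_range _)) n

theorem grading_succ (n : ℕ) : grading k Q (n + 1) = grading k Q n * deg1 k Q := by
  rw [grading, grading, pow_succ, mul_assoc]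

/-- An element of positive degree is a combination `∑ y_β β` over the arrows. -/
theorem exists_sum_dbl {n : ℕ} {x : Preproj k Q} (hx : x ∈ grading k Q (n + 1)) :
    ∃ y : E ⊕ E → Preproj k Q, (∀ β, y β ∈ grading k Q n) ∧ ∑ β, y β * dbl k Q β = x := by
  rw [grading_succ] at hx
  induction hx using Submodule.mul_induction_on' with
  | mem_mul_mem a ha b hb =>
    obtain ⟨c, rfl⟩ := (Submodule.mem_span_range_iff_exists_fun k).1 hb
    refine ⟨fun β => c β • a, fun β => Submodule.smul_mem _ _ ha, ?_⟩
    rw [Finset.mul_sum]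
    exact Finset.sum_congr rfl fun β _ => by rw [smul_mul_assoc, mul_smul_comm]
  | add x _ y _ hx hy =>
    obtain ⟨u, hu, rfl⟩ := hx
    obtain ⟨w, hw, rfl⟩ := hy
    exact ⟨u + w, fun β => Submodule.add_mem _ (hu β) (hw β), by
      simp only [Pi.add_apply, add_mul, Finset.sum_add_distrib]⟩

theorem exists_sum_codbl {n : ℕ} {x : Preproj k Q} (hx : x ∈ grading k Q (n + 1)) :
    ∃ y : E ⊕ E → Preproj k Q, (∀ β, y β ∈ grading k Q n) ∧ ∑ β, y β * codbl k Q β = x := by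
  obtain ⟨y, hy, rfl⟩ := exists_sum_dbl k Q hx
  refine ⟨fun β => sgn k β • y β.swap, fun β => Submodule.smul_mem _ _ (hy _), ?_⟩
  rw [← (Equiv.sumComm E E).sum_comp]
  refine Finset.sum_congr rfl fun β _ => ?_
  change (sgn k β.swap • y β.swap.swap) * (sgn k β.swap • dbl k Q β.swap.swap) = _
  rw [Sum.swap_swap, smul_mul_smul_comm, sgn_mul_sgn, one_smul]

/-! ### The augmentation -/

theorem rels_augmentation [DecidableEq V] : Rels (k := k) Q (B := V → k)
    (fun v => Pi.single v 1) (fun _ => 0) where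
  idem v := by rw [← Pi.single_mul, one_mul]
  orth v w h := by
    ext u
    by_cases hu : u = v
    · subst hu; simp [h]
    · simp [hu]
  one := by
    ext u; simp [Finset.sum_apply, Pi.single_apply]
  src _ := mul_zero _
  tgt _ := zero_mul _
  rel := by simp

/-- The augmentation `A → A / A_{≥ 1} = k^V`. -/
def aug [DecidableEq V] : Preproj k Q →ₐ[k] (V → k) := lift (rels_augmentation k Q)

@[simp] theorem aug_vert [DecidableEq V] (v : V) : aug k Q (vert k Q v) = Pi.single v 1 :=
  lift_vert _ v

theorem eq_sum_aug [DecidableEq V] {a : Preproj k Q} (ha : a ∈ grading k Q 0) :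
    a = ∑ v, aug k Q a v • vert k Q v := by
  rw [grading_zero] at ha
  obtain ⟨c, rfl⟩ := (Submodule.mem_span_range_iff_exists_fun k).1 ha
  refine Finset.sum_congr rfl fun v _ => ?_
  simp [Finset.sum_apply, Pi.single_apply]

/-! ### The grading is a decomposition -/

open Polynomial in
-- All relations are homogeneous, so they survive when each arrow is weighted by the variable. The
-- resulting algebra map records the degree and so separates the graded pieces.
theorem rels_polynomial : Rels (k := k) Q (B := (Preproj k Q)[X])
    (fun v => monomial 0 (vert k Q v)) (fun β => monomial 1 (dbl k Q β)) where
  idem v := by rw [monomial_mul_monomial, vert_idem]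
  orth v w h := by rw [monomial_mul_monomial, vert_orth k Q h, map_zero]
  one := by rw [← map_sum, sum_vert]; rfl
  src β := by rw [monomial_mul_monomial, vert_dbl]
  tgt β := by rw [monomial_mul_monomial, dbl_vert]
  rel := by
    simp only [monomial_mul_monomial, ← map_sub, ← map_sum, sum_dbl_rel, map_zero]

open Polynomial in
/-- The coaction of the grading, `a ↦ a tⁿ` for `a` homogeneous of degree `n`. -/
def coact : Preproj k Q →ₐ[k] (Preproj k Q)[X] := lift (rels_polynomial k Q)

open Polynomial in
theorem coact_of_mem {n : ℕ} {a : Preproj k Q} (ha : a ∈ grading k Q n) :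
    coact k Q a = monomial n a := by
  induction n generalizing a with
  | zero =>
    rw [grading_zero] at ha
    induction ha using Submodule.span_induction with
    | mem x h => obtain ⟨v, rfl⟩ := h; exact lift_vert _ v
    | zero => simp
    | add x y _ _ hx hy => rw [map_add, hx, hy, map_add]
    | smul c x _ hx => rw [map_smul, hx, smul_monomial]
  | succ n ih =>
    obtain ⟨y, hy, rfl⟩ := exists_sum_dbl k Q ha
    rw [map_sum, map_sum]
    refine Finset.sum_congr rfl fun β _ => ?_
    rw [map_mul, ih (hy β), coact, lift_dbl, monomial_mul_monomial]

theorem mem_iSup_grading (a : Preproj k Q) : a ∈ ⨆ n, grading k Q n := by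
  let S : Subalgebra k (Preproj k Q) :=
    { (⨆ n, grading k Q n : Submodule k (Preproj k Q)) with
      mul_mem' := by
        intro a b ha hb
        change a ∈ ⨆ n, grading k Q n at ha
        change b ∈ ⨆ n, grading k Q n at hb
        change a * b ∈ ⨆ n, grading k Q n
        induction ha using Submodule.iSup_induction' with
        | mem i x hx =>
          induction hb using Submodule.iSup_induction' with
          | mem j y hy =>
            exact Submodule.mem_iSup_of_mem (i + j) (SetLike.mul_mem_graded hx hy)
          | zero => rw [mul_zero]; exact Submodule.zero_mem _
          | add y z _ _ hy hz => rw [mul_add]; exact Submodule.add_mem _ hy hz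
        | zero => rw [zero_mul]; exact Submodule.zero_mem _
        | add y z _ _ hy hz => rw [add_mul]; exact Submodule.add_mem _ hy hz
      algebraMap_mem' := by
        intro r
        change algebraMap k _ r ∈ ⨆ n, grading k Q n
        rw [Algebra.algebraMap_eq_smul_one]
        exact Submodule.smul_mem _ _ (Submodule.mem_iSup_of_mem 0 SetLike.GradedOne.one_mem) }
  exact induction_subalgebra S (fun v => Submodule.mem_iSup_of_mem (p := grading k Q) 0 (vert_mem k Q v))
    (fun β => Submodule.mem_iSup_of_mem (p := grading k Q) 1 (dbl_mem k Q β)) a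

/-- Independence: the coefficient of `tⁿ` in the coaction of a sum of homogeneous elements is the
component of degree `n`. Spanning: the sum of the pieces is a subalgebra containing the generators.
-/
theorem grading_isInternal : DirectSum.IsInternal (grading k Q) := by
  classical
  constructor
  · rw [injective_iff_map_eq_zero]
    intro x hx
    ext n
    have h := congrArg (fun p => Polynomial.coeff (coact k Q p) n) hx
    simp only [DirectSum.coeAddMonoidHom_eq_dfinsuppSum, DFinsupp.sum, map_sum, map_zero,
      Polynomial.finsetSum_coeff, Polynomial.coeff_zero] at h
    rw [Finset.sum_congr rfl (g := fun i => if i = n then (x i : Preproj k Q) else 0)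
      (fun i _ => by rw [coact_of_mem k Q (x i).2, Polynomial.coeff_monomial])] at h
    rw [Finset.sum_ite_eq'] at h
    split_ifs at h with hn
    · simpa using h
    · rw [DFinsupp.notMem_support_iff] at hn
      rw [hn]
      rfl
  · intro a
    have ha := mem_iSup_grading k Q a
    rw [Submodule.iSup_eq_range_dfinsupp_lsum] at ha
    obtain ⟨f, hf⟩ := ha
    exact ⟨f, by rw [← hf]; rfl⟩

instance : DirectSum.Decomposition (grading k Q) := (grading_isInternal k Q).chooseDecomposition

/-! ### The anti-involution -/

/-- Reversing products while exchanging `α` and `α^*` fixes each of `α α^*` and `α^* α`, hence the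
relation. The anti-involution obtained from this carries the left Koszul complex to the right one.
-/
theorem rels_op : Rels (k := k) Q (B := (Preproj k Q)ᵐᵒᵖ)
    (fun v => op (vert k Q v)) (fun β => op (dbl k Q β.swap)) where
  idem v := by rw [← op_mul, vert_idem]
  orth v w h := by rw [← op_mul, vert_orth k Q h.symm, op_zero]
  one := by rw [← Finset.op_sum, sum_vert, op_one]
  src β := by rw [← op_mul, ← FinQuiver.double_tgt_swap, dbl_vert]
  tgt β := by rw [← op_mul, ← FinQuiver.double_src_swap, vert_dbl]
  rel := by
    simp only [← op_mul, ← op_sub, ← Finset.op_sum]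
    exact congrArg op (sum_dbl_rel k Q)

/-- The anti-involution exchanging `α` and `α^*`. -/
def anti : Preproj k Q →ₐ[k] (Preproj k Q)ᵐᵒᵖ := lift (rels_op k Q)

/-- The anti-involution exchanging `α` and `α^*`, as a linear map. -/
def flip : Preproj k Q →ₗ[k] Preproj k Q :=
  (opLinearEquiv k).symm.toLinearMap.comp (anti k Q).toLinearMap

theorem flip_mul (a b : Preproj k Q) : flip k Q (a * b) = flip k Q b * flip k Q a := by
  simp [flip]

@[simp] theorem flip_vert (v : V) : flip k Q (vert k Q v) = vert k Q v := by
  simp [flip, anti]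

@[simp] theorem flip_dbl (β : E ⊕ E) : flip k Q (dbl k Q β) = dbl k Q β.swap := by
  simp [flip, anti]

theorem flip_one : flip k Q 1 = 1 := by simp [flip]

@[simp] theorem flip_flip (a : Preproj k Q) : flip k Q (flip k Q a) = a := by
  let S : Subalgebra k (Preproj k Q) :=
    { carrier := {a | flip k Q (flip k Q a) = a}
      mul_mem' := by
        intro a b ha hb
        simp only [Set.mem_ofPred_eq] at *
        rw [flip_mul, flip_mul, ha, hb]
      add_mem' := by
        intro a b ha hb
        simp only [Set.mem_ofPred_eq] at *
        rw [map_add, map_add, ha, hb]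
      algebraMap_mem' := by
        intro r
        simp only [Set.mem_ofPred_eq]
        rw [Algebra.algebraMap_eq_smul_one, map_smul, map_smul, flip_one, flip_one] }
  exact induction_subalgebra S (fun v => by change flip k Q (flip k Q _) = _; simp)
    (fun β => by change flip k Q (flip k Q _) = _; simp) a

theorem flip_mem {n : ℕ} {a : Preproj k Q} (ha : a ∈ grading k Q n) :
    flip k Q a ∈ grading k Q n := by
  induction n generalizing a with
  | zero =>
    rw [grading_zero] at ha
    induction ha using Submodule.span_induction with
    | mem x h => obtain ⟨v, rfl⟩ := h; rw [flip_vert]; exact vert_mem k Q v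
    | zero => rw [map_zero]; exact Submodule.zero_mem _
    | add x y _ _ hx hy => rw [map_add]; exact Submodule.add_mem _ hx hy
    | smul c x _ hx => rw [map_smul]; exact Submodule.smul_mem _ _ hx
  | succ n ih =>
    obtain ⟨y, hy, rfl⟩ := exists_sum_dbl k Q ha
    rw [map_sum]
    refine Submodule.sum_mem _ fun β _ => ?_
    rw [flip_mul, flip_dbl, add_comm]
    exact SetLike.mul_mem_graded (dbl_mem k Q _) (ih (hy β))

end Structure

end Preproj

namespace Preproj

/-! ### Exactness of the Koszul complex in the middle -/

section Exactness

variable (k : Type*) [Field k] {V E : Type*} [Fintype V] [DecidableEq V] [Fintype E]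
  [DecidableEq E] (Q : FinQuiver V E)

/-- The cokernel of `A → ⨁_β A`, `x ↦ (x β)_β`. -/
abbrev KCoker : Type _ :=
  (E ⊕ E → Preproj k Q) ⧸ Submodule.span (Preproj k Q) {fun β => dbl k Q β}

/-- The generators of the module of differentials of `A` relative to `k^V`. -/
def kgen (γ : E ⊕ E) : E ⊕ E → Preproj k Q :=
  Pi.single γ.swap (sgn k γ.swap • vert k Q (Q.double.src γ))

/-- The action of a vertex on the extension of `k^V` by `KCoker`. -/
def actVert (v : V) : Module.End k (KCoker k Q × (V → k)) where
  toFun p := (vert k Q v • p.1, Pi.single v (p.2 v))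
  map_add' p q := by ext <;> simp [Pi.single_add]
  map_smul' c p := by
    ext
    · exact smul_comm _ _ _
    · simp [Pi.single_apply]

/-- The action of an arrow on the extension of `k^V` by `KCoker`. -/
def actDbl (γ : E ⊕ E) : Module.End k (KCoker k Q × (V → k)) where
  toFun p := (dbl k Q γ • p.1 + p.2 (Q.double.tgt γ) • Submodule.Quotient.mk (kgen k Q γ), 0)
  map_add' p q := by
    ext
    · simp only [Prod.fst_add, Prod.snd_add, Pi.add_apply, smul_add, add_smul]; abel
    · simp
  map_smul' c p := by
    ext
    · simp only [Prod.smul_fst, Prod.smul_snd, Pi.smul_apply, smul_add, RingHom.id_apply,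
        smul_eq_mul, mul_smul, smul_comm (dbl k Q γ) c]
    · simp

theorem smul_kgen (a : Preproj k Q) (γ : E ⊕ E) : a • kgen k Q γ
    = Pi.single γ.swap (sgn k γ.swap • (a * vert k Q (Q.double.src γ))) := by
  rw [kgen, ← Pi.single_smul, smul_eq_mul, mul_smul_comm]

theorem actVert_apply (v : V) (y : KCoker k Q) (c : V → k) :
    actVert k Q v (y, c) = (vert k Q v • y, Pi.single v (c v)) := rfl

theorem actDbl_apply (γ : E ⊕ E) (y : KCoker k Q) (c : V → k) : actDbl k Q γ (y, c) =
    (dbl k Q γ • y + c (Q.double.tgt γ) • Submodule.Quotient.mk (kgen k Q γ), 0) := rfl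

theorem smul_smul_mk_kgen (a : Preproj k Q) (c : k) (γ : E ⊕ E) :
    a • c • (Submodule.Quotient.mk (kgen k Q γ) : KCoker k Q) = c • Submodule.Quotient.mk
      (Pi.single γ.swap (sgn k γ.swap • (a * vert k Q (Q.double.src γ)))) := by
  rw [smul_comm, ← Submodule.Quotient.mk_smul, smul_kgen]

/-- `kgen γ` plays the role of the differential of the arrow `γ`. Applied to `(y, c)`, the
preprojective relation produces `(∑ c_v e_v) • (β)_β`, which is zero in `KCoker` because this is the
submodule divided out. -/
theorem rels_act : Rels (k := k) Q (actVert k Q) (actDbl k Q) where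
  idem v := by
    refine LinearMap.ext fun ⟨y, c⟩ => ?_
    rw [Module.End.mul_apply, actVert_apply k Q _ y c, actVert_apply, ← mul_smul, vert_idem,
      Pi.single_eq_same]
  orth v w h := by
    refine LinearMap.ext fun ⟨y, c⟩ => ?_
    rw [Module.End.mul_apply, actVert_apply k Q _ y c, actVert_apply, ← mul_smul, vert_orth k Q h, zero_smul,
      Pi.single_eq_of_ne h, Pi.single_zero]
    rfl
  one := by
    refine LinearMap.ext fun ⟨y, c⟩ => Prod.ext ?_ ?_
    · rw [LinearMap.sum_apply, Prod.fst_sum]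
      simp only [actVert_apply]
      rw [← Finset.sum_smul, sum_vert, one_smul]
      rfl
    · rw [LinearMap.sum_apply, Prod.snd_sum]
      simp only [actVert_apply]
      rw [Finset.univ_sum_single]
      rfl
  src β := by
    refine LinearMap.ext fun ⟨y, c⟩ => Prod.ext ?_ ?_
    · rw [Module.End.mul_apply, actDbl_apply k Q _ y c, actVert_apply]
      rw [smul_add, ← mul_smul, vert_dbl, smul_smul_mk_kgen, vert_idem]
      rfl
    · rw [Module.End.mul_apply, actDbl_apply k Q _ y c, actVert_apply, Pi.zero_apply, Pi.single_zero]
  tgt β := by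
    refine LinearMap.ext fun ⟨y, c⟩ => ?_
    rw [Module.End.mul_apply, actVert_apply k Q _ y c, actDbl_apply, ← mul_smul, dbl_vert, Pi.single_eq_same,
      actDbl_apply]
  rel := by
    refine LinearMap.ext fun ⟨y, c⟩ => Prod.ext ?_ ?_
    · simp only [LinearMap.sum_apply, Prod.fst_sum]
      simp only [actDbl_apply, LinearMap.sub_apply, Module.End.mul_apply, Pi.zero_apply, zero_smul, add_zero, Prod.fst_sub]
      simp only [smul_add, ← mul_smul]
      have h1 : ∀ x : E, (dbl k Q (Sum.inl x) * dbl k Q (Sum.inr x)) • y +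
          dbl k Q (Sum.inl x) • c (Q.double.tgt (Sum.inr x)) •
            (Submodule.Quotient.mk (kgen k Q (Sum.inr x)) : KCoker k Q) -
          ((dbl k Q (Sum.inr x) * dbl k Q (Sum.inl x)) • y +
          dbl k Q (Sum.inr x) • c (Q.double.tgt (Sum.inl x)) •
            (Submodule.Quotient.mk (kgen k Q (Sum.inl x)) : KCoker k Q))
          = (dbl k Q (Sum.inl x) * dbl k Q (Sum.inr x) - dbl k Q (Sum.inr x) * dbl k Q (Sum.inl x))
            • y + Submodule.Quotient.mk (
              Pi.single (Sum.inl x) ((∑ v, c v • vert k Q v) * dbl k Q (Sum.inl x)) +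
              Pi.single (Sum.inr x) ((∑ v, c v • vert k Q v) * dbl k Q (Sum.inr x))) := by
        intro x
        rw [smul_smul_mk_kgen, smul_smul_mk_kgen, ← FinQuiver.double_tgt_swap,
          ← FinQuiver.double_tgt_swap]
        simp only [Sum.swap_inl, Sum.swap_inr, dbl_vert, sgn, Sum.elim_inl, Sum.elim_inr, one_smul,
          neg_smul, Finset.sum_mul, smul_mul_assoc, vert_mul_dbl, smul_ite, smul_zero,
          Finset.sum_ite_eq', Finset.mem_univ, if_true, Pi.single_neg, Submodule.Quotient.mk_neg,
          smul_neg, Pi.single_smul, Submodule.Quotient.mk_add, Submodule.Quotient.mk_smul,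
          sub_smul]
        simp only [FinQuiver.double, Sum.elim_inl, Sum.elim_inr]
        abel
      rw [Finset.sum_congr rfl fun x _ => h1 x, Finset.sum_add_distrib, ← Finset.sum_smul,
        sum_dbl_rel, zero_smul, zero_add]
      have h2 : ∑ x : E, (
              Pi.single (Sum.inl x) ((∑ v, c v • vert k Q v) * dbl k Q (Sum.inl x)) +
              Pi.single (Sum.inr x) ((∑ v, c v • vert k Q v) * dbl k Q (Sum.inr x)))
          = (∑ v, c v • vert k Q v) • (fun β => dbl k Q β) := by
        rw [Finset.sum_add_distrib, ← Fintype.sum_sum_type (f := fun β => 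
          (Pi.single β ((∑ v, c v • vert k Q v) * dbl k Q β) : E ⊕ E → Preproj k Q)),
          Finset.univ_sum_single]
        rfl
      have h3 := congrArg (Submodule.mkQ (Submodule.span (Preproj k Q) {fun β => dbl k Q β})) h2
      rw [map_sum] at h3
      refine h3.trans ?_
      exact (Submodule.Quotient.mk_eq_zero _).2
        (Submodule.smul_mem _ _ (Submodule.subset_span rfl))
    · simp only [LinearMap.sum_apply, Prod.snd_sum]
      simp [actDbl_apply]

/-- The action of `A` on the extension of `k^V` by `KCoker`. -/
def act : Preproj k Q →ₐ[k] Module.End k (KCoker k Q × (V → k)) := lift (rels_act k Q)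

theorem act_fst (a : Preproj k Q) (y : KCoker k Q) : act k Q a (y, 0) = (a • y, 0) := by
  let S : Subalgebra k (Preproj k Q) :=
    { carrier := {a | ∀ y : KCoker k Q, act k Q a (y, 0) = (a • y, 0)}
      mul_mem' := by
        intro a b ha hb y
        rw [map_mul, Module.End.mul_apply, hb, ha, mul_smul]
      add_mem' := by
        intro a b ha hb y
        rw [map_add, LinearMap.add_apply, ha, hb, add_smul]
        simp
      algebraMap_mem' := by
        intro r y
        rw [AlgHom.commutes, Module.algebraMap_end_apply, algebraMap_smul]
        simp }
  refine induction_subalgebra S (fun v y => ?_) (fun β y => ?_) a y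
  · rw [act, lift_vert, actVert_apply, Pi.zero_apply, Pi.single_zero]
  · rw [act, lift_dbl, actDbl_apply, Pi.zero_apply, zero_smul, add_zero]

/-- Exactness of the left Koszul complex in the middle. -/
theorem exists_eq_mul_dbl (y : E ⊕ E → Preproj k Q)
    (hy : ∀ β, y β * vert k Q (Q.double.tgt β) = y β) (h : ∑ β, y β * codbl k Q β = 0) :
    ∃ x, ∀ β, y β = x * dbl k Q β := by
  -- `codbl β` sends `(0, 1)` to the `β`-th basis class. So `∑ y_β codbl β` sends it to the class of
  -- `y`, and if this sum is zero then `y` lies in the submodule spanned by `(β)_β`.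
  have h1 : ∀ β, act k Q (codbl k Q β) (0, fun _ => 1)
      = (Submodule.Quotient.mk (Pi.single β (vert k Q (Q.double.tgt β))), 0) := by
    intro β
    rw [codbl, map_smul, act, lift_dbl, LinearMap.smul_apply]
    simp only [actDbl_apply, smul_zero, one_smul, zero_add, kgen,
      Sum.swap_swap, FinQuiver.double_src_swap, Prod.smul_mk]
    rw [← Submodule.Quotient.mk_smul, ← Pi.single_smul, smul_smul, sgn_mul_sgn, one_smul]
  have h2 := congrArg (fun a => act k Q a (0, fun _ => 1)) h
  simp only [map_sum, map_mul, LinearMap.sum_apply, Module.End.mul_apply, h1, act_fst, map_zero,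
    LinearMap.zero_apply] at h2
  have h3 := congrArg Prod.fst h2
  simp only [Prod.fst_sum, Prod.fst_zero] at h3
  have h4 : Submodule.mkQ (Submodule.span (Preproj k Q) {fun β => dbl k Q β}) y = 0 := by
    conv_lhs => rw [← Finset.univ_sum_single y]
    rw [← h3, map_sum]
    refine Finset.sum_congr rfl fun β _ => ?_
    rw [← Submodule.Quotient.mk_smul, ← Pi.single_smul, smul_eq_mul, hy]
    rfl
  rw [Submodule.mkQ_apply, Submodule.Quotient.mk_eq_zero, Submodule.mem_span_singleton] at h4
  obtain ⟨x, hx⟩ := h4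
  exact ⟨x, fun β => by rw [← hx]; rfl⟩

end Exactness

end Preproj

/-! ### Splittings and traces of linear maps -/

section LinearAlgebra

variable {k : Type*} [Field k]

/-- A short exact sequence `U → e W → Z` of vector spaces, with `e` a projection of `W`, splits. -/
theorem LinearMap.exists_contraction {U W Z : Type*} [AddCommGroup U] [Module k U]
    [AddCommGroup W] [Module k W] [AddCommGroup Z] [Module k Z]
    (d₂ : U →ₗ[k] W) (d₁ : W →ₗ[k] Z) (e : W →ₗ[k] W) (hee : ∀ y, e (e y) = e y)
    (h2 : ∀ x, d₂ x = 0 → x = 0) (h1 : Function.Surjective d₁) (he1 : ∀ y, d₁ (e y) = d₁ y)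
    (he2 : ∀ x, e (d₂ x) = d₂ x) (h12 : ∀ x, d₁ (d₂ x) = 0)
    (hex : ∀ y, d₁ y = 0 → e y = y → ∃ x, y = d₂ x) :
    ∃ (s : W →ₗ[k] U) (t : Z →ₗ[k] W), (∀ x, s (d₂ x) = x) ∧ (∀ z, d₁ (t z) = z) ∧
      (∀ y, e y = t (d₁ y) + d₂ (s y)) ∧ (∀ z, e (t z) = t z) ∧ (∀ y, s (e y) = s y) := by
  obtain ⟨l, hl⟩ := d₂.exists_leftInverse_of_injective (LinearMap.ker_eq_bot'.2 h2)
  obtain ⟨r, hr⟩ := d₁.exists_rightInverse_of_surjective (LinearMap.range_eq_top.2 h1)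
  have hl' : ∀ x, l (d₂ x) = x := fun x => LinearMap.congr_fun hl x
  have hr' : ∀ z, d₁ (r z) = z := fun z => LinearMap.congr_fun hr z
  -- The vector `e y - e (r (d₁ y))` is fixed by `e` and killed by `d₁`, so it is in the image of
  -- `d₂`, where `l` inverts `d₂`.
  have key : ∀ y, d₂ (l (e y - e (r (d₁ y)))) = e y - e (r (d₁ y)) := by
    intro y
    obtain ⟨x, hx⟩ := hex (e y - e (r (d₁ y))) (by rw [map_sub, he1, he1, hr', sub_self])
      (by rw [map_sub, hee, hee])
    rw [hx, hl']
  refine ⟨l ∘ₗ (e - e ∘ₗ r ∘ₗ d₁), e ∘ₗ r, fun x => ?_, fun z => ?_, fun y => ?_, fun z => ?_,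
    fun y => ?_⟩
  · simp [he2, h12, hl']
  · simp [he1, hr']
  · simp only [LinearMap.comp_apply, LinearMap.sub_apply]
    rw [key]; abel
  · simp [hee]
  · simp [hee, he1]

theorem LinearMap.trace_pi_diagonal {B X : Type*} [Fintype B] [AddCommGroup X]
    [Module k X] [Module.Finite k X] (f : B → X →ₗ[k] X) :
    LinearMap.trace k (B → X) (LinearMap.pi fun β => f β ∘ₗ LinearMap.proj β)
      = ∑ β, LinearMap.trace k X (f β) := by
  classical
  have h : (LinearMap.pi fun β => f β ∘ₗ LinearMap.proj β : (B → X) →ₗ[k] (B → X))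
      = ∑ β, LinearMap.single k (fun _ : B => X) β ∘ₗ (f β ∘ₗ LinearMap.proj β) := by
    ext β x γ
    simp [Finset.sum_apply, Pi.single_apply]
  rw [h, map_sum]
  refine Finset.sum_congr rfl fun β _ => ?_
  rw [LinearMap.trace_comp_comm', LinearMap.comp_assoc, LinearMap.proj_comp_single_same,
    LinearMap.comp_id]

end LinearAlgebra

namespace GradedRight

/-! ### Homogeneous components indexed by the integers -/

section ZGrading

variable {k A : Type*} [Field k] [Ring A] [Algebra k A] (𝒜 : ℕ → Submodule k A)

theorem zgr_of_neg {p : ℤ} (hp : p < 0) : zgr 𝒜 p = ⊥ := by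
  obtain ⟨n, rfl⟩ := Int.eq_negSucc_of_lt_zero hp
  rfl

theorem zgr_mul [SetLike.GradedMonoid 𝒜] {j : ℕ} {a b : A} (hb : b ∈ 𝒜 j) {p : ℤ}
    (ha : a ∈ zgr 𝒜 p) {q : ℤ} (hq : q = p + j) : a * b ∈ zgr 𝒜 q := by
  subst hq
  cases p with
  | ofNat n =>
    have h : a * b ∈ 𝒜 (n + j) := SetLike.mul_mem_graded (A := 𝒜) ha hb
    exact h
  | negSucc n =>
    have : a = 0 := ha
    rw [this, zero_mul]
    exact Submodule.zero_mem _

theorem mul_zgr' [SetLike.GradedMonoid 𝒜] {j : ℕ} {a b : A} (ha : a ∈ 𝒜 j) {p : ℤ}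
    (hb : b ∈ zgr 𝒜 p) {q : ℤ} (hq : q = p + j) : a * b ∈ zgr 𝒜 q := by
  subst hq
  exact mul_zgr 𝒜 ha hb

variable [DirectSum.Decomposition 𝒜]

/-- The linear map on `A` given by linear maps on the homogeneous components. -/
def ofComponents {W : Type*} [AddCommGroup W] [Module k W] (F : ∀ n, 𝒜 n →ₗ[k] W) : A →ₗ[k] W :=
  DirectSum.toModule k ℕ W F ∘ₗ (DirectSum.decomposeLinearEquiv 𝒜).toLinearMap

theorem ofComponents_of_mem {W : Type*} [AddCommGroup W] [Module k W] (F : ∀ n, 𝒜 n →ₗ[k] W)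
    {n : ℕ} {a : A} (ha : a ∈ 𝒜 n) : ofComponents 𝒜 F a = F n ⟨a, ha⟩ := by
  simp only [ofComponents, LinearMap.comp_apply, LinearEquiv.coe_coe,
    DirectSum.decomposeLinearEquiv_apply]
  rw [DirectSum.decompose_of_mem 𝒜 ha]
  exact DirectSum.toModule_lof (M := fun i => 𝒜 i) k n ⟨a, ha⟩

/-- The projection onto the component of degree `p`. -/
def zproj (p : ℤ) : A →ₗ[k] A :=
  ofComponents 𝒜 fun n => if (n : ℤ) = p then (𝒜 n).subtype else 0

theorem zproj_of_mem {p : ℤ} {a : A} (ha : a ∈ zgr 𝒜 p) : zproj 𝒜 p a = a := by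
  cases p with
  | ofNat n =>
    rw [zproj, ofComponents_of_mem 𝒜 _ (n := n) ha]
    simp
  | negSucc n =>
    have : a = 0 := ha
    rw [this, map_zero]

theorem zproj_of_mem_ne {p q : ℤ} {a : A} (ha : a ∈ zgr 𝒜 q) (h : q ≠ p) : zproj 𝒜 p a = 0 := by
  cases q with
  | ofNat n =>
    have ha' : a ∈ 𝒜 n := ha
    have h' : (n : ℤ) ≠ p := h
    rw [zproj, ofComponents_of_mem 𝒜 _ ha', if_neg h', LinearMap.zero_apply]
  | negSucc n =>
    have : a = 0 := ha
    rw [this, map_zero]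

variable {𝒜} in
theorem homogeneous_induction {P : A → Prop} (h0 : P 0) (hadd : ∀ a b, P a → P b → P (a + b))
    (hh : ∀ n, ∀ a ∈ 𝒜 n, P a) (a : A) : P a := by
  induction a using DirectSum.Decomposition.inductionOn 𝒜 with
  | zero => exact h0
  | homogeneous a => exact hh _ _ a.2
  | add a b ha hb => exact hadd _ _ ha hb

theorem zproj_mem (p : ℤ) (a : A) : zproj 𝒜 p a ∈ zgr 𝒜 p := by
  induction a using homogeneous_induction (𝒜 := 𝒜) with
  | h0 => rw [map_zero]; exact Submodule.zero_mem _
  | hadd a b ha hb => rw [map_add]; exact Submodule.add_mem _ ha hb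
  | hh n a ha =>
    by_cases h : (n : ℤ) = p
    · subst h
      rw [zproj_of_mem 𝒜 (p := n) ha]
      exact ha
    · rw [zproj_of_mem_ne 𝒜 (q := n) ha h]
      exact Submodule.zero_mem _

theorem zproj_mul [SetLike.GradedMonoid 𝒜] {j : ℕ} {b : A} (hb : b ∈ 𝒜 j) (p q : ℤ)
    (h : q = p + j) (a : A) : zproj 𝒜 q (a * b) = zproj 𝒜 p a * b := by
  induction a using homogeneous_induction (𝒜 := 𝒜) with
  | h0 => simp
  | hadd x y hx hy => rw [add_mul, map_add, map_add, add_mul, hx, hy]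
  | hh n a ha =>
    by_cases hn : (n : ℤ) = p
    · rw [zproj_of_mem 𝒜 (zgr_mul 𝒜 (p := n) hb ha (by omega)), zproj_of_mem 𝒜 (by rw [← hn]; exact ha)]
    · rw [zproj_of_mem_ne 𝒜 (zgr_mul 𝒜 (p := n) hb ha rfl) (by omega),
        zproj_of_mem_ne 𝒜 (q := n) ha hn, zero_mul]

theorem ext_zproj {a b : A} (h : ∀ n : ℕ, zproj 𝒜 n a = zproj 𝒜 n b) : a = b := by
  have : ∀ c : A, (∀ n : ℕ, zproj 𝒜 n c = 0) → c = 0 := by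
    intro c hc
    have h1 : ∀ (n : ℕ) (c : A), zproj 𝒜 n c = DirectSum.decompose 𝒜 c n := by
      intro n c
      induction c using homogeneous_induction (𝒜 := 𝒜) with
      | h0 => simp
      | hadd x y hx hy => rw [map_add, DirectSum.decompose_add, hx, hy]; rfl
      | hh m a ha =>
        by_cases hm : m = n
        · subst hm
          rw [zproj_of_mem 𝒜 (p := m) ha, DirectSum.decompose_of_mem_same 𝒜 ha]
        · rw [zproj_of_mem_ne 𝒜 (q := m) ha (by omega), DirectSum.decompose_of_mem_ne 𝒜 ha hm]
    have h2 : DirectSum.decompose 𝒜 c = 0 := by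
      ext n
      rw [← h1, hc]
      rfl
    exact (DirectSum.decompose 𝒜).injective (h2.trans (DirectSum.decompose_zero 𝒜).symm)
  rw [← sub_eq_zero]
  exact this _ fun n => by rw [map_sub, h, sub_self]

end ZGrading

end GradedRight

namespace Preproj

open GradedRight

/-! ### The Koszul complex degree by degree, and traces along it -/

section Koszul

variable (k : Type*) [Field k] {V E : Type*} [Fintype V] [DecidableEq V] [Fintype E]
  (Q : FinQuiver V E)

instance zgr_finite (p : ℤ) : Module.Finite k (zgr (grading k Q) p) := by
  cases p with
  | ofNat n => exact grading_finite k Q n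
  | negSucc n =>
    change Module.Finite k (⊥ : Submodule k (Preproj k Q))
    infer_instance

/-- The witness given by exactness need not be homogeneous. Right multiplication by an arrow shifts
components by one, so its component of degree `p` serves as well; for `p < 0` this forces `y = 0`.
-/
theorem exists_eq_mul_dbl_zgr {p q : ℤ} (hq : q = p + 1) (y : E ⊕ E → Preproj k Q)
    (hy : ∀ β, y β * vert k Q (Q.double.tgt β) = y β) (h : ∑ β, y β * codbl k Q β = 0)
    (hp : ∀ β, y β ∈ zgr (grading k Q) q) :
    ∃ x ∈ zgr (grading k Q) p, ∀ β, y β = x * dbl k Q β := by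
  classical
  obtain ⟨x, hx⟩ := exists_eq_mul_dbl k Q y hy h
  refine ⟨zproj (grading k Q) p x, zproj_mem _ _ _, fun β => ?_⟩
  rw [← zproj_mul (grading k Q) (dbl_mem k Q β) p q (by simpa using hq), ← hx,
    zproj_of_mem _ (hp β)]

theorem exists_sum_codbl_zgr {p q : ℤ} (hq : q = p + 1) (hq0 : q ≠ 0) {x : Preproj k Q}
    (hx : x ∈ zgr (grading k Q) q) :
    ∃ y : E ⊕ E → Preproj k Q, (∀ β, y β ∈ zgr (grading k Q) p) ∧ ∑ β, y β * codbl k Q β = x := by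
  rcases lt_or_ge p 0 with hp | hp
  · rw [zgr_of_neg _ (by omega)] at hx
    exact ⟨0, fun β => Submodule.zero_mem _, by rw [(Submodule.mem_bot k).1 hx]; simp⟩
  · obtain ⟨n, rfl⟩ := Int.eq_ofNat_of_zero_le hp
    subst hq
    exact exists_sum_codbl k Q (n := n) hx

/-- The map `x ↦ (x β)_β` in degree `n`. -/
def koszulD₂ (n : ℤ) : zgr (grading k Q) (n - 1) →ₗ[k] (E ⊕ E → zgr (grading k Q) n) :=
  LinearMap.pi fun β => (LinearMap.mulRight k (dbl k Q β)).restrict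
    fun _ hx => zgr_mul _ (dbl_mem k Q β) hx (by simp)

/-- The map `(y_β)_β ↦ ∑ ± y_β β^*` in degree `n`. -/
def koszulD₁ (n : ℤ) : (E ⊕ E → zgr (grading k Q) n) →ₗ[k] zgr (grading k Q) (n + 1) :=
  ∑ β, (LinearMap.mulRight k (codbl k Q β)).restrict
    (fun _ hx => zgr_mul _ (codbl_mem k Q β) hx (by simp)) ∘ₗ LinearMap.proj β

/-- The map `(y_β)_β ↦ (y_β e_{t(β)})_β` in degree `n`. -/
def koszulProj (n : ℤ) : (E ⊕ E → zgr (grading k Q) n) →ₗ[k] (E ⊕ E → zgr (grading k Q) n) :=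
  LinearMap.pi fun β => (LinearMap.mulRight k (vert k Q (Q.double.tgt β))).restrict
    (fun _ hx => zgr_mul _ (vert_mem k Q _) hx (by simp)) ∘ₗ LinearMap.proj β

@[simp] theorem koszulD₂_apply (n : ℤ) (x : zgr (grading k Q) (n - 1)) (β : E ⊕ E) :
    (koszulD₂ k Q n x β : Preproj k Q) = x * dbl k Q β := rfl

@[simp] theorem koszulD₁_apply (n : ℤ) (y : E ⊕ E → zgr (grading k Q) n) :
    (koszulD₁ k Q n y : Preproj k Q) = ∑ β, (y β : Preproj k Q) * codbl k Q β := by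
  rw [koszulD₁, LinearMap.sum_apply, Submodule.coe_sum]
  rfl

@[simp] theorem koszulProj_apply (n : ℤ) (y : E ⊕ E → zgr (grading k Q) n) (β : E ⊕ E) :
    (koszulProj k Q n y β : Preproj k Q) = y β * vert k Q (Q.double.tgt β) := rfl

/-- The value `n = -1` is excluded because the last map then lands in `A_0`, its cokernel.
Injectivity is asked for in degree `n - 1` only, so that the contraction is available during the
induction which proves that the socle vanishes. -/
theorem koszul_contraction (n : ℤ) (hn : n ≠ -1)
    (hinj : ∀ x ∈ zgr (grading k Q) (n - 1), (∀ β, x * dbl k Q β = 0) → x = 0) :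
    ∃ (s : (E ⊕ E → zgr (grading k Q) n) →ₗ[k] zgr (grading k Q) (n - 1))
      (t : zgr (grading k Q) (n + 1) →ₗ[k] (E ⊕ E → zgr (grading k Q) n)),
      (∀ x, s (koszulD₂ k Q n x) = x) ∧ (∀ z, koszulD₁ k Q n (t z) = z) ∧
      (∀ y, koszulProj k Q n y = t (koszulD₁ k Q n y) + koszulD₂ k Q n (s y)) ∧
      (∀ z, koszulProj k Q n (t z) = t z) ∧ (∀ y, s (koszulProj k Q n y) = s y) := by
  apply LinearMap.exists_contraction
  · intro y
    ext β
    simp [mul_assoc, vert_idem]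
  · intro x hx
    apply Subtype.ext
    refine hinj x x.2 fun β => ?_
    rw [← koszulD₂_apply, hx]
    rfl
  · intro z
    obtain ⟨y, hy, hz⟩ := exists_sum_codbl_zgr k Q (p := n) rfl (by omega) z.2
    exact ⟨fun β => ⟨y β, hy β⟩, Subtype.ext (by rw [koszulD₁_apply]; exact hz)⟩
  · intro y
    apply Subtype.ext
    simp [-Fintype.sum_sum_type, mul_assoc, vert_codbl]
  · intro x
    ext β
    simp [mul_assoc, dbl_vert]
  · intro x
    apply Subtype.ext
    rw [koszulD₁_apply]
    simp only [koszulD₂_apply, mul_assoc]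
    rw [← Finset.mul_sum, sum_dbl_codbl, mul_zero]
    rfl
  · intro y h1 h2
    obtain ⟨x, hx, h⟩ := exists_eq_mul_dbl_zgr k Q (p := n - 1) (q := n) (by omega)
      (fun β => (y β : Preproj k Q))
      (fun β => by rw [← koszulProj_apply, h2]) (by rw [← koszulD₁_apply, h1]; rfl)
      (fun β => (y β).2)
    exact ⟨⟨x, hx⟩, funext fun β => Subtype.ext (by rw [h β]; rfl)⟩

/-! ### Traces -/

variable {k Q}

/-- The map `x ↦ e_i g(x) e_j` on the component of degree `n`. -/
def cornerMap (g : GradedAut (grading k Q)) (i j : V) (n : ℤ) :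
    zgr (grading k Q) n →ₗ[k] zgr (grading k Q) n :=
  (LinearMap.mulLeft k (vert k Q i) ∘ₗ LinearMap.mulRight k (vert k Q j) ∘ₗ
    g.toEquiv.toLinearMap).restrict fun x hx => mul_zgr' _ (vert_mem k Q i)
      (zgr_mul _ (vert_mem k Q j) (g.zgr_mem n x hx) (q := n) (by simp)) (by simp)

@[simp] theorem cornerMap_apply (g : GradedAut (grading k Q)) (i j : V) (n : ℤ)
    (x : zgr (grading k Q) n) :
    (cornerMap g i j n x : Preproj k Q) = vert k Q i * (g.toEquiv x * vert k Q j) := rfl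

/-- The trace of `g` on `e_i A_n e_j`. -/
def cornerTrace (g : GradedAut (grading k Q)) (i j : V) (n : ℤ) : k :=
  LinearMap.trace k _ (cornerMap g i j n)

/-- `g` fixes the vertices and scales the arrows of the double by `s`, with `s_β s_{β^*} = q`. -/
structure ScalesArrows (g : GradedAut (grading k Q)) (s : E ⊕ E → k) (q : k) : Prop where
  vert : ∀ v, g.toEquiv (vert k Q v) = vert k Q v
  dbl : ∀ β, g.toEquiv (dbl k Q β) = s β • dbl k Q β
  mul : ∀ β, s β * s β.swap = q

theorem ScalesArrows.codbl {g : GradedAut (grading k Q)} {s : E ⊕ E → k} {q : k}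
    (hg : ScalesArrows g s q) (β : E ⊕ E) :
    g.toEquiv (codbl k Q β) = s β.swap • codbl k Q β := by
  rw [Preproj.codbl, map_smul, hg.dbl, smul_comm]

/-- Additivity of the trace on the exact sequence `e_i A_{n-1} e_v → ⨁ e_i A_n e_{t(β)} → e_i
A_{n+1} e_v`, the sum being over the arrows `β` with source `v`. -/
theorem cornerTrace_recursion {g : GradedAut (grading k Q)} {s : E ⊕ E → k} {q : k}
    (hg : ScalesArrows g s q) (n : ℤ) (hn : n ≠ -1)
    (hinj : ∀ x ∈ zgr (grading k Q) (n - 1), (∀ β, x * dbl k Q β = 0) → x = 0) (i v : V) :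
    cornerTrace g i v (n + 1) + q * cornerTrace g i v (n - 1) =
      ∑ β, if Q.double.src β = v then s β.swap * cornerTrace g i (Q.double.tgt β) n else 0 := by
  obtain ⟨r, t, h1, h2, h3, -, -⟩ := koszul_contraction k Q n hn hinj
  -- The factor `s β.swap` makes the second Koszul map commute with `g`; the first one then commutes
  -- up to `s β * s β.swap = q`. Killing the components with another source restricts to the summand
  -- ending at `v`.
  let G : (E ⊕ E → zgr (grading k Q) n) →ₗ[k] (E ⊕ E → zgr (grading k Q) n) :=
    LinearMap.pi fun β => (if Q.double.src β = v then s β.swap else 0) •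
      ((LinearMap.mulLeft k (vert k Q i) ∘ₗ g.toEquiv.toLinearMap).restrict
        (p := zgr (grading k Q) n) (q := zgr (grading k Q) n)
        fun x hx => mul_zgr' _ (vert_mem k Q i) (g.zgr_mem n x hx) (by simp)) ∘ₗ LinearMap.proj β
  have hG : ∀ y β, (G y β : Preproj k Q) = (if Q.double.src β = v then s β.swap else 0) •
    (vert k Q i * g.toEquiv (y β)) := fun _ _ => rfl
  have e1 : G ∘ₗ koszulProj k Q n = LinearMap.pi fun β =>
      ((if Q.double.src β = v then s β.swap else 0) • cornerMap g i (Q.double.tgt β) n) ∘ₗ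
        LinearMap.proj β := by
    refine LinearMap.ext fun y => funext fun β => Subtype.ext ?_
    rw [LinearMap.comp_apply, hG, koszulProj_apply, map_mul, hg.vert]
    rfl
  have e2 : koszulD₁ k Q n ∘ₗ G = cornerMap g i v (n + 1) ∘ₗ koszulD₁ k Q n := by
    refine LinearMap.ext fun y => Subtype.ext ?_
    rw [LinearMap.comp_apply, LinearMap.comp_apply, koszulD₁_apply, cornerMap_apply,
      koszulD₁_apply, map_sum, Finset.sum_mul, Finset.mul_sum]
    refine Finset.sum_congr rfl fun β _ => ?_
    rw [hG, map_mul, hg.codbl]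
    simp only [smul_mul_assoc, mul_smul_comm, mul_assoc, codbl_mul_vert]
    split_ifs <;> simp
  have e3 : G ∘ₗ koszulD₂ k Q n = q • (koszulD₂ k Q n ∘ₗ cornerMap g i v (n - 1)) := by
    refine LinearMap.ext fun x => funext fun β => Subtype.ext ?_
    rw [LinearMap.comp_apply, hG, koszulD₂_apply, map_mul, hg.dbl]
    change _ = q • (vert k Q i * (g.toEquiv x * vert k Q v) * dbl k Q β)
    rw [mul_assoc, mul_assoc, vert_mul_dbl, ← hg.mul β, mul_comm (s β)]
    by_cases h : Q.double.src β = v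
    · rw [if_pos h, if_pos h.symm, mul_smul_comm, mul_smul_comm, smul_smul]
    · rw [if_neg h, if_neg (Ne.symm h)]; simp
  have e4 : G ∘ₗ koszulProj k Q n
      = (G ∘ₗ t) ∘ₗ koszulD₁ k Q n + (G ∘ₗ koszulD₂ k Q n) ∘ₗ r := by
    refine LinearMap.ext fun y => ?_
    simp only [LinearMap.comp_apply, LinearMap.add_apply]
    rw [h3, map_add]
  have h1' : r ∘ₗ koszulD₂ k Q n = LinearMap.id := LinearMap.ext h1
  have h2' : koszulD₁ k Q n ∘ₗ t = LinearMap.id := LinearMap.ext h2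
  -- The contraction writes `G ∘ koszulProj` as a sum of two composites; cyclicity of the trace
  -- moves each of them to an end of the sequence.
  have e5 := congrArg (LinearMap.trace k _) e4
  rw [e1, LinearMap.trace_pi_diagonal, map_add, LinearMap.trace_comp_comm' (koszulD₁ k Q n) (G ∘ₗ t),
    ← LinearMap.comp_assoc, e2, LinearMap.comp_assoc, h2', LinearMap.comp_id, e3,
    LinearMap.smul_comp, map_smul, LinearMap.trace_comp_comm', ← LinearMap.comp_assoc, h1',
    LinearMap.id_comp] at e5
  rw [cornerTrace, cornerTrace, ← smul_eq_mul (a := q), ← e5]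
  refine Finset.sum_congr rfl fun β _ => ?_
  rw [map_smul, smul_eq_mul, ite_mul, zero_mul]
  rfl

theorem cornerTrace_of_neg (g : GradedAut (grading k Q)) (i j : V) {n : ℤ} (hn : n < 0) :
    cornerTrace g i j n = 0 := by
  have : cornerMap g i j n = 0 := by
    refine LinearMap.ext fun x => Subtype.ext ?_
    have hx : (x : Preproj k Q) = 0 := (Submodule.mem_bot k).1 ((zgr_of_neg _ hn).le x.2)
    rw [cornerMap_apply, hx]
    simp
  rw [cornerTrace, this, map_zero]

theorem vert_mul_eq (i : V) {a : Preproj k Q} (ha : a ∈ grading k Q 0) :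
    vert k Q i * a = aug k Q a i • vert k Q i := by
  conv_lhs => rw [eq_sum_aug k Q ha]
  simp [Finset.mul_sum, vert_mul_vert]

theorem ScalesArrows.fix {g : GradedAut (grading k Q)} {s : E ⊕ E → k} {q : k}
    (hg : ScalesArrows g s q) {a : Preproj k Q} (ha : a ∈ grading k Q 0) : g.toEquiv a = a := by
  rw [eq_sum_aug k Q ha, map_sum]
  exact Finset.sum_congr rfl fun v _ => by rw [map_smul, hg.vert]

theorem cornerTrace_zero {g : GradedAut (grading k Q)} {s : E ⊕ E → k} {q : k}
    (hg : ScalesArrows g s q) (i j : V) : cornerTrace g i j 0 = if i = j then 1 else 0 := by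
  -- The map has rank at most one: it factors through the coordinate at `i`, so its trace can be
  -- taken on `k`.
  have h : cornerMap g i j 0 = LinearMap.toSpanSingleton k _
      (⟨if i = j then vert k Q i else 0, by
        split_ifs
        · exact vert_mem k Q i
        · exact Submodule.zero_mem _⟩ : zgr (grading k Q) 0) ∘ₗ
      (LinearMap.proj i ∘ₗ (aug k Q).toLinearMap ∘ₗ (zgr (grading k Q) 0).subtype) := by
    refine LinearMap.ext fun x => Subtype.ext ?_
    rw [cornerMap_apply, hg.fix x.2, ← mul_assoc, vert_mul_eq i x.2, smul_mul_assoc, vert_mul_vert]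
    rfl
  rw [cornerTrace, h, LinearMap.trace_comp_comm']
  have h2 : (LinearMap.proj i ∘ₗ (aug k Q).toLinearMap ∘ₗ (zgr (grading k Q) 0).subtype) ∘ₗ
      LinearMap.toSpanSingleton k _
      (⟨if i = j then vert k Q i else 0, by
        split_ifs
        · exact vert_mem k Q i
        · exact Submodule.zero_mem _⟩ : zgr (grading k Q) 0) =
      (if i = j then (1 : k) else 0) • LinearMap.id := by
    ext
    simp only [LinearMap.comp_apply, LinearMap.toSpanSingleton_apply, one_smul,
      Submodule.subtype_apply, AlgHom.toLinearMap_apply, LinearMap.proj_apply]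
    split_ifs <;> simp
  rw [h2, map_smul, LinearMap.trace_id]
  simp

end Koszul

end Preproj

namespace Preproj

open GradedRight

/-! ### Vanishing of the socle -/

section Socle

variable {k : Type*} [Field k] {V E : Type*} [Fintype V] [DecidableEq V] [Fintype E]
  {Q : FinQuiver V E}

theorem eq_sum_corner (x : Preproj k Q) : x = ∑ i, ∑ v, vert k Q i * x * vert k Q v := by
  simp_rw [← Finset.mul_sum, sum_vert, mul_one, ← Finset.sum_mul, sum_vert, one_mul]

/-- A pair of maps of `e_i A_m` and `e_i A_{m+1}` which commutes with the right multiplication by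
the arrows and the vertices. -/
structure IsPairEnd (i : V) (m : ℕ) (φ ψ : Preproj k Q →ₗ[k] Preproj k Q) : Prop where
  mem : ∀ y ∈ grading k Q m, φ y ∈ grading k Q m
  comm_dbl : ∀ y ∈ grading k Q m, ∀ β, ψ (y * dbl k Q β) = φ y * dbl k Q β
  comm_vert : ∀ y ∈ grading k Q m, ∀ w, φ (y * vert k Q w) = φ y * vert k Q w
  left : ∀ y ∈ grading k Q m, vert k Q i * φ y = φ y
  right : ∀ y ∈ grading k Q m, φ (vert k Q i * y) = φ y

/-- The arrows generate `A_{m+1}` from `A_m`, so `φ` determines `ψ`. -/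
theorem IsPairEnd.snd_scalar {i : V} {m : ℕ} {φ ψ : Preproj k Q →ₗ[k] Preproj k Q}
    (h : IsPairEnd i m φ ψ) {c : k} (hc : ∀ y ∈ grading k Q m, φ y = c • (vert k Q i * y))
    (y : Preproj k Q) (hy : y ∈ grading k Q (m + 1)) : ψ y = c • (vert k Q i * y) := by
  obtain ⟨u, hu, rfl⟩ := exists_sum_dbl k Q hy
  rw [map_sum, Finset.mul_sum, Finset.smul_sum]
  refine Finset.sum_congr rfl fun β _ => ?_
  rw [h.comm_dbl _ (hu β), hc _ (hu β), smul_mul_assoc, mul_assoc]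

theorem vert_mul_mem (v : V) {m : ℕ} {y : Preproj k Q} (hy : y ∈ grading k Q m) :
    vert k Q v * y ∈ grading k Q m := by
  simpa using SetLike.mul_mem_graded (vert_mem k Q v) hy

theorem mul_vert_mem (v : V) {m : ℕ} {y : Preproj k Q} (hy : y ∈ grading k Q m) :
    y * vert k Q v ∈ grading k Q m := by
  simpa using SetLike.mul_mem_graded hy (vert_mem k Q v)

/-- If the socle of `A` vanishes in degrees below `N`, then the endomorphisms of `e_i A` in two
adjacent degrees are the scalars. -/
theorem IsPairEnd.scalar (i : V) {N : ℕ}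
    (hinj : ∀ m < N, ∀ x ∈ grading k Q m, (∀ β, x * dbl k Q β = 0) → x = 0)
    {m : ℕ} (hm : m ≤ N) {φ ψ : Preproj k Q →ₗ[k] Preproj k Q} (h : IsPairEnd i m φ ψ) :
    ∃ c : k, (∀ y ∈ grading k Q m, φ y = c • (vert k Q i * y)) ∧
      ∀ y ∈ grading k Q (m + 1), ψ y = c • (vert k Q i * y) := by
  suffices ∃ c : k, ∀ y ∈ grading k Q m, φ y = c • (vert k Q i * y) by
    obtain ⟨c, hc⟩ := this
    exact ⟨c, hc, h.snd_scalar hc⟩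
  induction m generalizing φ ψ with
  | zero =>
    refine ⟨aug k Q (φ (vert k Q i)) i, fun y hy => ?_⟩
    rw [← h.right y hy, vert_mul_eq i hy, map_smul,
      ← h.left _ (vert_mem k Q i), vert_mul_eq i (h.mem _ (vert_mem k Q i)), smul_comm]
    rw [map_smul]
    simp
  | succ m ih =>
    -- Descent by one degree. The tuple `(φ(x β))_β` is killed by the second Koszul map, because `ψ`
    -- vanishes on `x ∑ β β' = 0`; middle exactness writes it as `(x' β)_β`. Injectivity in degree
    -- `m` makes `x'` unique, and the left inverse `L` makes it linear in `x`. Then `(φ', φ)` is a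
    -- pair in degree `m`.
    let D : Preproj k Q →ₗ[k] (E ⊕ E → Preproj k Q) :=
      LinearMap.pi fun β => LinearMap.mulRight k (dbl k Q β)
    obtain ⟨L, hL⟩ := (D ∘ₗ (grading k Q m).subtype).exists_leftInverse_of_injective
      (LinearMap.ker_eq_bot'.2 fun x hx => Subtype.ext
        (hinj m (by omega) x x.2 fun β => congrFun hx β))
    let φ' : Preproj k Q →ₗ[k] Preproj k Q :=
      (grading k Q m).subtype ∘ₗ L ∘ₗ LinearMap.pi fun β => φ ∘ₗ LinearMap.mulRight k
        (dbl k Q β)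
    have hφ' : ∀ x ∈ grading k Q m, φ' x ∈ grading k Q m ∧
        ∀ β, φ (x * dbl k Q β) = φ' x * dbl k Q β := by
      intro x hx
      have hxb : ∀ β, x * dbl k Q β ∈ grading k Q (m + 1) := fun β =>
        SetLike.mul_mem_graded hx (dbl_mem k Q β)
      obtain ⟨x', hx', e⟩ := exists_eq_mul_dbl_zgr k Q (p := m) (q := (m + 1 : ℕ)) (by simp)
        (fun β => φ (x * dbl k Q β))
        (fun β => by rw [← h.comm_vert _ (hxb β), mul_assoc, dbl_vert])
        (by
          have e : ∀ β, φ (x * dbl k Q β) * codbl k Q β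
              = ψ (x * dbl k Q β * codbl k Q β) := by
            intro β
            rw [codbl, mul_smul_comm, mul_smul_comm, map_smul, h.comm_dbl _ (hxb β)]
          simp_rw [e, ← map_sum, mul_assoc, ← Finset.mul_sum, sum_dbl_codbl, mul_zero, map_zero])
        (fun β => h.mem _ (hxb β))
      have e2 : φ' x = x' := by
        have := LinearMap.congr_fun hL ⟨x', hx'⟩
        have e3 : φ' x = L (fun β => φ (x * dbl k Q β)) := rfl
        rw [e3, funext e]
        exact congrArg Subtype.val this
      rw [e2]
      exact ⟨hx', e⟩
    have huniq : ∀ x ∈ grading k Q m, ∀ y ∈ grading k Q m,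
        (∀ β, x * dbl k Q β = y * dbl k Q β) → x = y := by
      intro x hx y hy hxy
      rw [← sub_eq_zero]
      exact hinj m (by omega) _ (Submodule.sub_mem _ hx hy) fun β => by
        rw [sub_mul, hxy, sub_self]
    obtain ⟨c, hc⟩ := ih (by omega) (φ := φ') (ψ := φ)
      { mem := fun y hy => (hφ' y hy).1
        comm_dbl := fun y hy β => (hφ' y hy).2 β
        comm_vert := fun y hy w => by
          refine huniq _ (hφ' _ (mul_vert_mem w hy)).1 _ (mul_vert_mem w (hφ' y hy).1) fun β => ?_
          rw [← (hφ' _ (mul_vert_mem w hy)).2, mul_assoc, mul_assoc, vert_mul_dbl]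
          split_ifs
          · exact (hφ' y hy).2 β
          · simp
        left := fun y hy => by
          refine huniq _ (vert_mul_mem i (hφ' y hy).1) _ (hφ' y hy).1 fun β => ?_
          rw [mul_assoc, ← (hφ' y hy).2, h.left _ (SetLike.mul_mem_graded hy (dbl_mem k Q β))]
        right := fun y hy => by
          refine huniq _ (hφ' _ (vert_mul_mem i hy)).1 _ (hφ' y hy).1 fun β => ?_
          rw [← (hφ' y hy).2, ← (hφ' _ (vert_mul_mem i hy)).2, mul_assoc,
            h.right _ (SetLike.mul_mem_graded hy (dbl_mem k Q β))] }
    refine ⟨c, fun y hy => ?_⟩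
    obtain ⟨u, hu, rfl⟩ := exists_sum_dbl k Q hy
    rw [map_sum, Finset.mul_sum, Finset.smul_sum]
    refine Finset.sum_congr rfl fun β _ => ?_
    rw [(hφ' _ (hu β)).2, hc _ (hu β), smul_mul_assoc, mul_assoc]

/-- The identity, as a graded automorphism. -/
def idAut : GradedAut (grading k Q) := ⟨AlgEquiv.refl, fun _ _ => Iff.rfl⟩

theorem scalesArrows_idAut : ScalesArrows (k := k) (Q := Q) idAut (fun _ => 1) 1 where
  vert _ := rfl
  dbl _ := (one_smul _ _).symm
  mul _ := one_mul _

/-- The weighted dimension of `e_i A_m`, for an additive function `δ`. -/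
theorem sum_weight_cornerTrace (δ : V → ℕ)
    (hδ : ∀ v, ∑ β, (if Q.double.src β = v then δ (Q.double.tgt β) else 0) = 2 * δ v)
    {N : ℕ} (hinj : ∀ m < N, ∀ x ∈ grading k Q m, (∀ β, x * dbl k Q β = 0) → x = 0) (i : V)
    {m : ℕ} (hm : m ≤ N + 1) :
    ∑ v, (δ v : k) * cornerTrace (k := k) (Q := Q) idAut i v (m : ℤ) = (m + 1) * δ i := by
  -- The trace recursion of the identity summed against `δ`. As `δ` is an eigenvector of the
  -- adjacency matrix for the eigenvalue `2`, the weighted dimensions form an arithmetic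
  -- progression.
  have hstep : ∀ n : ℕ, n ≤ N →
      ∑ v, (δ v : k) * cornerTrace (k := k) (Q := Q) idAut i v ((n : ℤ) + 1)
        + ∑ v, (δ v : k) * cornerTrace (k := k) (Q := Q) idAut i v ((n : ℤ) - 1)
      = 2 * ∑ v, (δ v : k) * cornerTrace (k := k) (Q := Q) idAut i v (n : ℤ) := by
    intro n hn
    have h1 : ∀ v, cornerTrace (k := k) (Q := Q) idAut i v ((n : ℤ) + 1)
        + cornerTrace (k := k) (Q := Q) idAut i v ((n : ℤ) - 1)
        = ∑ β, if Q.double.src β = v then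
            cornerTrace (k := k) (Q := Q) idAut i (Q.double.tgt β) n else 0 := by
      intro v
      have := cornerTrace_recursion (scalesArrows_idAut (k := k) (Q := Q)) n (by omega) (by
        intro x hx hxb
        cases n with
        | zero => 
          rw [zgr_of_neg _ (by simp)] at hx
          exact (Submodule.mem_bot k).1 hx
        | succ n =>
          refine hinj n (by omega) x ?_ hxb
          have e : ((n + 1 : ℕ) : ℤ) - 1 = (n : ℤ) := by simp
          rw [e] at hx
          exact hx) i v
      simpa only [one_mul] using this
    rw [← Finset.sum_add_distrib]
    simp_rw [← mul_add, h1, Finset.mul_sum]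
    rw [Finset.sum_comm]
    simp_rw [mul_ite, mul_zero, Finset.sum_ite_eq, Finset.mem_univ, if_true]
    have h2 : ∀ v, 2 * ((δ v : k) * cornerTrace (k := k) (Q := Q) idAut i v (n : ℤ)) =
        ∑ β, if Q.double.src β = v then
          (δ (Q.double.tgt β) : k) * cornerTrace (k := k) (Q := Q) idAut i v (n : ℤ) else 0 := by
      intro v
      have := congrArg (fun r : ℕ => (r : k)) (hδ v)
      simp only [Nat.cast_sum, Nat.cast_mul, Nat.cast_ite, Nat.cast_zero, Nat.cast_ofNat] at this
      rw [← mul_assoc, ← this, Finset.sum_mul]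
      simp_rw [ite_mul, zero_mul]
    simp_rw [h2]
    rw [Finset.sum_comm]
    simp_rw [Finset.sum_ite_eq, Finset.mem_univ, if_true]
    rw [← (Equiv.sumComm E E).sum_comp]
    refine Finset.sum_congr rfl fun β _ => ?_
    change (δ (Q.double.src β.swap) : k) * cornerTrace idAut i (Q.double.tgt β.swap) n = _
    rw [FinQuiver.double_src_swap, FinQuiver.double_tgt_swap]
  have h0 : ∑ v, (δ v : k) * cornerTrace (k := k) (Q := Q) idAut i v ((0 : ℕ) : ℤ) = δ i := by
    rw [Nat.cast_zero]
    simp_rw [cornerTrace_zero (scalesArrows_idAut (k := k) (Q := Q)), mul_ite, mul_one, mul_zero,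
      Finset.sum_ite_eq, Finset.mem_univ, if_true]
  induction m using Nat.strong_induction_on with
  | _ m ih =>
    match m with
    | 0 => rw [h0]; simp
    | 1 =>
      have := hstep 0 (by omega)
      rw [h0] at this
      simp_rw [cornerTrace_of_neg (k := k) (Q := Q) idAut i _ (n := ((0 : ℕ) : ℤ) - 1) (by simp),
        mul_zero, Finset.sum_const_zero, add_zero] at this
      have e : ((0 : ℕ) : ℤ) + 1 = ((1 : ℕ) : ℤ) := by simp
      rw [e] at this
      rw [this]
      push_cast
      ring
    | m + 2 =>
      have := hstep (m + 1) (by omega)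
      have e : ((m + 1 : ℕ) : ℤ) + 1 = ((m + 2 : ℕ) : ℤ) := by push_cast; ring
      have e' : ((m + 1 : ℕ) : ℤ) - 1 = ((m : ℕ) : ℤ) := by push_cast; ring
      rw [e, e', ih m (by omega) (by omega), ih (m + 1) (by omega) (by omega)] at this
      rw [eq_sub_of_add_eq this]
      push_cast
      ring

/-- The preprojective algebra of a quiver with a positive additive function has no socle. -/
theorem eq_zero_of_mul_dbl [CharZero k] (δ : V → ℕ) (hpos : ∀ v, 0 < δ v)
    (hδ : ∀ v, ∑ β, (if Q.double.src β = v then δ (Q.double.tgt β) else 0) = 2 * δ v)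
    (x : Preproj k Q) (hx : ∀ β, x * dbl k Q β = 0) : x = 0 := by
  suffices H : ∀ N, ∀ x ∈ grading k Q N, (∀ β, x * dbl k Q β = 0) → x = 0 by
    refine ext_zproj (grading k Q) fun n => ?_
    rw [map_zero]
    refine H n _ (zproj_mem (grading k Q) n x) fun β => ?_
    rw [← zproj_mul (grading k Q) (dbl_mem k Q β) n (n + 1) (by simp), hx, map_zero]
  intro N
  induction N using Nat.strong_induction_on with
  | _ N hinj =>
    intro x hxN hxb
    by_contra hne
    have : ∃ i v, vert k Q i * x * vert k Q v ≠ 0 := by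
      by_contra hall
      push Not at hall
      apply hne
      rw [eq_sum_corner x]
      simp [hall]
    obtain ⟨i, v, hiv⟩ := this
    set x' := vert k Q i * x * vert k Q v with hx'
    have hx'N : x' ∈ grading k Q N := mul_vert_mem v (vert_mul_mem i hxN)
    have hix : vert k Q i * x' = x' := by
      rw [hx', mul_assoc (vert k Q i) x, ← mul_assoc (vert k Q i), vert_idem]
    obtain ⟨f, hf⟩ : ∃ f : Module.Dual k (Preproj k Q), f x' ≠ 0 := by
      by_contra hall
      push Not at hall
      exact hiv ((Module.forall_dual_apply_eq_zero_iff k x').1 hall)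
    -- A rank-one endomorphism of `A_N` with image spanned by the socle element `x'`. Since the
    -- arrows kill `x'`, it forms a pair with `ψ = 0`.
    let φ : Preproj k Q →ₗ[k] Preproj k Q :=
      LinearMap.toSpanSingleton k _ x' ∘ₗ f ∘ₗ LinearMap.mulLeft k (vert k Q i) ∘ₗ
        LinearMap.mulRight k (vert k Q v)
    have hφ : ∀ y, φ y = f (vert k Q i * (y * vert k Q v)) • x' := fun _ => rfl
    have hP : IsPairEnd i N φ 0 :=
      { mem := fun y _ => Submodule.smul_mem _ _ hx'N
        comm_dbl := fun y _ β => by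
          have : x' * dbl k Q β = 0 := by
            rw [hx', mul_assoc, vert_mul_dbl, mul_assoc]
            split_ifs
            · rw [hxb, mul_zero]
            · rw [mul_zero, mul_zero]
          rw [hφ, smul_mul_assoc, this, smul_zero]
          rfl
        comm_vert := fun y _ w => by
          rw [hφ, hφ, smul_mul_assoc, mul_assoc, vert_mul_vert, hx', mul_assoc _ _ (vert k Q w),
            vert_mul_vert]
          by_cases h : w = v
          · subst h; simp
          · rw [if_neg h, if_neg (Ne.symm h)]; simp
        left := fun y _ => by
          rw [hφ, mul_smul_comm, hix]
        right := fun y _ => by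
          rw [hφ, hφ, mul_assoc, ← mul_assoc (vert k Q i), vert_idem] }
    obtain ⟨c, hc1, hc2⟩ := hP.scalar i hinj le_rfl
    have hc : c ≠ 0 := by
      rintro rfl
      have h1 := hc1 x' hx'N
      have h2 : vert k Q i * (x' * vert k Q v) = x' := by
        rw [hx', mul_assoc _ (vert k Q v), vert_idem, ← mul_assoc, ← mul_assoc, vert_idem]
      rw [hφ, zero_smul, h2] at h1
      rcases smul_eq_zero.1 h1 with h | h
      · exact hf h
      · exact hiv h
    -- On `e_i A_{N+1}` the zero map is the nonzero scalar `c`, so this space vanishes, against its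
    -- weighted dimension `(N + 2) δ_i`.
    have hz : ∀ w, cornerTrace (k := k) (Q := Q) idAut i w ((N + 1 : ℕ) : ℤ) = 0 := by
      intro w
      have : cornerMap (k := k) (Q := Q) idAut i w ((N + 1 : ℕ) : ℤ) = 0 := by
        refine LinearMap.ext fun y => Subtype.ext ?_
        have h := hc2 y y.2
        rw [LinearMap.zero_apply] at h
        have h := (smul_eq_zero.1 h.symm).resolve_left hc
        rw [cornerMap_apply]
        change vert k Q i * ((y : Preproj k Q) * vert k Q w) = 0
        rw [← mul_assoc, h, zero_mul]
      rw [cornerTrace, this, map_zero]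
    have hw := sum_weight_cornerTrace δ hδ hinj i le_rfl
    simp_rw [hz, mul_zero, Finset.sum_const_zero] at hw
    have : ((N + 1 : ℕ) + 1 : k) * δ i ≠ 0 := by
      have h1 : (((N + 1 : ℕ) : k) + 1) = ((N + 2 : ℕ) : k) := by push_cast; ring
      rw [h1]
      exact mul_ne_zero (Nat.cast_ne_zero.2 (by omega)) (Nat.cast_ne_zero.2 (hpos i).ne')
    exact this hw.symm

end Socle

end Preproj

namespace GradedRight

/-! ### The bar differential -/

section Bar

variable {k A : Type*} [Field k] [Ring A] [Algebra k A] {𝒜 : ℕ → Submodule k A}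
variable {N N' M : Type*}
  [AddCommGroup N] [Module k N] [Module Aᵐᵒᵖ N] [IsScalarTower k Aᵐᵒᵖ N]
  [AddCommGroup N'] [Module k N'] [Module Aᵐᵒᵖ N'] [IsScalarTower k Aᵐᵒᵖ N']
  [AddCommGroup M] [Module k M] [Module Aᵐᵒᵖ M] [IsScalarTower k Aᵐᵒᵖ M]
  {𝒩 : ℤ → Submodule k N} {𝒩' : ℤ → Submodule k N'} {ℳ : ℤ → Submodule k M}

/-- The cochain `φ(x, a, …)` on the free module `A`, for fixed `x`. -/
def slice {n : ℕ} (φ : N → (Fin (n + 1) → A) → M) (x : N) : A → (Fin n → A) → M :=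
  fun a c => φ x (Fin.cons a c)

variable (k) in
/-- `k`-multilinearity of a cochain. -/
def IsML {n : ℕ} (φ : N → (Fin n → A) → M) : Prop :=
  ∃ Φ : N →ₗ[k] MultilinearMap k (fun _ : Fin n => A) M, ∀ x a, φ x a = Φ x a

theorem IsML.add_left {n : ℕ} {φ : N → (Fin n → A) → M} (h : IsML k φ) (x y : N)
    (a : Fin n → A) : φ (x + y) a = φ x a + φ y a := by
  obtain ⟨Φ, hΦ⟩ := h; simp [hΦ]

theorem IsML.smul_left {n : ℕ} {φ : N → (Fin n → A) → M} (h : IsML k φ) (c : k) (x : N)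
    (a : Fin n → A) : φ (c • x) a = c • φ x a := by
  obtain ⟨Φ, hΦ⟩ := h; simp [hΦ]

/-- A multilinear cochain as a linear map in its first variable. -/
def IsML.evalLeft {n : ℕ} {φ : N → (Fin n → A) → M} (h : IsML k φ) (a : Fin n → A) :
    N →ₗ[k] M where
  toFun x := φ x a
  map_add' x y := h.add_left x y a
  map_smul' c x := h.smul_left c x a

theorem IsML.zero_left {n : ℕ} {φ : N → (Fin n → A) → M} (h : IsML k φ) (a : Fin n → A) :
    φ 0 a = 0 := map_zero (h.evalLeft a)

theorem IsML.sub_left {n : ℕ} {φ : N → (Fin n → A) → M} (h : IsML k φ) (x y : N)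
    (a : Fin n → A) : φ (x - y) a = φ x a - φ y a := map_sub (h.evalLeft a) x y

theorem IsML.sum_left {n : ℕ} {φ : N → (Fin n → A) → M} (h : IsML k φ) {ι : Type*} (s : Finset ι)
    (x : ι → N) (a : Fin n → A) : φ (∑ i ∈ s, x i) a = ∑ i ∈ s, φ (x i) a :=
  map_sum (h.evalLeft a) x s

theorem isML_iff {n : ℕ} {φ : N → (Fin n → A) → M} : IsML k φ ↔
    (∀ x, ∃ μ : MultilinearMap k (fun _ : Fin n => A) M, ∀ a, φ x a = μ a) ∧
    (∀ x y a, φ (x + y) a = φ x a + φ y a) ∧ ∀ (c : k) x a, φ (c • x) a = c • φ x a := by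
  refine ⟨fun h => ⟨fun x => ⟨h.choose x, h.choose_spec x⟩, h.add_left, h.smul_left⟩,
    fun ⟨h1, h2, h3⟩ => ?_⟩
  choose μ hμ using h1
  exact ⟨{ toFun := μ
           map_add' := fun x y => by ext a; simp [← hμ, h2]
           map_smul' := fun c x => by ext a; simp [← hμ, h3] }, hμ⟩

theorem isML_succ_iff {n : ℕ} {φ : N → (Fin (n + 1) → A) → M} : IsML k φ ↔
    (∀ x, IsML k (slice φ x)) ∧
    (∀ x y a, φ (x + y) a = φ x a + φ y a) ∧ ∀ (c : k) x a, φ (c • x) a = c • φ x a := by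
  refine ⟨fun h => ⟨fun x => ?_, h.add_left, h.smul_left⟩, fun ⟨h1, h2, h3⟩ => isML_iff.2
    ⟨fun x => ?_, h2, h3⟩⟩
  · obtain ⟨Φ, hΦ⟩ := h
    exact ⟨(Φ x).curryLeft, fun a c => hΦ x _⟩
  · obtain ⟨Ψ, hΨ⟩ := h1 x
    refine ⟨LinearMap.uncurryLeft Ψ, fun a => ?_⟩
    rw [LinearMap.uncurryLeft_apply, ← hΨ, slice, Fin.cons_self_tail]

theorem isML_of_mem {n : ℕ} {ℓ : ℤ} {φ : N → (Fin n → A) → M} (h : φ ∈ cochains 𝒜 𝒩 ℳ n ℓ) :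
    IsML k φ := h.1

/-- Currying the first algebra variable turns a cochain on `N` into cochains on the free module `A`
with one variable less, the degree of `x` being absorbed into the shift. -/
theorem mem_cochains_succ {n : ℕ} {ℓ : ℤ} {φ : N → (Fin (n + 1) → A) → M} :
    φ ∈ cochains 𝒜 𝒩 ℳ (n + 1) ℓ ↔ IsML k φ ∧
      ∀ p, ∀ x ∈ 𝒩 p, slice φ x ∈ cochains 𝒜 (zgr 𝒜) ℳ n (p + ℓ) := by
  constructor
  · rintro ⟨h1, h2⟩
    refine ⟨h1, fun p x hx => ⟨(isML_succ_iff.1 h1).1 x, fun q d a c ha hc => ?_⟩⟩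
    cases q with
    | ofNat m =>
      have := h2 p (Fin.cons m d) x (Fin.cons a c) hx (fun i => by
        refine Fin.cases ?_ (fun i => ?_) i
        · exact ha
        · exact hc i)
      rw [Fin.sum_univ_succ] at this
      simp only [Fin.cons_zero, Fin.cons_succ] at this
      have e : p + ((m : ℤ) + ∑ i, (d i : ℤ)) + ℓ = Int.ofNat m + ∑ i, (d i : ℤ) + (p + ℓ) := by
        rw [Int.ofNat_eq_natCast]; ring
      rw [e] at this
      exact this
    | negSucc m =>
      have h0 : a = 0 := ha
      rw [h0, ((isML_succ_iff.1 h1).1 x).zero_left]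
      exact Submodule.zero_mem _
  · rintro ⟨h1, h2⟩
    refine ⟨h1, fun p d x a hx ha => ?_⟩
    have := (h2 p x hx).2 (d 0) (fun i => d i.succ) (a 0) (Fin.tail a) (ha 0) (fun i => ha i.succ)
    rw [slice, Fin.cons_self_tail] at this
    rw [Fin.sum_univ_succ]
    have e : p + ((d 0 : ℤ) + ∑ i : Fin n, (d i.succ : ℤ)) + ℓ
      = d 0 + ∑ i : Fin n, (d i.succ : ℤ) + (p + ℓ) := by ring
    rw [e]
    exact this

theorem slice_mem {n : ℕ} {ℓ ℓ' p : ℤ} {φ : N → (Fin (n + 1) → A) → M}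
    (h : φ ∈ cochains 𝒜 𝒩 ℳ (n + 1) ℓ) {x : N} (hx : x ∈ 𝒩 p) (e : ℓ' = p + ℓ) :
    slice φ x ∈ cochains 𝒜 (zgr 𝒜) ℳ n ℓ' := by
  subst e
  exact (mem_cochains_succ.1 h).2 p x hx

theorem comp_mem {n : ℕ} {ℓ ℓ' j : ℤ} {φ : N → (Fin n → A) → M} (h : φ ∈ cochains 𝒜 𝒩 ℳ n ℓ)
    (u : N' →ₗ[k] N) (hu : ∀ p, ∀ x ∈ 𝒩' p, u x ∈ 𝒩 (p + j)) (e : ℓ' = ℓ + j) :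
    (fun x a => φ (u x) a) ∈ cochains 𝒜 𝒩' ℳ n ℓ' := by
  subst e
  obtain ⟨⟨Φ, hΦ⟩, h2⟩ := h
  refine ⟨⟨Φ ∘ₗ u, fun x a => hΦ _ _⟩, fun p d x a hx ha => ?_⟩
  have := h2 (p + j) d (u x) a (hu p x hx) ha
  have e : p + j + ∑ i, (d i : ℤ) + ℓ = p + ∑ i, (d i : ℤ) + (ℓ + j) := by ring
  rw [e] at this
  exact this

theorem barD_comp {n : ℕ} (φ : N → (Fin n → A) → M) (u : N' → N)
    (hu : ∀ (a : A) x, u (op a • x) = op a • u x) (x : N') (a : Fin (n + 1) → A) :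
    barD k A N' M n (fun x a => φ (u x) a) x a = barD k A N M n φ (u x) a := by
  simp only [barD, LinearMap.coe_mk, AddHom.coe_mk, hu]

theorem barD_zero_apply (φ : N → (Fin 0 → A) → M) (x : N) (a : Fin 1 → A) :
    barD k A N M 0 φ x a = φ (op (a 0) • x) Fin.elim0 - op (a 0) • φ x Fin.elim0 := by
  have h : ∀ c : Fin 0 → A, c = Fin.elim0 := fun c => Subsingleton.elim _ _
  simp only [barD, LinearMap.coe_mk, AddHom.coe_mk, Finset.univ_eq_empty, Finset.sum_empty,
    add_zero, zero_add, pow_one, neg_smul, one_smul]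
  rw [h fun i => a i.succ, h fun i => a i.castSucc, sub_eq_add_neg]
  rfl

theorem contractNth_zero_cons {n : ℕ} (a : A) (c : Fin (n + 1) → A) :
    Fin.contractNth (0 : Fin (n + 2)) (· * ·) (Fin.cons a c : Fin (n + 2) → A)
      = Fin.cons (a * c 0) (fun i : Fin n => c i.succ) := by
  funext i
  refine Fin.cases ?_ (fun i => ?_) i
  · simp [Fin.contractNth]
  · simp [Fin.contractNth]

theorem contractNth_succ_cons {n : ℕ} (j : Fin (n + 1)) (a : A) (c : Fin (n + 1) → A) :
    Fin.contractNth j.succ (· * ·) (Fin.cons a c : Fin (n + 2) → A)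
      = Fin.cons a (Fin.contractNth j (· * ·) c) := by
  funext i
  refine Fin.cases ?_ (fun i => ?_) i
  · simp [Fin.contractNth]
  · simp only [Fin.contractNth, Fin.cons_succ, Fin.val_succ, Nat.add_lt_add_iff_right,
      Nat.add_right_cancel_iff]
    split_ifs
    · rw [← Fin.succ_castSucc, Fin.cons_succ]
    · rw [← Fin.succ_castSucc, Fin.cons_succ]
    · rfl

/-- The first term of the alternating sum is kept apart; the remaining terms are those of the
differential of the slice at `x`, with opposite signs. Multilinearity, homogeneity and `d² = 0`
follow from this recursion. -/
theorem barD_cons {n : ℕ} (φ : N → (Fin (n + 1) → A) → M) (x : N) (a : A) (c : Fin (n + 1) → A) :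
    barD k A N M (n + 1) φ x (Fin.cons a c) =
      φ (op a • x) c - barD k A A M n (slice φ x) a c := by
  simp only [barD, LinearMap.coe_mk, AddHom.coe_mk, Fin.cons_zero, Fin.cons_succ]
  rw [Fin.sum_univ_succ]
  have h1 : (fun i : Fin (n + 1) => (Fin.cons a c : Fin (n + 2) → A) i.castSucc)
      = Fin.cons a (fun i : Fin n => c i.castSucc) := by
    funext i
    refine Fin.cases rfl (fun i => ?_) i
    rw [← Fin.succ_castSucc, Fin.cons_succ, Fin.cons_succ]
  have h2 : (Fin.cons a c : Fin (n + 2) → A) (Fin.last (n + 1)) = c (Fin.last n) := by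
    rw [← Fin.succ_last, Fin.cons_succ]
  rw [h1, h2]
  simp only [Fin.castSucc_zero, contractNth_zero_cons, Fin.castSucc_succ, contractNth_succ_cons,
    slice, Fin.val_zero, Fin.val_succ, zero_add, pow_one, neg_smul, one_smul, op_smul_eq_mul]
  have h3 : ∀ (j : Fin n) (m : M), (-1 : k) ^ ((j : ℕ) + 1 + 1) • m
      = -((-1 : k) ^ ((j : ℕ) + 1) • m) := by
    intro j m
    rw [pow_succ _ ((j : ℕ) + 1)]; simp
  simp only [h3, Finset.sum_neg_distrib]
  rw [pow_succ _ (n + 1), mul_neg_one, neg_smul]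
  abel

theorem barD_add_left {n : ℕ} {φ : N → (Fin n → A) → M} (h : IsML k φ) (x y : N)
    (a : Fin (n + 1) → A) :
    barD k A N M n φ (x + y) a = barD k A N M n φ x a + barD k A N M n φ y a := by
  simp only [barD, LinearMap.coe_mk, AddHom.coe_mk, smul_add, h.add_left, Finset.sum_add_distrib]
  abel

theorem barD_smul_left {n : ℕ} {φ : N → (Fin n → A) → M} (h : IsML k φ) (c : k) (x : N)
    (a : Fin (n + 1) → A) : barD k A N M n φ (c • x) a = c • barD k A N M n φ x a := by
  have h1 : ∀ (b : A), op b • c • x = c • op b • x := fun b => smul_comm _ _ _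
  have h2 : ∀ (b : A) (m : M), op b • c • m = c • op b • m := fun b m => smul_comm _ _ _
  simp only [barD, LinearMap.coe_mk, AddHom.coe_mk, smul_add, h1, h.smul_left, h2, Finset.smul_sum,
    smul_comm _ c]

/-- Right translation of `x`, as a linear map. -/
def orbit (x : N) : A →ₗ[k] N where
  toFun a := op a • x
  map_add' a b := by rw [op_add, add_smul]
  map_smul' c a := by rw [op_smul, smul_assoc]; rfl

theorem slice_barD {n : ℕ} (φ : N → (Fin (n + 1) → A) → M) (x : N) :
    slice (barD k A N M (n + 1) φ) x
      = (fun a c => φ (orbit (k := k) x a) c) - barD k A A M n (slice φ x) := by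
  funext a c
  exact barD_cons φ x a c

theorem isML_barD_zero {φ : N → (Fin 0 → A) → M} (h : IsML k φ) : IsML k (barD k A N M 0 φ) := by
  refine isML_succ_iff.2 ⟨fun x => isML_iff.2 ⟨fun a => ?_, fun a b c => ?_, fun r a c => ?_⟩,
    barD_add_left h, barD_smul_left h⟩
  · exact ⟨MultilinearMap.constOfIsEmpty k _ (slice (barD k A N M 0 φ) x a Fin.elim0),
      fun c => by rw [Subsingleton.elim c Fin.elim0]; rfl⟩
  · simp only [slice, barD_zero_apply, Fin.cons_zero, op_add, add_smul, h.add_left]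
    abel
  · simp only [slice, barD_zero_apply, Fin.cons_zero, op_smul, smul_assoc, h.smul_left, smul_sub]

theorem isML_sub {n : ℕ} {φ ψ : N → (Fin n → A) → M} (h : IsML k φ) (h' : IsML k ψ) :
    IsML k (φ - ψ) := by
  obtain ⟨Φ, hΦ⟩ := h
  obtain ⟨Ψ, hΨ⟩ := h'
  exact ⟨Φ - Ψ, fun x a => by simp [hΦ, hΨ]⟩

theorem isML_comp {n : ℕ} {φ : N → (Fin n → A) → M} (h : IsML k φ) (u : N' →ₗ[k] N) :
    IsML k (fun x a => φ (u x) a) := by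
  obtain ⟨Φ, hΦ⟩ := h
  exact ⟨Φ ∘ₗ u, fun x a => hΦ _ _⟩

/-- The recursion replaces `N` by `A`, so the induction is closed only for `N = A`; a general `N`
takes one further step. Homogeneity and `d² = 0` are proved in the same two stages. -/
theorem isML_barD_succ {n : ℕ} (hA : ∀ φ : A → (Fin n → A) → M, IsML k φ → IsML k (barD k A A M n φ))
    {φ : N → (Fin (n + 1) → A) → M} (h : IsML k φ) : IsML k (barD k A N M (n + 1) φ) := by
  refine isML_succ_iff.2 ⟨fun x => ?_, barD_add_left h, barD_smul_left h⟩
  rw [slice_barD]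
  exact isML_sub (isML_comp h _) (hA _ ((isML_succ_iff.1 h).1 x))

theorem isML_barD_self {n : ℕ} (φ : A → (Fin n → A) → M) (h : IsML k φ) :
    IsML k (barD k A A M n φ) := by
  induction n with
  | zero => exact isML_barD_zero h
  | succ n ih => exact isML_barD_succ (fun φ hφ => ih φ hφ) h

theorem isML_barD {n : ℕ} {φ : N → (Fin n → A) → M} (h : IsML k φ) :
    IsML k (barD k A N M n φ) := by
  cases n with
  | zero => exact isML_barD_zero h
  | succ n => exact isML_barD_succ (fun φ hφ => isML_barD_self φ hφ) h

/-- The action of `A` on a graded right module is homogeneous. -/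
def GradedAction (𝒜 : ℕ → Submodule k A) (𝒩 : ℤ → Submodule k N) : Prop :=
  ∀ (n : ℕ) (p : ℤ), ∀ a ∈ 𝒜 n, ∀ x ∈ 𝒩 p, op a • x ∈ 𝒩 (p + n)

theorem gradedAction_zgr [SetLike.GradedMonoid 𝒜] : GradedAction 𝒜 (zgr 𝒜) :=
  fun _ _ _ ha _ hx => zgr_mul 𝒜 ha hx rfl

theorem orbit_mem (h𝒩 : GradedAction 𝒜 𝒩) {p : ℤ} {x : N} (hx : x ∈ 𝒩 p) (q : ℤ) (a : A)
    (ha : a ∈ zgr 𝒜 q) : orbit (k := k) x a ∈ 𝒩 (q + p) := by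
  cases q with
  | ofNat m => rw [add_comm]; exact h𝒩 m p a ha x hx
  | negSucc m =>
    have h0 : a = 0 := ha
    rw [h0, map_zero]; exact Submodule.zero_mem _

theorem barD_mem_zero (h𝒩 : GradedAction 𝒜 𝒩) (hℳ : GradedAction 𝒜 ℳ) {ℓ : ℤ}
    {φ : N → (Fin 0 → A) → M} (h : φ ∈ cochains 𝒜 𝒩 ℳ 0 ℓ) :
    barD k A N M 0 φ ∈ cochains 𝒜 𝒩 ℳ 1 ℓ := by
  refine ⟨isML_barD_zero h.1, fun p d x a hx ha => ?_⟩
  rw [barD_zero_apply]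
  refine Submodule.sub_mem _ ?_ ?_
  · have := h.2 _ Fin.elim0 _ Fin.elim0 (h𝒩 _ _ _ (ha 0) _ hx) (fun i => i.elim0)
    simpa using this
  · have := hℳ _ _ _ (ha 0) _ (h.2 _ Fin.elim0 _ Fin.elim0 hx (fun i => i.elim0))
    simp only [Finset.univ_eq_empty, Finset.sum_empty, add_zero] at this
    have e : p + ∑ i : Fin 1, (d i : ℤ) + ℓ = p + ℓ + d 0 := by simp; ring
    rw [e]
    exact this

theorem barD_mem_succ (h𝒩 : GradedAction 𝒜 𝒩) {n : ℕ} {ℓ : ℤ}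
    (hA : ∀ (ℓ : ℤ) (φ : A → (Fin n → A) → M), φ ∈ cochains 𝒜 (zgr 𝒜) ℳ n ℓ →
      barD k A A M n φ ∈ cochains 𝒜 (zgr 𝒜) ℳ (n + 1) ℓ)
    {φ : N → (Fin (n + 1) → A) → M} (h : φ ∈ cochains 𝒜 𝒩 ℳ (n + 1) ℓ) :
    barD k A N M (n + 1) φ ∈ cochains 𝒜 𝒩 ℳ (n + 2) ℓ := by
  refine mem_cochains_succ.2 ⟨isML_barD h.1, fun p x hx => ?_⟩
  rw [slice_barD]
  exact Submodule.sub_mem _ (comp_mem h _ (orbit_mem h𝒩 hx) (add_comm _ _))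
    (hA _ _ (slice_mem h hx rfl))

theorem barD_mem_self [SetLike.GradedMonoid 𝒜] (hℳ : GradedAction 𝒜 ℳ) {n : ℕ} (ℓ : ℤ)
    (φ : A → (Fin n → A) → M) (h : φ ∈ cochains 𝒜 (zgr 𝒜) ℳ n ℓ) :
    barD k A A M n φ ∈ cochains 𝒜 (zgr 𝒜) ℳ (n + 1) ℓ := by
  induction n generalizing ℓ with
  | zero => exact barD_mem_zero gradedAction_zgr hℳ h
  | succ n ih => exact barD_mem_succ gradedAction_zgr ih h

theorem barD_mem [SetLike.GradedMonoid 𝒜] (h𝒩 : GradedAction 𝒜 𝒩) (hℳ : GradedAction 𝒜 ℳ) {n : ℕ}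
    {ℓ : ℤ} {φ : N → (Fin n → A) → M} (h : φ ∈ cochains 𝒜 𝒩 ℳ n ℓ) :
    barD k A N M n φ ∈ cochains 𝒜 𝒩 ℳ (n + 1) ℓ := by
  cases n with
  | zero => exact barD_mem_zero h𝒩 hℳ h
  | succ n => exact barD_mem_succ h𝒩 (barD_mem_self hℳ) h

theorem barD_barD_zero (φ : N → (Fin 0 → A) → M) : barD k A N M 1 (barD k A N M 0 φ) = 0 := by
  funext x a
  rw [← Fin.cons_self_tail a, barD_cons]
  simp only [barD_zero_apply, slice, Fin.cons_zero, op_smul_eq_mul, op_mul, mul_smul, smul_sub]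
  simp

theorem barD_barD_succ {n : ℕ} (hA : ∀ φ : A → (Fin n → A) → M,
      barD k A A M (n + 1) (barD k A A M n φ) = 0)
    (φ : N → (Fin (n + 1) → A) → M) :
    barD k A N M (n + 2) (barD k A N M (n + 1) φ) = 0 := by
  funext x a
  rw [← Fin.cons_self_tail a, barD_cons, slice_barD, map_sub, hA, sub_zero,
    barD_comp φ (orbit (k := k) x) (fun b y => by
      change op (y * b) • x = op b • op y • x
      rw [op_mul, mul_smul])]
  exact sub_self _

theorem barD_barD_self {n : ℕ} (φ : A → (Fin n → A) → M) :
    barD k A A M (n + 1) (barD k A A M n φ) = 0 := by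
  induction n with
  | zero => exact barD_barD_zero φ
  | succ n ih => exact barD_barD_succ ih φ

theorem barD_barD {n : ℕ} (φ : N → (Fin n → A) → M) :
    barD k A N M (n + 1) (barD k A N M n φ) = 0 := by
  cases n with
  | zero => exact barD_barD_zero φ
  | succ n => exact barD_barD_succ barD_barD_self φ

end Bar

end GradedRight

namespace GradedRight

/-! ### Cochains on `A / A_{≥ r}` as cochains on `A`, and Koszul frames -/

section Trunc

theorem isML_zero {k A M : Type*} [Field k] [Ring A] [Algebra k A] [AddCommGroup M] [Module k M]
    {n : ℕ} : IsML k (0 : A → (Fin n → A) → M) := ⟨0, fun _ _ => rfl⟩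

variable {k A : Type*} [Field k] [Ring A] [Algebra k A] (𝒜 : ℕ → Submodule k A)

theorem mem_geq {r s : ℕ} (h : r ≤ s) {x : A} (hx : x ∈ 𝒜 s) : x ∈ geq 𝒜 r :=
  Submodule.subset_span ⟨s, h, hx⟩

theorem mul_mem_geq {r : ℕ} {x : A} (hx : x ∈ geq 𝒜 r) (a : A) : x * a ∈ geq 𝒜 r :=
  Submodule.smul_mem _ (op a) hx

variable [DirectSum.Decomposition 𝒜]

theorem zproj_natCast (n : ℕ) (a : A) : zproj 𝒜 n a = DirectSum.decompose 𝒜 a n := by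
  induction a using homogeneous_induction (𝒜 := 𝒜) with
  | h0 => simp
  | hadd x y hx hy => rw [map_add, DirectSum.decompose_add, hx, hy]; rfl
  | hh m a ha =>
    by_cases hm : m = n
    · subst hm
      rw [zproj_of_mem 𝒜 (p := m) ha, DirectSum.decompose_of_mem_same 𝒜 ha]
    · rw [zproj_of_mem_ne 𝒜 (q := m) ha (by omega), DirectSum.decompose_of_mem_ne 𝒜 ha hm]

theorem exists_eq_sum_zproj (a : A) : ∃ s : Finset ℕ, a = ∑ n ∈ s, zproj 𝒜 n a := by
  classical
  refine ⟨(DirectSum.decompose 𝒜 a).support, ?_⟩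
  conv_lhs => rw [← DirectSum.sum_support_decompose 𝒜 a]
  exact Finset.sum_congr rfl fun n _ => (zproj_natCast 𝒜 n a).symm

variable [SetLike.GradedMonoid 𝒜]

theorem zproj_eq_zero_of_mem_geq {r : ℕ} {x : A} (hx : x ∈ geq 𝒜 r) (n : ℕ) (hn : n < r) :
    zproj 𝒜 n x = 0 := by
  induction hx using Submodule.span_induction generalizing n with
  | mem x h =>
    obtain ⟨s, hs, hx⟩ := h
    exact zproj_of_mem_ne 𝒜 (q := s) hx (by omega)
  | zero => rw [map_zero]
  | add x y _ _ h1 h2 => rw [map_add, h1 n hn, h2 n hn, add_zero]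
  | smul a x _ h =>
    rw [← op_unop a, op_smul_eq_mul]
    generalize a.unop = b
    induction b using homogeneous_induction (𝒜 := 𝒜) with
    | h0 => rw [mul_zero, map_zero]
    | hadd a b ha hb => rw [mul_add, map_add, ha, hb, add_zero]
    | hh m b hb =>
      rw [zproj_mul 𝒜 hb (n - m) n (by omega)]
      rcases lt_or_ge n m with hnm | hnm
      · have := zproj_mem 𝒜 ((n : ℤ) - m) x
        rw [zgr_of_neg 𝒜 (by omega)] at this
        rw [(Submodule.mem_bot k).1 this, zero_mul]
      · have e : (n : ℤ) - m = ((n - m : ℕ) : ℤ) := by omega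
        rw [e, h _ (by omega), zero_mul]

theorem geq_zero_eq_top : geq 𝒜 0 = ⊤ := by
  rw [eq_top_iff]
  intro x _
  obtain ⟨s, hs⟩ := exists_eq_sum_zproj 𝒜 x
  rw [hs]
  exact Submodule.sum_mem _ fun n _ => mem_geq 𝒜 (Nat.zero_le n) (zproj_mem 𝒜 n x)

variable {M : Type*} [AddCommGroup M] [Module k M] [Module Aᵐᵒᵖ M] [IsScalarTower k Aᵐᵒᵖ M]
  (ℳ : ℤ → Submodule k M)

theorem IsML.eq_of_mem_geq {n : ℕ} {φ ψ : A → (Fin n → A) → M} (h : IsML k φ) (h' : IsML k ψ)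
    {r : ℕ} {a : Fin n → A} (h1 : ∀ s ≥ r, ∀ x ∈ 𝒜 s, φ x a = ψ x a) (x : A) (hx : x ∈ geq 𝒜 r) :
    φ x a = ψ x a := by
  obtain ⟨s, hs⟩ := exists_eq_sum_zproj 𝒜 x
  rw [hs, h.sum_left, h'.sum_left]
  refine Finset.sum_congr rfl fun n _ => ?_
  by_cases hn : n < r
  · rw [zproj_eq_zero_of_mem_geq 𝒜 hx n hn, h.zero_left, h'.zero_left]
  · exact h1 n (by omega) _ (zproj_mem 𝒜 n x)

theorem IsML.eq_zero_of_mem_geq {n : ℕ} {φ : A → (Fin n → A) → M} (h : IsML k φ)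
    {r : ℕ} {a : Fin n → A} (h1 : ∀ s ≥ r, ∀ x ∈ 𝒜 s, φ x a = 0) (x : A) (hx : x ∈ geq 𝒜 r) :
    φ x a = 0 :=
  h.eq_of_mem_geq 𝒜 (isML_zero) h1 x hx

/-- The cochains of `A` with values in `M` which vanish on `A_{≥ r}`, that is, the cochains
of `A / A_{≥ r}`. -/
def truncCochains (r n : ℕ) (ℓ : ℤ) : Submodule k (A → (Fin n → A) → M) where
  carrier := {φ | φ ∈ cochains 𝒜 (zgr 𝒜) ℳ n ℓ ∧ ∀ x ∈ geq 𝒜 r, ∀ a, φ x a = 0}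
  add_mem' h h' := ⟨Submodule.add_mem _ h.1 h'.1, fun x hx a => by
    rw [Pi.add_apply, Pi.add_apply, h.2 x hx, h'.2 x hx, add_zero]⟩
  zero_mem' := ⟨Submodule.zero_mem _, fun _ _ _ => rfl⟩
  smul_mem' c φ h := ⟨Submodule.smul_mem _ c h.1, fun x hx a => by
    rw [Pi.smul_apply, Pi.smul_apply, h.2 x hx, smul_zero]⟩

variable {𝒜 ℳ}

theorem barD_mem_trunc (hℳ : GradedAction 𝒜 ℳ) {r n : ℕ} {ℓ : ℤ} {φ : A → (Fin n → A) → M}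
    (h : φ ∈ truncCochains 𝒜 ℳ r n ℓ) : barD k A A M n φ ∈ truncCochains 𝒜 ℳ r (n + 1) ℓ := by
  refine ⟨barD_mem_self hℳ _ _ h.1, fun x hx a => ?_⟩
  simp only [barD, LinearMap.coe_mk, AddHom.coe_mk, h.2 x hx, h.2 _ (mul_mem_geq 𝒜 hx _),
    op_smul_eq_mul, smul_zero, Finset.sum_const_zero, add_zero]

theorem trunc_mono {r r' n : ℕ} (h : r ≤ r') (ℓ : ℤ) :
    truncCochains 𝒜 ℳ r n ℓ ≤ truncCochains 𝒜 ℳ r' n ℓ :=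
  fun _ hφ => ⟨hφ.1, fun x hx => hφ.2 x (geq_anti 𝒜 h hx)⟩

theorem eq_zero_of_mem_trunc_zero {n : ℕ} {ℓ : ℤ} {φ : A → (Fin n → A) → M}
    (h : φ ∈ truncCochains 𝒜 ℳ 0 n ℓ) : φ = 0 := by
  funext x a
  exact h.2 x (by rw [geq_zero_eq_top]; trivial) a

end Trunc

/-- A Koszul frame of a graded algebra `A`: orthogonal idempotents `e_v`, generators `b_β` and
dual generators `b'_β` with `∑ b_β b'_β = 0`, together with a contraction of the right Koszul
complex `A → ⨁_β e_{t(β)} A → A`. -/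
structure KoszulFrame {k A : Type*} [Field k] [Ring A] [Algebra k A] (𝒜 : ℕ → Submodule k A)
    (V B : Type*) [Fintype V] [DecidableEq V] [Fintype B] [DecidableEq B] where
  e : V → A
  b : B → A
  b' : B → A
  src : B → V
  tgt : B → V
  aug : V → A →ₗ[k] k
  sec : A →ₗ[k] (B → A)
  ret : (B → A) →ₗ[k] A
  e_mem : ∀ v, e v ∈ 𝒜 0
  b_mem : ∀ β, b β ∈ 𝒜 1
  b'_mem : ∀ β, b' β ∈ 𝒜 1
  sum_e : ∑ v, e v = 1
  e_mul_e : ∀ v w, e v * e w = if v = w then e v else 0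
  e_mul : ∀ v, ∀ a ∈ 𝒜 0, e v * a = aug v a • e v
  mul_e : ∀ v, ∀ a ∈ 𝒜 0, a * e v = aug v a • e v
  e_mul_b : ∀ v β, e v * b β = if v = src β then b β else 0
  b_mul_e : ∀ β, b β * e (tgt β) = b β
  e_mul_b' : ∀ β, e (tgt β) * b' β = b' β
  b'_mul_e : ∀ v β, b' β * e v = if src β = v then b' β else 0
  sum_b_mul_b' : ∑ β, b β * b' β = 0
  sec_zero : ∀ a ∈ 𝒜 0, sec a = 0
  sec_mem : ∀ n, ∀ a ∈ 𝒜 (n + 1), ∀ β, sec a β ∈ 𝒜 n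
  ret_mem : ∀ (n : ℕ) (y : B → A), (∀ β, y β ∈ 𝒜 n) → ret y ∈ zgr 𝒜 ((n : ℤ) - 1)
  sum_b_sec : ∀ n, ∀ a ∈ 𝒜 (n + 1), ∑ β, b β * sec a β = a
  split : ∀ y β, e (tgt β) * y β = sec (∑ γ, b γ * y γ) β + b' β * ret y
  ret_b' : ∀ x, ret (fun β => b' β * x) = x
  ret_e : ∀ y, ret (fun β => e (tgt β) * y β) = ret y
  sec_b : ∀ β, sec (b β) = Pi.single β (e (tgt β))

/-- A graded right module `M` for which the Koszul complex `M → ⨁_β M e_{t(β)} → M` of a frame is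
exact, except at the end, where the cokernel is concentrated in degree zero. -/
structure KoszulFrame.IsRegular {k A : Type*} [Field k] [Ring A] [Algebra k A]
    {𝒜 : ℕ → Submodule k A} {V B : Type*} [Fintype V] [DecidableEq V] [Fintype B] [DecidableEq B]
    (F : KoszulFrame 𝒜 V B) {M : Type*} [AddCommGroup M] [Module k M] [Module Aᵐᵒᵖ M]
    (ℳ : ℤ → Submodule k M) : Prop where
  action : GradedAction 𝒜 ℳ
  neg : ∀ p < 0, ℳ p = ⊥
  socle : ∀ m : M, (∀ β, op (F.b β) • m = 0) → m = 0
  exact : ∀ (p : ℤ) (y : B → M), (∀ β, y β ∈ ℳ (p + 1)) →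
    (∀ β, op (F.e (F.tgt β)) • y β = y β) → ∑ β, op (F.b' β) • y β = 0 →
    ∃ m ∈ ℳ p, ∀ β, y β = op (F.b β) • m
  generated : ∀ p : ℤ, p + 1 ≠ 0 → ∀ m ∈ ℳ (p + 1),
    ∃ y : B → M, (∀ β, y β ∈ ℳ p) ∧ ∑ β, op (F.b' β) • y β = m

/-! ### Cohomology of `A / A_{≥ 1}` from a Koszul frame -/

namespace KoszulFrame

variable {k A : Type*} [Field k] [Ring A] [Algebra k A] {𝒜 : ℕ → Submodule k A}
  [DirectSum.Decomposition 𝒜] [SetLike.GradedMonoid 𝒜]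
  {V B : Type*} [Fintype V] [DecidableEq V] [Fintype B] [DecidableEq B] (F : KoszulFrame 𝒜 V B)
  {M : Type*} [AddCommGroup M] [Module k M] [Module Aᵐᵒᵖ M] [IsScalarTower k Aᵐᵒᵖ M]
  {ℳ : ℤ → Submodule k M}

variable (𝒜 B) in
/-- The grading of `⨁_β A`. -/
def piGr (p : ℤ) : Submodule k (B → A) := Submodule.pi Set.univ fun _ => zgr 𝒜 p

theorem mem_piGr {p : ℤ} {y : B → A} : y ∈ piGr 𝒜 B p ↔ ∀ β, y β ∈ zgr 𝒜 p := by
  simp [piGr, Submodule.mem_pi]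

theorem gradedAction_piGr : GradedAction 𝒜 (piGr 𝒜 B) := by
  intro n p a ha x hx
  rw [mem_piGr] at hx ⊢
  exact fun β => zgr_mul 𝒜 ha (hx β) rfl

theorem sec_mem_piGr (p : ℤ) (x : A) (hx : x ∈ zgr 𝒜 p) : F.sec x ∈ piGr 𝒜 B (p + (-1)) := by
  rw [mem_piGr]
  intro β
  match p, hx with
  | Int.ofNat 0, hx => rw [F.sec_zero x hx]; exact Submodule.zero_mem _
  | Int.ofNat (n + 1), hx =>
    have e : Int.ofNat (n + 1) + (-1) = (n : ℤ) := by
      simp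
    rw [e]
    exact F.sec_mem n x hx β
  | Int.negSucc n, hx =>
    have : x = 0 := hx
    rw [this, map_zero]
    exact Submodule.zero_mem _

theorem ret_mem_zgr (p : ℤ) (y : B → A) (hy : y ∈ piGr 𝒜 B p) : F.ret y ∈ zgr 𝒜 (p + (-1)) := by
  rw [mem_piGr] at hy
  cases p with
  | ofNat n => exact F.ret_mem n y hy
  | negSucc n =>
    have : y = 0 := funext hy
    rw [this, map_zero]
    exact Submodule.zero_mem _

theorem sum_b_sec_of_mem_geq {u : A} (hu : u ∈ geq 𝒜 1) : ∑ β, F.b β * F.sec u β = u := by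
  obtain ⟨s, hs⟩ := exists_eq_sum_zproj 𝒜 u
  have h : ∀ n : ℕ, ∑ β, F.b β * F.sec (zproj 𝒜 n u) β = zproj 𝒜 n u := by
    intro n
    cases n with
    | zero => rw [zproj_eq_zero_of_mem_geq 𝒜 hu 0 one_pos]; simp
    | succ n => exact F.sum_b_sec n _ (zproj_mem 𝒜 ((n + 1 : ℕ) : ℤ) u)
  conv_rhs => rw [hs, ← Finset.sum_congr rfl fun n _ => h n, Finset.sum_comm]
  refine Finset.sum_congr rfl fun β _ => ?_
  rw [← Finset.mul_sum]
  conv_lhs => rw [hs, map_sum, Finset.sum_apply]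

/-- The linear map `y ↦ ∑ b_β y_β`. -/
def proj : (B → A) →ₗ[k] A := ∑ β, LinearMap.mulLeft k (F.b β) ∘ₗ LinearMap.proj β

theorem proj_apply (y : B → A) : F.proj y = ∑ β, F.b β * y β := by
  simp [proj]

/-- The linear map `x ↦ (b'_β x)_β`. -/
def inc : A →ₗ[k] (B → A) := LinearMap.pi fun β => LinearMap.mulLeft k (F.b' β)

theorem inc_apply (x : A) (β : B) : F.inc x β = F.b' β * x := rfl

/-- The linear map `y ↦ (e_{t(β)} y_β)_β`. -/
def cut : (B → A) →ₗ[k] (B → A) :=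
  LinearMap.pi fun β => LinearMap.mulLeft k (F.e (F.tgt β)) ∘ₗ LinearMap.proj β

theorem cut_apply (y : B → A) (β : B) : F.cut y β = F.e (F.tgt β) * y β := rfl

theorem cut_eq (y : B → A) : F.cut y = F.sec (F.proj y) + F.inc (F.ret y) := by
  funext β
  rw [proj_apply]
  exact F.split y β

theorem proj_inc (x : A) : F.proj (F.inc x) = 0 := by
  simp only [proj_apply, inc_apply, ← mul_assoc, ← Finset.sum_mul, F.sum_b_mul_b', zero_mul]

theorem ret_inc (x : A) : F.ret (F.inc x) = x := F.ret_b' x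

theorem ret_cut (y : B → A) : F.ret (F.cut y) = F.ret y := F.ret_e y

theorem inc_smul (a x : A) : F.inc (op a • x) = op a • F.inc x := by
  funext β
  exact (mul_assoc _ _ _).symm

theorem cut_smul (a : A) (y : B → A) : F.cut (op a • y) = op a • F.cut y := by
  funext β
  exact (mul_assoc _ _ _).symm

theorem proj_smul (a : A) (y : B → A) : F.proj (op a • y) = op a • F.proj y := by
  simp only [proj_apply, Pi.smul_apply, op_smul_eq_mul, Finset.sum_mul, mul_assoc]

theorem b_mem_geq (β : B) : F.b β ∈ geq 𝒜 1 := mem_geq 𝒜 le_rfl (F.b_mem β)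

/-- A cochain on `⨁_β A` which vanishes on the kernel of `y ↦ ∑ b_β y_β` and has the given
coboundary provides a primitive of a cocycle on `A_{≥ 1}`. -/
theorem exists_primitive_of_descends (hℳ : GradedAction 𝒜 ℳ) {n : ℕ} {ℓ : ℤ}
    {z : A → (Fin (n + 2) → A) → M} {η : A → (Fin (n + 1) → A) → M}
    (hη : η ∈ cochains 𝒜 (zgr 𝒜) ℳ (n + 1) ℓ) (hd : barD k A A M (n + 1) η = z)
    {ξ : (B → A) → (Fin n → A) → M} (hξ : ξ ∈ cochains 𝒜 (piGr 𝒜 B) ℳ n (ℓ + 1))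
    (hcut : ∀ y a, ξ (F.cut y) a = ξ y a) (hinc : ∀ x a, ξ (F.inc x) a = 0)
    (hdξ : ∀ y a, barD k A (B → A) M n ξ y a = η (F.proj y) a) :
    ∃ η' ∈ truncCochains 𝒜 ℳ 1 (n + 1) ℓ, barD k A A M (n + 1) η' = z := by
  set ζ : A → (Fin n → A) → M := fun u a => ξ (F.sec u) a with hζ
  have hζm : ζ ∈ cochains 𝒜 (zgr 𝒜) ℳ n ℓ := comp_mem hξ F.sec F.sec_mem_piGr (by ring)
  -- By `cut_eq` and the vanishing on the image of `inc`, `ξ` factors through `proj`. The factor `ζ`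
  -- has coboundary `η` on `A_{≥ 1}`, so `η - dζ` vanishes there and has the same coboundary as `η`.
  have h1 : ξ = fun y a => ζ (F.proj y) a := by
    funext y a
    rw [← hcut, cut_eq, (isML_of_mem hξ).add_left, hinc, add_zero]
  have h2 : ∀ y a, barD k A A M n ζ (F.proj y) a = η (F.proj y) a := by
    intro y a
    rw [← hdξ, h1]
    exact (barD_comp ζ F.proj F.proj_smul y a).symm
  refine ⟨η - barD k A A M n ζ, ⟨Submodule.sub_mem _ hη (barD_mem_self hℳ _ _ hζm),
    fun x hx a => ?_⟩, ?_⟩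
  · have hx' : x = F.proj (F.sec x) := by rw [proj_apply, F.sum_b_sec_of_mem_geq hx]
    rw [Pi.sub_apply, Pi.sub_apply, hx', h2, sub_self]
  · rw [map_sub, barD_barD, sub_zero, hd]

/-- The cochain `x ↦ m x`. -/
theorem orbit_cochain_mem (hℳ : GradedAction 𝒜 ℳ) {ℓ : ℤ} {m : M} (hm : m ∈ ℳ ℓ) :
    (fun (x : A) (_ : Fin 0 → A) => op x • m) ∈ cochains 𝒜 (zgr 𝒜) ℳ 0 ℓ := by
  refine ⟨isML_iff.2 ⟨fun x => ⟨MultilinearMap.constOfIsEmpty k _ (op x • m), fun a => rfl⟩,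
    fun x y a => by rw [op_add, add_smul], fun c x a => by rw [op_smul, smul_assoc]⟩,
    fun p d x a hx _ => ?_⟩
  have := orbit_mem hℳ hm p x hx
  rw [Finset.univ_eq_empty, Finset.sum_empty, add_zero]
  exact this

/-- A cocycle of `A` vanishing on `A_{≥ 1}` has a primitive on `A`. -/
theorem barD_slice_one {n : ℕ} {z : A → (Fin (n + 1) → A) → M}
    (hz : barD k A A M (n + 1) z = 0) : barD k A A M n (slice z 1) = z := by
  funext a c
  have h := congrFun (congrFun hz 1) (Fin.cons a c)
  rw [barD_cons, op_smul_eq_mul, one_mul] at h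
  exact (sub_eq_zero.1 h).symm

theorem one_mem_zgr : (1 : A) ∈ zgr 𝒜 0 := SetLike.GradedOne.one_mem (A := 𝒜)

theorem slice_one_mem {n : ℕ} {ℓ : ℤ} {z : A → (Fin (n + 1) → A) → M}
    (h : z ∈ cochains 𝒜 (zgr 𝒜) ℳ (n + 1) ℓ) : slice z 1 ∈ cochains 𝒜 (zgr 𝒜) ℳ n ℓ :=
  slice_mem h one_mem_zgr (by ring)

/-- The cohomology of `A / A_{≥ 1}` with coefficients in a regular module vanishes in degree `0`. -/
theorem IsRegular.cocycle_zero (hM : F.IsRegular ℳ) {ℓ : ℤ} {z : A → (Fin 0 → A) → M}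
    (hz : z ∈ truncCochains 𝒜 ℳ 1 0 ℓ) (hd : barD k A A M 0 z = 0) : z = 0 := by
  have h1 : ∀ x, z x Fin.elim0 = op x • z 1 Fin.elim0 := by
    intro x
    have := congrFun (congrFun hd 1) (fun _ => x)
    rw [barD_zero_apply, op_smul_eq_mul, one_mul] at this
    exact sub_eq_zero.1 this
  have h2 : z 1 Fin.elim0 = 0 := hM.socle _ fun β => by
    rw [← h1, hz.2 _ (F.b_mem_geq β)]
  funext x a
  rw [Subsingleton.elim a Fin.elim0, h1, h2, smul_zero]
  rfl

/-- The cohomology of `A / A_{≥ 1}` with coefficients in a regular module vanishes in degree `1`. -/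
theorem IsRegular.primitive_one (hM : F.IsRegular ℳ) {ℓ : ℤ} {z : A → (Fin 1 → A) → M}
    (hz : z ∈ truncCochains 𝒜 ℳ 1 1 ℓ) (hd : barD k A A M 1 z = 0) :
    ∃ η ∈ truncCochains 𝒜 ℳ 1 0 ℓ, barD k A A M 0 η = z := by
  set η := slice z 1 with hηdef
  have hη : η ∈ cochains 𝒜 (zgr 𝒜) ℳ 0 ℓ := slice_one_mem hz.1
  have hdη : barD k A A M 0 η = z := barD_slice_one hd
  have hhom : ∀ u ∈ geq 𝒜 1, ∀ x, η (u * x) Fin.elim0 = op x • η u Fin.elim0 := by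
    intro u hu x
    have h := hz.2 u hu (fun _ => x)
    rw [← hdη, barD_zero_apply, op_smul_eq_mul] at h
    exact sub_eq_zero.1 h
  -- On `A_{≥ 1}` the primitive `η` is a module map, so its values on the generators form a syzygy
  -- in `M`. Exactness gives `η(b_β) = m b_β`; subtracting `x ↦ m x` makes `η` vanish on `A_{≥ 1}`.
  obtain ⟨m, hm, hmb⟩ := hM.exact ℓ (fun β => η (F.b β) Fin.elim0)
    (fun β => by
      have := hη.2 1 Fin.elim0 (F.b β) Fin.elim0 (F.b_mem β) (fun i => i.elim0)
      simpa [add_comm] using this)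
    (fun β => by rw [← hhom _ (F.b_mem_geq β), F.b_mul_e])
    (by
      simp_rw [← hhom _ (F.b_mem_geq _)]
      rw [← (isML_of_mem hη).sum_left, F.sum_b_mul_b', (isML_of_mem hη).zero_left])
  refine ⟨η - fun x _ => op x • m, ⟨Submodule.sub_mem _ hη (orbit_cochain_mem hM.action hm),
    fun x hx a => ?_⟩, ?_⟩
  · rw [Subsingleton.elim a Fin.elim0, Pi.sub_apply, Pi.sub_apply, sub_eq_zero]
    conv_lhs => rw [← F.sum_b_sec_of_mem_geq hx, (isML_of_mem hη).sum_left]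
    conv_rhs => rw [← F.sum_b_sec_of_mem_geq hx, Finset.op_sum, Finset.sum_smul]
    refine Finset.sum_congr rfl fun β _ => ?_
    rw [hhom _ (F.b_mem_geq β), hmb, op_mul, mul_smul]
  · rw [map_sub, hdη]
    have : barD k A A M 0 (fun x _ => op x • m) = 0 := by
      funext x a
      rw [barD_zero_apply, op_smul_eq_mul, op_mul, mul_smul, sub_self]
      rfl
    rw [this, sub_zero]

/-- The cochain `(y_β) ↦ ∑_β η(b_β, e_{t(β)} y_β, …)` on `⨁_β A`. -/
def spread {n : ℕ} (η : A → (Fin (n + 1) → A) → M) : (B → A) → (Fin n → A) → M :=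
  fun y a => ∑ β, slice η (F.b β) (F.cut y β) a

theorem spread_mem {n : ℕ} {ℓ : ℤ} {η : A → (Fin (n + 1) → A) → M}
    (hη : η ∈ cochains 𝒜 (zgr 𝒜) ℳ (n + 1) ℓ) :
    F.spread η ∈ cochains 𝒜 (piGr 𝒜 B) ℳ n (ℓ + 1) := by
  have : F.spread η = ∑ β, fun y a =>
      slice η (F.b β) ((LinearMap.proj β ∘ₗ F.cut : (B → A) →ₗ[k] A) y) a := by
    funext y a
    simp [spread, Finset.sum_apply]
  rw [this]
  refine Submodule.sum_mem _ fun β _ => ?_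
  refine comp_mem (j := 0) (slice_mem hη (p := 1) (F.b_mem β) rfl) _ (fun p y hy => ?_) (by ring)
  rw [mem_piGr] at hy
  exact mul_zgr' 𝒜 (F.e_mem _) (hy β) (by simp)

theorem spread_cut {n : ℕ} (η : A → (Fin (n + 1) → A) → M) (y : B → A) (a : Fin n → A) :
    F.spread η (F.cut y) a = F.spread η y a := by
  simp only [spread, cut_apply, ← mul_assoc, F.e_mul_e, if_true]

/-- Evaluated at `(b_β, e_{t(β)} y_β, …)`, the cocycle condition for `η` on `A_{≥ 1}` equates the
differential of the slice at `b_β` with `η(b_β y_β, …)`. -/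
theorem barD_spread {n : ℕ} {ℓ : ℤ} {η : A → (Fin (n + 1) → A) → M}
    (hη : η ∈ cochains 𝒜 (zgr 𝒜) ℳ (n + 1) ℓ)
    (hd : ∀ u ∈ geq 𝒜 1, ∀ a, barD k A A M (n + 1) η u a = 0) (y : B → A) (a : Fin (n + 1) → A) :
    barD k A (B → A) M n (F.spread η) y a = η (F.proj y) a := by
  have : F.spread η = ∑ β, fun y a => slice η (F.b β) (F.cut y β) a := by
    funext y a
    simp [spread, Finset.sum_apply]
  rw [this, map_sum, Finset.sum_apply, Finset.sum_apply, proj_apply, (isML_of_mem hη).sum_left]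
  refine Finset.sum_congr rfl fun β _ => ?_
  rw [barD_comp (slice η (F.b β)) (fun y => F.cut y β) (fun b y => by rw [F.cut_smul]; rfl)]
  have h := hd _ (F.b_mem_geq β) (Fin.cons (F.cut y β) a)
  rw [barD_cons, op_smul_eq_mul, cut_apply, ← mul_assoc, F.b_mul_e] at h
  exact (sub_eq_zero.1 h).symm

/-- A `2`-cocycle of `A / A_{≥ 1}` is a coboundary when its residue `∑ z(1, b_β, b'_β)` is in
`M A_{≥ 1}`. -/
theorem primitive_two (hℳ : GradedAction 𝒜 ℳ) {ℓ : ℤ} {z : A → (Fin 2 → A) → M}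
    (hz : z ∈ truncCochains 𝒜 ℳ 1 2 ℓ) (hd : barD k A A M 2 z = 0) (w : B → M)
    (hw : ∀ β, w β ∈ ℳ (ℓ + 1)) (hzw : ∑ β, op (F.b' β) • w β = ∑ β, z 1 ![F.b β, F.b' β]) :
    ∃ η ∈ truncCochains 𝒜 ℳ 1 1 ℓ, barD k A A M 1 η = z := by
  set η := slice z 1 with hηdef
  have hη : η ∈ cochains 𝒜 (zgr 𝒜) ℳ 1 ℓ := slice_one_mem hz.1
  have hdη : barD k A A M 1 η = z := barD_slice_one hd
  have hdη' : ∀ u ∈ geq 𝒜 1, ∀ a, barD k A A M 1 η u a = 0 := fun u hu a => by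
    rw [hdη, hz.2 u hu]
  have hsp := F.spread_mem hη
  -- A module map on `⨁_β A`, hence closed. It agrees with the spread of `η` at `inc 1` by the
  -- assumption on `w`, and so on the whole image of `inc`, where both are right linear.
  set ρ : (B → A) → (Fin 0 → A) → M := fun y _ => ∑ β, op (F.cut y β) • w β with hρ
  have hρm : ρ ∈ cochains 𝒜 (piGr 𝒜 B) ℳ 0 (ℓ + 1) := by
    have : ρ = ∑ β, fun y (a : Fin 0 → A) => (fun (x : A) (_ : Fin 0 → A) => op x • w β)
        ((LinearMap.proj β ∘ₗ F.cut : (B → A) →ₗ[k] A) y) a := by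
      funext y a
      simp [hρ, Finset.sum_apply]
    rw [this]
    refine Submodule.sum_mem _ fun β _ => ?_
    refine comp_mem (j := 0) (orbit_cochain_mem hℳ (hw β)) _ (fun p y hy => ?_) (by ring)
    rw [mem_piGr] at hy
    exact mul_zgr' 𝒜 (F.e_mem _) (hy β) (by simp)
  have hρd : barD k A (B → A) M 0 ρ = 0 := by
    funext y a
    rw [barD_zero_apply]
    simp only [hρ, F.cut_smul, Finset.smul_sum, Pi.smul_apply, op_smul_eq_mul, op_mul, mul_smul,
      sub_self]
    rfl
  have hs : ∀ x, F.spread η (F.inc x) Fin.elim0 = op x • F.spread η (F.inc 1) Fin.elim0 := by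
    intro x
    have h := F.barD_spread hη hdη' (F.inc 1) (fun _ => x)
    rw [proj_inc, (isML_of_mem hη).zero_left, barD_zero_apply, ← inc_smul, op_smul_eq_mul, one_mul] at h
    exact sub_eq_zero.1 h
  have hs1 : F.spread η (F.inc 1) Fin.elim0 = ∑ β, op (F.b' β) • w β := by
    rw [hzw]
    refine Finset.sum_congr rfl fun β _ => ?_
    rw [cut_apply, inc_apply, mul_one, F.e_mul_b']
    simp only [hηdef, slice]
    congr 1
  refine F.exists_primitive_of_descends hℳ hη hdη (ξ := F.spread η - ρ)
    (Submodule.sub_mem _ hsp hρm) (fun y a => ?_) (fun x a => ?_) (fun y a => ?_)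
  · simp only [Pi.sub_apply, spread_cut, hρ, cut_apply, ← mul_assoc, F.e_mul_e, if_true]
  · rw [Subsingleton.elim a Fin.elim0, Pi.sub_apply, Pi.sub_apply, hs, hs1, sub_eq_zero,
      Finset.smul_sum]
    refine Finset.sum_congr rfl fun β _ => ?_
    rw [cut_apply, inc_apply, ← mul_assoc, F.e_mul_b', op_mul, mul_smul]
  · rw [map_sub, hρd, sub_zero, F.barD_spread hη hdη']

/-- The cohomology of `A / A_{≥ 1}` vanishes in degrees at least `3`. -/
theorem primitive_add_three (F : KoszulFrame 𝒜 V B) (hℳ : GradedAction 𝒜 ℳ) {n : ℕ} {ℓ : ℤ}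
    {z : A → (Fin (n + 3) → A) → M}
    (hz : z ∈ truncCochains 𝒜 ℳ 1 (n + 3) ℓ) (hd : barD k A A M (n + 3) z = 0) :
    ∃ η ∈ truncCochains 𝒜 ℳ 1 (n + 2) ℓ, barD k A A M (n + 2) η = z := by
  set η := slice z 1 with hηdef
  have hη : η ∈ cochains 𝒜 (zgr 𝒜) ℳ (n + 2) ℓ := slice_one_mem hz.1
  have hdη : barD k A A M (n + 2) η = z := barD_slice_one hd
  have hdη' : ∀ u ∈ geq 𝒜 1, ∀ a, barD k A A M (n + 2) η u a = 0 := fun u hu a => by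
    rw [hdη, hz.2 u hu]
  have hsp := F.spread_mem hη
  -- `ω` is a primitive of the spread of `η` along `inc`. Extended to `⨁_β A` through `ret`, a left
  -- inverse of `inc`, its coboundary corrects the spread so that it vanishes on the image of `inc`.
  -- In degree two there is no variable left to define such an `ω`, which is where the residue
  -- obstructs.
  set ω : A → (Fin n → A) → M := slice (F.spread η) (F.inc 1) with hω
  have hωm : ω ∈ cochains 𝒜 (zgr 𝒜) ℳ n (ℓ + 2) :=
    slice_mem hsp (p := 1) (by
      rw [mem_piGr]
      intro β
      rw [inc_apply, mul_one]
      exact F.b'_mem β) (by ring)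
  have hdω : ∀ x a, barD k A A M n ω x a = F.spread η (F.inc x) a := by
    intro x a
    have h := F.barD_spread hη hdη' (F.inc 1) (Fin.cons x a)
    rw [proj_inc, (isML_of_mem hη).zero_left, barD_cons, ← inc_smul, op_smul_eq_mul, one_mul] at h
    exact (sub_eq_zero.1 h).symm
  have hωr : (fun y a => ω (F.ret y) a) ∈ cochains 𝒜 (piGr 𝒜 B) ℳ n (ℓ + 1) :=
    comp_mem hωm F.ret F.ret_mem_zgr (by ring)
  refine F.exists_primitive_of_descends hℳ hη hdη
    (ξ := F.spread η - barD k A (B → A) M n fun y a => ω (F.ret y) a)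
    (Submodule.sub_mem _ hsp (barD_mem gradedAction_piGr hℳ hωr)) (fun y a => ?_) (fun x a => ?_)
    (fun y a => ?_)
  · rw [Pi.sub_apply, Pi.sub_apply, Pi.sub_apply, Pi.sub_apply, spread_cut,
      ← barD_comp _ F.cut F.cut_smul]
    simp only [ret_cut]
  · rw [Pi.sub_apply, Pi.sub_apply, ← hdω, ← barD_comp _ F.inc F.inc_smul]
    simp only [ret_inc, sub_self]
  · rw [map_sub, barD_barD, sub_zero, F.barD_spread hη hdη']

end KoszulFrame

end GradedRight

/-- Preimages that exist vector by vector can be chosen linearly over a field. This is used to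
choose primitives of the translates of a cochain by all `x ∈ A_r` at once. -/
theorem LinearMap.exists_lift_of_forall_mem_map {k X Y Z : Type*} [Field k] [AddCommGroup X]
    [Module k X] [AddCommGroup Y] [Module k Y] [AddCommGroup Z] [Module k Z] (D : Y →ₗ[k] Z)
    (f : X →ₗ[k] Z) (S : Submodule k X) (U : Submodule k Y) (h : ∀ x ∈ S, f x ∈ U.map D) :
    ∃ H : X →ₗ[k] Y, ∀ x ∈ S, H x ∈ U ∧ D (H x) = f x := by
  obtain ⟨s, hs⟩ := (D.submoduleMap U).exists_rightInverse_of_surjective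
    (LinearMap.range_eq_top.2 (D.submoduleMap_surjective U))
  obtain ⟨H, hH⟩ := LinearMap.exists_extend
    (U.subtype ∘ₗ s ∘ₗ LinearMap.codRestrict (U.map D) (f ∘ₗ S.subtype) fun x => h x x.2)
  refine ⟨H, fun x hx => ?_⟩
  have h1 : H x = s ⟨f x, h x hx⟩ := LinearMap.congr_fun hH ⟨x, hx⟩
  rw [h1]
  refine ⟨(s _).2, ?_⟩
  have h2 := congrArg Subtype.val (LinearMap.congr_fun hs ⟨f x, h x hx⟩)
  simpa using h2

namespace GradedRight

/-! ### Translates of cochains -/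

section Translate

variable {k A : Type*} [Field k] [Ring A] [Algebra k A] {𝒜 : ℕ → Submodule k A}
  [DirectSum.Decomposition 𝒜] [SetLike.GradedMonoid 𝒜]
  {M : Type*} [AddCommGroup M] [Module k M] [Module Aᵐᵒᵖ M] [IsScalarTower k Aᵐᵒᵖ M]
  {ℳ : ℤ → Submodule k M}

theorem mul_mem_geq_add {j r : ℕ} {x : A} (hx : x ∈ 𝒜 j) {y : A} (hy : y ∈ geq 𝒜 r) :
    x * y ∈ geq 𝒜 (j + r) := by
  induction hy using Submodule.span_induction with
  | mem y h =>
    obtain ⟨s, hs, hy⟩ := h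
    exact mem_geq 𝒜 (by omega : j + r ≤ j + s) (SetLike.mul_mem_graded hx hy)
  | zero => rw [mul_zero]; exact Submodule.zero_mem _
  | add y z _ _ h1 h2 => rw [mul_add]; exact Submodule.add_mem _ h1 h2
  | smul b y _ h => rw [mul_smul_comm]; exact Submodule.smul_mem _ b h

/-- The translate `(y, a) ↦ z(x y, a)` of a cochain. -/
def translate {n : ℕ} (z : A → (Fin n → A) → M) (x : A) : A → (Fin n → A) → M :=
  fun y a => z (x * y) a

/-- Translation of a multilinear cochain, as a linear map. -/
def IsML.translate {n : ℕ} {z : A → (Fin n → A) → M} (h : IsML k z) :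
    A →ₗ[k] (A → (Fin n → A) → M) where
  toFun := GradedRight.translate z
  map_add' x y := by
    funext u a
    simp only [GradedRight.translate, add_mul, h.add_left, Pi.add_apply]
  map_smul' c x := by
    funext u a
    simp only [GradedRight.translate, smul_mul_assoc, h.smul_left, Pi.smul_apply, RingHom.id_apply]

theorem barD_translate {n : ℕ} (z : A → (Fin n → A) → M) (x : A) :
    barD k A A M n (translate z x) = translate (barD k A A M n z) x := by
  funext y a
  exact barD_comp z (fun y => x * y) (fun b y => by simp [mul_assoc]) y a

theorem translate_mem {n r s : ℕ} {ℓ : ℤ} {z : A → (Fin n → A) → M}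
    (hz : z ∈ truncCochains 𝒜 ℳ (r + s) n ℓ) {x : A} (hx : x ∈ 𝒜 r) :
    translate z x ∈ truncCochains 𝒜 ℳ s n (ℓ + r) :=
  ⟨comp_mem hz.1 (LinearMap.mulLeft k x) (fun _ _ hy => mul_zgr 𝒜 hx hy) rfl,
    fun _ hy a => hz.2 _ (mul_mem_geq_add hx hy) a⟩

theorem mem_trunc_of_succ {n r : ℕ} {ℓ : ℤ} {z : A → (Fin n → A) → M}
    (hz : z ∈ truncCochains 𝒜 ℳ (r + 1) n ℓ) (h : ∀ x ∈ 𝒜 r, ∀ a, z x a = 0) :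
    z ∈ truncCochains 𝒜 ℳ r n ℓ := by
  refine ⟨hz.1, fun x hx a => (isML_of_mem hz.1).eq_zero_of_mem_geq 𝒜 (fun s hs y hy => ?_) x hx⟩
  rcases hs.eq_or_lt with rfl | hs
  · exact h y hy a
  · exact hz.2 y (mem_geq 𝒜 hs hy) a

end Translate

/-! ### Induction on the truncation degree, and residues of 2-cocycles -/

namespace KoszulFrame

variable {k A : Type*} [Field k] [Ring A] [Algebra k A] {𝒜 : ℕ → Submodule k A}
  [DirectSum.Decomposition 𝒜] [SetLike.GradedMonoid 𝒜]
  {V B : Type*} [Fintype V] [DecidableEq V] [Fintype B] [DecidableEq B] (F : KoszulFrame 𝒜 V B)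
  {M : Type*} [AddCommGroup M] [Module k M] [Module Aᵐᵒᵖ M] [IsScalarTower k Aᵐᵒᵖ M]
  {ℳ : ℤ → Submodule k M}

/-- The cochain on `A / A_{≥ r + 1}` supported in degree `r` whose translates by `x ∈ A_r` extend
the cochains `H(x)`. -/
def assemble (r : ℕ) {n : ℕ} (H : A →ₗ[k] (A → (Fin n → A) → M)) : A → (Fin n → A) → M :=
  fun x a => ∑ v, H (zproj 𝒜 r x * F.e v) (F.e v) a

theorem mul_e_mem {r : ℕ} {x : A} (hx : x ∈ 𝒜 r) (v : V) : x * F.e v ∈ 𝒜 r :=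
  SetLike.mul_mem_graded hx (F.e_mem v)

theorem assemble_mem {r n : ℕ} {ℓ : ℤ} (H : A →ₗ[k] (A → (Fin n → A) → M))
    (hH : ∀ x ∈ 𝒜 r, H x ∈ cochains 𝒜 (zgr 𝒜) ℳ n (ℓ + r)) :
    F.assemble r H ∈ truncCochains 𝒜 ℳ (r + 1) n ℓ := by
  refine ⟨⟨isML_iff.2 ⟨fun x => ?_, fun x y a => ?_, fun c x a => ?_⟩, fun p d x a hx ha => ?_⟩,
    fun x hx a => ?_⟩
  · choose Φ hΦ using fun v => hH _ (F.mul_e_mem (zproj_mem 𝒜 (r : ℤ) x) v) |>.1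
    exact ⟨∑ v, Φ v (F.e v), fun a => by simp [assemble, hΦ]⟩
  · simp only [assemble, map_add, add_mul, Pi.add_apply, Finset.sum_add_distrib]
  · simp only [assemble, map_smul, smul_mul_assoc, Pi.smul_apply, Finset.smul_sum]
  · refine Submodule.sum_mem _ fun v _ => ?_
    by_cases hp : p = r
    · subst hp
      rw [zproj_of_mem 𝒜 hx]
      have := (hH _ (F.mul_e_mem hx v)).2 0 d (F.e v) a (F.e_mem v) ha
      have e : (r : ℤ) + ∑ i, (d i : ℤ) + ℓ = 0 + ∑ i, (d i : ℤ) + (ℓ + r) := by ring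
      rw [e]
      exact this
    · rw [zproj_of_mem_ne 𝒜 hx hp, zero_mul, map_zero]
      exact Submodule.zero_mem _
  · simp only [assemble, zproj_eq_zero_of_mem_geq 𝒜 hx r (Nat.lt_succ_self r), zero_mul, map_zero]
    exact Finset.sum_const_zero

theorem assemble_apply {r n : ℕ} (H : A →ₗ[k] (A → (Fin n → A) → M)) {x : A} (hx : x ∈ 𝒜 r)
    (a : Fin n → A) : F.assemble r H x a = ∑ v, H (x * F.e v) (F.e v) a := by
  rw [assemble, zproj_of_mem 𝒜 (p := r) hx]

/-- `H` is only `k`-linear, so nothing relates `H (x c)` to `H x` for `c ∈ A_0`. After splitting `x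
= ∑ x e_v`, such a `c` acts by a scalar on each summand and passes through. For `c` of positive
degree both sides vanish, the right one because `H` takes values in cochains killing `A_{≥ 1}`. -/
theorem assemble_mul {r n : ℕ} {ℓ : ℤ} (H : A →ₗ[k] (A → (Fin n → A) → M))
    (hH : ∀ x ∈ 𝒜 r, H x ∈ truncCochains 𝒜 ℳ 1 n ℓ) {x : A} (hx : x ∈ 𝒜 r) (c : A)
    (a : Fin n → A) :
    F.assemble r H (x * c) a = ∑ v, H (x * F.e v) (F.e v * c) a := by
  have hml : ∀ v, IsML k (H (x * F.e v)) := fun v => (hH _ (F.mul_e_mem hx v)).1.1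
  induction c using homogeneous_induction (𝒜 := 𝒜) with
  | h0 => simp [assemble, (hml _).zero_left]
  | hadd c c' h h' =>
    simp only [assemble, mul_add, map_add, add_mul, Pi.add_apply, Finset.sum_add_distrib,
      (hml _).add_left] at h h' ⊢
    rw [h, h']
  | hh m c hc =>
    cases m with
    | zero =>
      have h0 : x * c ∈ 𝒜 r := by simpa using SetLike.mul_mem_graded hx hc
      rw [F.assemble_apply H h0]
      refine Finset.sum_congr rfl fun v _ => ?_
      rw [mul_assoc, F.mul_e v c hc, F.e_mul v c hc, mul_smul_comm, map_smul, (hml v).smul_left]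
      rfl
    | succ m =>
      have h1 : zproj 𝒜 (r : ℤ) (x * c) = 0 :=
        zproj_of_mem_ne 𝒜 (q := ((r + (m + 1) : ℕ) : ℤ)) (SetLike.mul_mem_graded hx hc) (by omega)
      simp only [assemble, h1, zero_mul, map_zero]
      rw [Finset.sum_eq_zero fun v _ => ?_, Finset.sum_eq_zero fun v _ => ?_]
      · exact (hH _ (F.mul_e_mem hx v)).2 _ (mem_geq 𝒜 (by omega : 1 ≤ 0 + (m + 1))
          (SetLike.mul_mem_graded (F.e_mem v) hc)) a
      · rfl

theorem barD_assemble {r n : ℕ} {ℓ : ℤ} (H : A →ₗ[k] (A → (Fin n → A) → M))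
    (hH : ∀ x ∈ 𝒜 r, H x ∈ truncCochains 𝒜 ℳ 1 n ℓ) {x : A} (hx : x ∈ 𝒜 r)
    (a : Fin (n + 1) → A) :
    barD k A A M n (F.assemble r H) x a
      = ∑ v, barD k A A M n (H (x * F.e v)) (F.e v) a := by
  simp only [barD, LinearMap.coe_mk, AddHom.coe_mk, op_smul_eq_mul, F.assemble_apply H hx,
    F.assemble_mul H hH hx, Finset.sum_add_distrib, Finset.smul_sum]
  congr 2
  exact Finset.sum_comm

/-- If the translates by `A_r` of a cochain on `A / A_{≥ r + 1}` are coboundaries, the cochain is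
cohomologous to a cochain on `A / A_{≥ r}`. -/
theorem exists_sub_barD_mem (F : KoszulFrame 𝒜 V B) {r n : ℕ} {ℓ : ℤ} {z : A → (Fin (n + 1) → A) → M}
    (hℳ : GradedAction 𝒜 ℳ) (hz : z ∈ truncCochains 𝒜 ℳ (r + 1) (n + 1) ℓ)
    (h : ∀ x ∈ 𝒜 r, ∃ η ∈ truncCochains 𝒜 ℳ 1 n (ℓ + r), barD k A A M n η = translate z x) :
    ∃ η ∈ truncCochains 𝒜 ℳ (r + 1) n ℓ,
      z - barD k A A M n η ∈ truncCochains 𝒜 ℳ r (n + 1) ℓ := by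
  obtain ⟨H, hH⟩ := LinearMap.exists_lift_of_forall_mem_map (barD k A A M n)
    (isML_of_mem hz.1).translate (𝒜 r) (truncCochains 𝒜 ℳ 1 n (ℓ + r)) h
  have hη := F.assemble_mem (ℳ := ℳ) H (fun x hx => (hH x hx).1.1)
  refine ⟨F.assemble r H, hη,
    mem_trunc_of_succ (Submodule.sub_mem _ hz (barD_mem_trunc hℳ hη)) fun x hx a => ?_⟩
  rw [Pi.sub_apply, Pi.sub_apply, F.barD_assemble H (fun x hx => (hH x hx).1) hx]
  simp only [fun v => (hH _ (F.mul_e_mem hx v)).2]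
  simp only [IsML.translate, LinearMap.coe_mk, AddHom.coe_mk, translate, mul_assoc, F.e_mul_e,
    if_true]
  rw [← (isML_of_mem hz.1).sum_left, ← Finset.mul_sum, F.sum_e, mul_one, sub_self]

variable {F}

theorem barD_translate_eq_zero {r n : ℕ} {z : A → (Fin n → A) → M}
    (hd : ∀ x ∈ geq 𝒜 r, ∀ a, barD k A A M n z x a = 0) {x : A} (hx : x ∈ 𝒜 r) :
    barD k A A M n (translate z x) = 0 := by
  rw [barD_translate]
  funext y a
  exact hd _ (mul_mem_geq (𝒜 := 𝒜) (mem_geq 𝒜 le_rfl hx) y) a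

/-- A `0`-cochain on `A / A_{≥ s}` which is a cocycle on `A_{≥ r}` vanishes on `A_{≥ r}`. -/
theorem IsRegular.mem_trunc_zero (hM : F.IsRegular ℳ) {r : ℕ} (s : ℕ) {ℓ : ℤ}
    {z : A → (Fin 0 → A) → M} (hz : z ∈ truncCochains 𝒜 ℳ (r + s) 0 ℓ)
    (hd : ∀ x ∈ geq 𝒜 r, ∀ a, barD k A A M 0 z x a = 0) : z ∈ truncCochains 𝒜 ℳ r 0 ℓ := by
  induction s with
  | zero => exact hz
  | succ s ih =>
    refine ih (mem_trunc_of_succ hz fun x hx a => ?_)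
    have hd' := barD_translate_eq_zero
      (fun y hy => hd y (geq_anti 𝒜 (Nat.le_add_right r s) hy)) hx
    have := hM.cocycle_zero F (translate_mem (s := 1) hz hx) hd'
    have h1 := congrFun (congrFun this 1) a
    rwa [translate, mul_one] at h1

/-- A cochain of positive degree `≠ 2` on `A / A_{≥ s}` which is a cocycle on `A_{≥ r}` is
cohomologous to a cochain on `A / A_{≥ r}`. -/
theorem IsRegular.exists_sub_barD_mem (hM : F.IsRegular ℳ) {r : ℕ} (s : ℕ) {n : ℕ} (hn : n ≠ 1)
    {ℓ : ℤ} {z : A → (Fin (n + 1) → A) → M} (hz : z ∈ truncCochains 𝒜 ℳ (r + s) (n + 1) ℓ)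
    (hd : ∀ x ∈ geq 𝒜 r, ∀ a, barD k A A M (n + 1) z x a = 0) :
    ∃ η ∈ truncCochains 𝒜 ℳ (r + s) n ℓ,
      z - barD k A A M n η ∈ truncCochains 𝒜 ℳ r (n + 1) ℓ := by
  induction s generalizing z with
  | zero => exact ⟨0, Submodule.zero_mem _, by rwa [map_zero, sub_zero]⟩
  | succ s ih =>
    obtain ⟨η, hη, h1⟩ := F.exists_sub_barD_mem hM.action hz (r := r + s) fun x hx => by
      have hd' := barD_translate_eq_zero
        (fun y hy => hd y (geq_anti 𝒜 (Nat.le_add_right r s) hy)) hx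
      have ht := translate_mem (s := 1) hz hx
      match n, hn with
      | 0, _ => exact hM.primitive_one F ht hd'
      | n + 2, _ => exact F.primitive_add_three hM.action ht hd'
    obtain ⟨η', hη', h2⟩ := ih h1 (fun x hx a => by
      rw [map_sub, barD_barD, sub_zero, hd x hx])
    refine ⟨η + η', Submodule.add_mem _ hη (trunc_mono (by omega) _ hη'), ?_⟩
    rwa [map_add, ← sub_sub]

/-- Reducing the truncation down to `0` leaves a cochain which vanishes on `A_{≥ 0} = A`. -/
theorem IsRegular.exists_primitive (hM : F.IsRegular ℳ) {r n : ℕ} (hn : n ≠ 1)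
    {ℓ : ℤ} {z : A → (Fin (n + 1) → A) → M} (hz : z ∈ truncCochains 𝒜 ℳ r (n + 1) ℓ)
    (hd : barD k A A M (n + 1) z = 0) :
    ∃ η ∈ truncCochains 𝒜 ℳ r n ℓ, barD k A A M n η = z := by
  obtain ⟨η, hη, h⟩ := hM.exists_sub_barD_mem (r := 0) r hn (by rwa [zero_add])
    (fun x _ a => by rw [hd]; rfl)
  rw [zero_add] at hη
  exact ⟨η, hη, (sub_eq_zero.1 (eq_zero_of_mem_trunc_zero h)).symm⟩

variable (F)

/-- The residue `∑_β z(x, b_β, b'_β)` of a `2`-cochain. -/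
def residue (z : A → (Fin 2 → A) → M) (x : A) : M := ∑ β, z x ![F.b β, F.b' β]

theorem residue_mem {ℓ p : ℤ} {z : A → (Fin 2 → A) → M} (hz : z ∈ cochains 𝒜 (zgr 𝒜) ℳ 2 ℓ) {x : A}
    (hx : x ∈ zgr 𝒜 p) : F.residue z x ∈ ℳ (p + 2 + ℓ) := by
  refine Submodule.sum_mem _ fun β _ => ?_
  have := hz.2 p (fun _ => 1) x ![F.b β, F.b' β] hx (fun i => by
    fin_cases i
    · exact F.b_mem β
    · exact F.b'_mem β)
  simpa using this

variable {F}

/-- In cochain degree two the step from `r + 1` to `r` is obstructed by the residues on `A_r`. They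
lie in `M_{r+ℓ+2}`, which is generated by arrows from the degree below unless `r + ℓ + 2 = 0`. -/
theorem IsRegular.exists_sub_barD_mem_two_succ (hM : F.IsRegular ℳ) {r : ℕ} {ℓ : ℤ}
    {z : A → (Fin 2 → A) → M} (hz : z ∈ truncCochains 𝒜 ℳ (r + 1) 2 ℓ)
    (hd : ∀ x ∈ geq 𝒜 r, ∀ a, barD k A A M 2 z x a = 0)
    (h : (r : ℤ) + ℓ + 2 ≠ 0 ∨ ∀ x ∈ 𝒜 r, F.residue z x = 0) :
    ∃ η ∈ truncCochains 𝒜 ℳ (r + 1) 1 ℓ,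
      z - barD k A A M 1 η ∈ truncCochains 𝒜 ℳ r 2 ℓ := by
  refine F.exists_sub_barD_mem hM.action hz fun x hx => ?_
  have hd' := barD_translate_eq_zero hd hx
  have ht := translate_mem (s := 1) hz hx
  have hres : ∑ β, translate z x 1 ![F.b β, F.b' β] = F.residue z x := by
    simp [translate, residue]
  rcases h with h | h
  · obtain ⟨w, hw, hzw⟩ := hM.generated (ℓ + r + 1) (by omega) (F.residue z x) (by
      have := F.residue_mem hz.1 (p := r) hx
      rwa [show ℓ + r + 1 + 1 = r + 2 + ℓ by ring])
    exact F.primitive_two hM.action ht hd' w hw (by rw [hres, hzw])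
  · exact F.primitive_two hM.action ht hd' 0 (fun β => Submodule.zero_mem _)
      (by rw [hres, h x hx]; simp)

/-- A `2`-cocycle of degree `ℓ` is cohomologous to a cocycle on `A / A_{≥ r}` if `r + ℓ + 2 > 0`. -/
theorem IsRegular.exists_sub_barD_mem_two (hM : F.IsRegular ℳ) {r : ℕ} (s : ℕ) {ℓ : ℤ}
    (hr : 0 < (r : ℤ) + ℓ + 2) {z : A → (Fin 2 → A) → M} (hz : z ∈ truncCochains 𝒜 ℳ (r + s) 2 ℓ)
    (hd : barD k A A M 2 z = 0) :
    ∃ η ∈ truncCochains 𝒜 ℳ (r + s) 1 ℓ, z - barD k A A M 1 η ∈ truncCochains 𝒜 ℳ r 2 ℓ := by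
  induction s generalizing z with
  | zero => exact ⟨0, Submodule.zero_mem _, by rwa [map_zero, sub_zero]⟩
  | succ s ih =>
    obtain ⟨η, hη, h1⟩ := hM.exists_sub_barD_mem_two_succ (r := r + s) hz
      (fun x _ a => by rw [hd]; rfl) (Or.inl (by push_cast; omega))
    obtain ⟨η', hη', h2⟩ := ih h1 (by rw [map_sub, barD_barD, sub_zero, hd])
    refine ⟨η + η', Submodule.add_mem _ hη (trunc_mono (by omega) _ hη'), ?_⟩
    rwa [map_add, ← sub_sub]

/-- A `2`-cocycle of degree `ℓ` on `A / A_{≥ r}` is a coboundary if `r + ℓ + 2 ≤ 0`. -/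
theorem IsRegular.exists_primitive_two_of_le (hM : F.IsRegular ℳ) {r : ℕ} {ℓ : ℤ}
    (hr : (r : ℤ) + ℓ + 2 ≤ 0) {z : A → (Fin 2 → A) → M} (hz : z ∈ truncCochains 𝒜 ℳ r 2 ℓ)
    (hd : barD k A A M 2 z = 0) :
    ∃ η ∈ truncCochains 𝒜 ℳ r 1 ℓ, barD k A A M 1 η = z := by
  induction r generalizing z with
  | zero => exact ⟨0, Submodule.zero_mem _, by rw [map_zero, eq_zero_of_mem_trunc_zero hz]⟩
  | succ r ih =>
    obtain ⟨η, hη, h1⟩ := hM.exists_sub_barD_mem_two_succ hz (fun x _ a => by rw [hd]; rfl)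
      (Or.inl (by push_cast at hr; omega))
    obtain ⟨η', hη', h2⟩ := ih (by push_cast at hr; omega) h1
      (by rw [map_sub, barD_barD, sub_zero, hd])
    exact ⟨η + η', Submodule.add_mem _ hη (trunc_mono (by omega) _ hη'), by rw [map_add, h2]; abel⟩

/-- Vanishing residues take care of the top step; the residues in the remaining steps have negative
degree in `M`, so those steps are unobstructed. -/
theorem IsRegular.exists_primitive_two (hM : F.IsRegular ℳ) {r : ℕ} {ℓ : ℤ}
    (hr : (r : ℤ) + ℓ + 2 ≤ 0) {z : A → (Fin 2 → A) → M} (hz : z ∈ truncCochains 𝒜 ℳ (r + 1) 2 ℓ)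
    (hd : barD k A A M 2 z = 0) (hres : ∀ x ∈ 𝒜 r, F.residue z x = 0) :
    ∃ η ∈ truncCochains 𝒜 ℳ (r + 1) 1 ℓ, barD k A A M 1 η = z := by
  obtain ⟨η, hη, h1⟩ := hM.exists_sub_barD_mem_two_succ hz (fun x _ a => by rw [hd]; rfl)
    (Or.inr hres)
  obtain ⟨η', hη', h2⟩ := hM.exists_primitive_two_of_le hr h1
    (by rw [map_sub, barD_barD, sub_zero, hd])
  exact ⟨η + η', Submodule.add_mem _ hη (trunc_mono (by omega) _ hη'), by rw [map_add, h2]; abel⟩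

theorem barD_one_apply (η : A → (Fin 1 → A) → M) (x a c : A) :
    barD k A A M 1 η x ![a, c] = η (x * a) ![c] - η x ![a * c] + op c • η x ![a] := by
  have h := barD_cons (k := k) η x a (fun _ => c)
  have e : (Fin.cons a fun _ => c : Fin 2 → A) = ![a, c] := by
    funext i; fin_cases i <;> rfl
  rw [e] at h
  rw [h, barD_zero_apply]
  have e1 : (fun _ : Fin 1 => c) = ![c] := by funext i; fin_cases i; rfl
  have e2 : ∀ y : A, (Fin.cons y (Fin.elim0 : Fin 0 → A) : Fin 1 → A) = ![y] := by
    intro y; funext i; fin_cases i; rfl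
  simp only [slice, op_smul_eq_mul, e1, e2]
  abel

/-- Three terms, three reasons: `x b_β ∈ A_{≥ r+1}`, `∑ b_β b'_β = 0`, and `η(x, b_β)` has degree `r
+ ℓ + 1 < 0` in `M`. -/
theorem IsRegular.residue_barD_eq_zero (hM : F.IsRegular ℳ) {r : ℕ} {ℓ : ℤ}
    (hr : (r : ℤ) + ℓ + 2 ≤ 0) {η : A → (Fin 1 → A) → M} (hη : η ∈ truncCochains 𝒜 ℳ (r + 1) 1 ℓ)
    {x : A} (hx : x ∈ 𝒜 r) : F.residue (barD k A A M 1 η) x = 0 := by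
  simp only [residue, barD_one_apply, Finset.sum_add_distrib, Finset.sum_sub_distrib]
  have h1 : ∀ β, η (x * F.b β) ![F.b' β] = 0 := fun β =>
    hη.2 _ (mul_mem_geq_add hx (F.b_mem_geq β)) _
  have h2 : ∑ β, η x ![F.b β * F.b' β] = 0 := by
    have hs := (isML_succ_iff.1 (isML_of_mem hη.1)).1 x
    have := hs.sum_left Finset.univ (fun β => F.b β * F.b' β) Fin.elim0
    rw [F.sum_b_mul_b', hs.zero_left] at this
    rw [this]
    refine Finset.sum_congr rfl fun β _ => congrArg (η x) ?_
    funext i; fin_cases i; rfl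
  have h3 : ∀ β, η x ![F.b β] = 0 := fun β => by
    have := hη.1.2 r (fun _ => 1) x ![F.b β] hx (fun i => by
      fin_cases i; exact F.b_mem β)
    rw [hM.neg _ (by simp; omega)] at this
    exact this
  simp [h1, h2, h3]

/-- The residues of a coboundary on `A / A_{≥ r + 1}` vanish on `A_r`. -/
theorem IsRegular.residue_eq_zero (hM : F.IsRegular ℳ) {r : ℕ} {ℓ : ℤ}
    (hr : (r : ℤ) + ℓ + 2 ≤ 0) {z : A → (Fin 2 → A) → M} (hz : z ∈ truncCochains 𝒜 ℳ (r + 1) 2 ℓ)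
    {s : ℕ} {η : A → (Fin 1 → A) → M} (hη : η ∈ truncCochains 𝒜 ℳ s 1 ℓ)
    (hd : barD k A A M 1 η = z) {x : A} (hx : x ∈ 𝒜 r) : F.residue z x = 0 := by
  -- The primitive may live on a larger truncation. Being closed on `A_{≥ r+1}`, it can be moved to
  -- `A / A_{≥ r+1}` by a coboundary, which leaves `z` unchanged.
  obtain ⟨ζ, hζ, h⟩ := hM.exists_sub_barD_mem (r := r + 1) s zero_ne_one
    (trunc_mono (Nat.le_add_left s (r + 1)) _ hη) (fun y hy a => by rw [hd, hz.2 y hy])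
  have := hM.residue_barD_eq_zero hr h hx
  rwa [map_sub, barD_barD, sub_zero, hd] at this

/-- The spread of a primitive of the translate by `x` is right linear along `inc`, since `proj`
kills the image of `inc`. Its values at `1` and `e_v` are the two residues; the terms by which the
second could differ vanish by `∑ b_β b'_β = 0` and `M_{-1} = 0`. -/
theorem IsRegular.residue_mul_e (hM : F.IsRegular ℳ) {r : ℕ} {ℓ : ℤ}
    (hr : (r : ℤ) + ℓ + 2 = 0) {z : A → (Fin 2 → A) → M} (hz : z ∈ truncCochains 𝒜 ℳ (r + 1) 2 ℓ)
    (hd : barD k A A M 2 z = 0) {x : A} (hx : x ∈ 𝒜 r) (v : V) :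
    F.residue z (x * F.e v) = op (F.e v) • F.residue z x := by
  have hd' := barD_translate_eq_zero (z := z) (r := r) (fun x _ a => by rw [hd]; rfl) hx
  have ht := translate_mem (s := 1) hz hx
  set y := translate z x with hy
  set η := slice y 1 with hηdef
  have hη : η ∈ cochains 𝒜 (zgr 𝒜) ℳ 1 (ℓ + r) := slice_one_mem ht.1
  have hdη : barD k A A M 1 η = y := barD_slice_one hd'
  have hdη' : ∀ u ∈ geq 𝒜 1, ∀ a, barD k A A M 1 η u a = 0 := fun u hu a => by
    rw [hdη, ht.2 u hu]
  have hs := F.barD_spread hη hdη' (F.inc 1) (fun _ => F.e v)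
  rw [proj_inc, (isML_of_mem hη).zero_left, barD_zero_apply, ← inc_smul, op_smul_eq_mul, one_mul,
    sub_eq_zero] at hs
  have e2 : ∀ y : A, (Fin.cons y (Fin.elim0 : Fin 0 → A) : Fin 1 → A) = ![y] := by
    intro y; funext i; fin_cases i; rfl
  have h1 : F.spread η (F.inc 1) Fin.elim0 = F.residue z x := by
    refine Finset.sum_congr rfl fun β _ => ?_
    rw [cut_apply, inc_apply, mul_one, F.e_mul_b']
    simp only [hηdef, slice, hy, translate, mul_one, e2]
    rfl
  have h2 : F.spread η (F.inc (F.e v)) Fin.elim0 = ∑ β, η (F.e v * F.b β) ![F.b' β] := by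
    refine Finset.sum_congr rfl fun β _ => ?_
    rw [cut_apply, inc_apply, ← mul_assoc, F.e_mul_b', F.b'_mul_e, F.e_mul_b]
    simp only [slice, e2]
    by_cases h : F.src β = v
    · rw [if_pos h, if_pos h.symm]
    · rw [if_neg h, if_neg (Ne.symm h), (isML_of_mem hη).zero_left, ← e2]
      exact ((isML_succ_iff.1 (isML_of_mem hη)).1 _).zero_left _
  rw [h1, h2] at hs
  rw [← hs]
  have h3 : ∀ β, η (F.e v) ![F.b β] = 0 := fun β => by
    have := hη.2 0 (fun _ => 1) (F.e v) ![F.b β] (F.e_mem v) (fun i => by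
      fin_cases i; exact F.b_mem β)
    rw [hM.neg _ (by simp; omega)] at this
    exact this
  have h4 : ∑ β, η (F.e v) ![F.b β * F.b' β] = 0 := by
    have hs := (isML_succ_iff.1 (isML_of_mem hη)).1 (F.e v)
    have := hs.sum_left Finset.univ (fun β => F.b β * F.b' β) Fin.elim0
    rw [F.sum_b_mul_b', hs.zero_left] at this
    rw [this]
    exact Finset.sum_congr rfl fun β _ => congrArg (η _) (e2 _).symm
  have h5 : F.residue z (x * F.e v) = ∑ β, y (F.e v) ![F.b β, F.b' β] := rfl
  rw [h5, ← hdη]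
  simp only [barD_one_apply, Finset.sum_sub_distrib, h3, h4, smul_zero, add_zero, sub_zero]

variable (F) in
/-- The cochain `(x, a) ↦ μ · ret(sec(x) a)`. -/
def linking (μ : M) : A → (Fin 1 → A) → M :=
  fun x a => op (F.ret (op (a 0) • F.sec x)) • μ

theorem linking_mem (hℳ : GradedAction 𝒜 ℳ) {ℓ : ℤ} {μ : M} (hμ : μ ∈ ℳ (ℓ + 2)) :
    F.linking μ ∈ cochains 𝒜 (zgr 𝒜) ℳ 1 ℓ := by
  refine mem_cochains_succ.2 ⟨isML_succ_iff.2 ⟨fun x => isML_iff.2 ⟨fun a => ?_, fun a c d => ?_,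
    fun r a d => ?_⟩, fun x y a => ?_, fun c x a => ?_⟩, fun p x hx => ?_⟩
  · exact ⟨MultilinearMap.constOfIsEmpty k _ (slice (F.linking μ) x a Fin.elim0),
      fun c => by rw [Subsingleton.elim c Fin.elim0]; rfl⟩
  · simp only [slice, linking, Fin.cons_zero, op_add, add_smul, map_add]
  · simp only [slice, linking, Fin.cons_zero, op_smul, smul_assoc, map_smul]
  · simp only [linking, map_add, smul_add, op_add, add_smul]
  · simp only [linking, map_smul, smul_comm _ c, op_smul, smul_assoc]
  · refine comp_mem (j := p - 2) (orbit_cochain_mem hℳ hμ)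
      (F.ret ∘ₗ (orbit (k := k) (A := A) (F.sec x) : A →ₗ[k] (B → A))) (fun q a ha => ?_) (by ring)
    have h1 := orbit_mem (k := k) (gradedAction_piGr (𝒜 := 𝒜) (B := B)) (F.sec_mem_piGr p x hx) q a ha
    have h2 := F.ret_mem_zgr _ _ h1
    rwa [show q + (p + -1) + -1 = q + (p - 2) by ring] at h2

/-- On `A_{≥ 1}` the section `sec` fails to be right linear by `inc (ret (sec u · a))`, and applying
`ret` to this defect yields the cocycle identity. Hence the coboundary of `linking μ` is a 2-cocycle
on `A / A_{≥ 1}`, an explicit class with prescribed residue. -/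
theorem linking_barD (μ : M) {u : A} (hu : u ∈ geq 𝒜 1) (a : Fin 2 → A) :
    barD k A A M 1 (F.linking μ) u a = 0 := by
  have ea : a = ![a 0, a 1] := by funext i; fin_cases i <;> rfl
  rw [ea, barD_one_apply]
  generalize a 0 = a
  rename_i a'
  generalize a' 1 = c
  have h1 : F.sec (u * a) = F.cut (op a • F.sec u) - F.inc (F.ret (op a • F.sec u)) := by
    rw [cut_eq, proj_smul, proj_apply, F.sum_b_sec_of_mem_geq hu, op_smul_eq_mul]
    abel
  simp only [linking, Matrix.cons_val_fin_one]
  rw [h1, smul_sub, ← inc_smul, ← cut_smul, map_sub, ret_inc, ret_cut, smul_smul, ← op_mul,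
    op_sub, sub_smul, op_smul_eq_mul]
  simp only [op_mul, mul_smul]
  abel

/-- `sec` takes each generator to a basis vector, so summing over `β` gives `inc (e_v)`, and `ret`
recovers `e_v`. -/
theorem linking_residue (μ : M) (v : V) :
    F.residue (barD k A A M 1 (F.linking μ)) (F.e v) = op (F.e v) • μ := by
  simp only [residue, barD_one_apply, Finset.sum_add_distrib, Finset.sum_sub_distrib]
  simp only [linking, Matrix.cons_val_fin_one, F.sec_zero _ (F.e_mem v), smul_zero, map_zero,
    op_zero, zero_smul, Finset.sum_const_zero, sub_zero, add_zero]
  rw [← Finset.sum_smul, ← Finset.op_sum, ← map_sum]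
  congr 2
  have : ∑ β, op (F.b' β) • F.sec (F.e v * F.b β) = F.inc (F.e v) := by
    funext γ
    rw [Finset.sum_apply, Finset.sum_eq_single γ, inc_apply, F.b'_mul_e, F.e_mul_b]
    · by_cases h : F.src γ = v
      · rw [if_pos h.symm, if_pos h, F.sec_b]
        simp [F.e_mul_b']
      · rw [if_neg (Ne.symm h), if_neg h]
        simp
    · intro β _ hβ
      rw [F.e_mul_b]
      split_ifs with h
      · rw [F.sec_b]
        simp [hβ.symm]
      · simp
    · simp
  rw [this, ret_inc]

/-- Every map `A_r → M_0` compatible with the idempotents is the residue of a cocycle. -/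
theorem IsRegular.exists_residue_eq (hM : F.IsRegular ℳ) {r : ℕ} {ℓ : ℤ}
    (hr : (r : ℤ) + ℓ + 2 = 0) (f : A →ₗ[k] M) (hf : ∀ x ∈ 𝒜 r, f x ∈ ℳ 0)
    (hfe : ∀ x ∈ 𝒜 r, ∀ v, f (x * F.e v) = op (F.e v) • f x) :
    ∃ z ∈ truncCochains 𝒜 ℳ (r + 1) 2 ℓ, barD k A A M 2 z = 0 ∧
      ∀ x ∈ 𝒜 r, F.residue z x = f x := by
  set H : A →ₗ[k] (A → (Fin 2 → A) → M) :=
    { toFun := fun x => barD k A A M 1 (F.linking (f x))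
      map_add' := fun x y => by
        rw [← map_add]
        congr 1
        funext u a
        simp only [linking, map_add, smul_add, Pi.add_apply]
      map_smul' := fun c x => by
        rw [RingHom.id_apply, ← map_smul]
        congr 1
        funext u a
        simp only [linking, map_smul, smul_comm _ c, Pi.smul_apply] } with hHdef
  have hH : ∀ x ∈ 𝒜 r, H x ∈ truncCochains 𝒜 ℳ 1 2 (ℓ + r) := fun x hx =>
    ⟨barD_mem_self hM.action _ _ (linking_mem hM.action (by
      rw [show ℓ + r + 2 = 0 by omega]; exact hf x hx)), fun u hu a => linking_barD _ hu a⟩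
  have hz0 := F.assemble_mem (ℳ := ℳ) H (fun x hx => (hH x hx).1)
  -- The assembled cochain has the right residues but is closed only on `A_{≥ r}`. Its differential
  -- is a 3-cocycle on `A / A_{≥ r}`, so it has a primitive there; this primitive vanishes on `A_r`
  -- and does not affect the residues.
  have hd0 : barD k A A M 2 (F.assemble r H) ∈ truncCochains 𝒜 ℳ r 3 ℓ := by
    refine mem_trunc_of_succ (barD_mem_trunc hM.action hz0) fun x hx a => ?_
    rw [F.barD_assemble H hH hx]
    refine Finset.sum_eq_zero fun v _ => ?_
    have : barD k A A M 2 (H (x * F.e v)) = 0 := barD_barD _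
    rw [this]; rfl
  obtain ⟨η, hη, hdη⟩ := hM.exists_primitive (n := 2) (by norm_num) hd0 (barD_barD _)
  refine ⟨F.assemble r H - η, Submodule.sub_mem _ hz0 (trunc_mono (by omega) _ hη),
    by rw [map_sub, hdη, sub_self], fun x hx => ?_⟩
  have h1 : F.residue (F.assemble r H - η) x = F.residue (F.assemble r H) x := by
    refine Finset.sum_congr rfl fun β _ => ?_
    rw [Pi.sub_apply, Pi.sub_apply, hη.2 x (mem_geq 𝒜 le_rfl hx), sub_zero]
  rw [h1]
  have h2 : F.residue (F.assemble r H) x = ∑ v, F.residue (H (x * F.e v)) (F.e v) := by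
    simp only [residue, F.assemble_apply H hx]
    exact Finset.sum_comm
  rw [h2]
  have h3 : ∀ v, F.residue (H (x * F.e v)) (F.e v) = op (F.e v) • f x := fun v => by
    have : F.residue (H (x * F.e v)) (F.e v) = _ := linking_residue (F := F) (k := k) (f (x * F.e v)) v
    rw [this, hfe x hx, smul_smul, ← op_mul, F.e_mul_e, if_pos rfl]
  rw [Finset.sum_congr rfl fun v _ => h3 v, ← Finset.sum_smul, ← Finset.op_sum, F.sum_e, op_one,
    one_smul]

end KoszulFrame

end GradedRight

/-- Two quotients of `X` by the same kernel. `Y` is the local cohomology below; its additive monoid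
structure suffices, as the scalars supply negatives. -/
theorem LinearMap.exists_linearEquiv_of_ker_eq {k X Y Z : Type*} [Field k] [AddCommGroup X]
    [Module k X] [AddCommMonoid Y] [Module k Y] [AddCommGroup Z] [Module k Z] (p : X →ₗ[k] Y)
    (q : X →ₗ[k] Z) (hp : Function.Surjective p) (hq : Function.Surjective q)
    (h : ∀ x, p x = 0 ↔ q x = 0) : ∃ e : Y ≃ₗ[k] Z, ∀ x, e (p x) = q x := by
  let _ : AddCommGroup Y := Module.addCommMonoidToAddCommGroup k
  have hk : LinearMap.ker p = LinearMap.ker q := by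
    ext x
    exact h x
  refine ⟨(p.quotKerEquivOfSurjective hp).symm ≪≫ₗ Submodule.quotEquivOfEq _ _ hk ≪≫ₗ
    q.quotKerEquivOfSurjective hq, fun x => ?_⟩
  have h1 : (p.quotKerEquivOfSurjective hp).symm (p x) = Submodule.Quotient.mk x := by
    rw [LinearEquiv.symm_apply_eq]
    rfl
  simp only [LinearEquiv.trans_apply, h1]
  rfl

namespace GradedRight

/-! ### Local cohomology classes of truncated cocycles -/

section Classes

variable {k A : Type*} [Field k] [Ring A] [Algebra k A] (𝒜 : ℕ → Submodule k A)
  [DirectSum.Decomposition 𝒜] [SetLike.GradedMonoid 𝒜]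
  {M : Type*} [AddCommGroup M] [Module k M] [Module Aᵐᵒᵖ M] [IsScalarTower k Aᵐᵒᵖ M]
  (ℳ : ℤ → Submodule k M)

variable (M) in
/-- A cochain on `A` regarded as a cochain on `A / A_{≥ r}`, by a choice of representatives. -/
def descend (r n : ℕ) :
    (A → (Fin n → A) → M) →ₗ[k] ((A ⧸ geq 𝒜 r) → (Fin n → A) → M) where
  toFun φ x a := φ (Function.surjInv (Submodule.mkQ_surjective (geq 𝒜 r)) x) a
  map_add' _ _ := rfl
  map_smul' _ _ := rfl

variable {𝒜 ℳ} {r n : ℕ} {ℓ : ℤ}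

theorem descend_mk {φ : A → (Fin n → A) → M} (h : φ ∈ truncCochains 𝒜 ℳ r n ℓ) (x : A)
    (a : Fin n → A) : descend 𝒜 M r n φ (Submodule.Quotient.mk x) a = φ x a := by
  have h1 := Function.surjInv_eq (Submodule.mkQ_surjective (geq 𝒜 r)) (Submodule.Quotient.mk x)
  rw [Submodule.mkQ_apply, Submodule.Quotient.eq] at h1
  have h2 := h.2 _ h1 a
  rw [(isML_of_mem h.1).sub_left] at h2
  exact sub_eq_zero.1 h2

theorem descend_mem {φ : A → (Fin n → A) → M} (h : φ ∈ truncCochains 𝒜 ℳ r n ℓ) :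
    descend 𝒜 M r n φ ∈ cochains 𝒜 (quotGr 𝒜 r) ℳ n ℓ := by
  refine ⟨isML_iff.2 ⟨fun x => ?_, fun x y a => ?_, fun c x a => ?_⟩, fun p d x a hx ha => ?_⟩
  · exact (isML_iff.1 h.1.1).1 _
  · induction x using Submodule.Quotient.induction_on with | _ x => ?_
    induction y using Submodule.Quotient.induction_on with | _ y => ?_
    rw [← Submodule.Quotient.mk_add, descend_mk h, descend_mk h, descend_mk h,
      (isML_of_mem h.1).add_left]
  · induction x using Submodule.Quotient.induction_on with | _ x => ?_
    rw [← Submodule.Quotient.mk_smul, descend_mk h, descend_mk h, (isML_of_mem h.1).smul_left]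
  · obtain ⟨y, hy, rfl⟩ := hx
    change descend 𝒜 M r n φ (Submodule.Quotient.mk y) a ∈ _
    rw [descend_mk h]
    exact h.1.2 p d y a hy ha

/-- The quotient map `A → A / A_{≥ r}`, as a `k`-linear map. -/
def quotMk (𝒜 : ℕ → Submodule k A) (r : ℕ) : A →ₗ[k] A ⧸ geq 𝒜 r :=
  (geq 𝒜 r).mkQ.restrictScalars k

/-- A cochain on `A / A_{≥ r}` regarded as a cochain on `A`. -/
def ascend (ψ : (A ⧸ geq 𝒜 r) → (Fin n → A) → M) : A → (Fin n → A) → M :=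
  fun x a => ψ (quotMk 𝒜 r x) a

theorem ascend_mem {ψ : (A ⧸ geq 𝒜 r) → (Fin n → A) → M}
    (h : ψ ∈ cochains 𝒜 (quotGr 𝒜 r) ℳ n ℓ) : ascend ψ ∈ truncCochains 𝒜 ℳ r n ℓ := by
  refine ⟨comp_mem (j := 0) h (quotMk 𝒜 r) (fun p x hx => ?_) (by ring), fun x hx a => ?_⟩
  · rw [add_zero]
    exact ⟨x, hx, rfl⟩
  · have : quotMk 𝒜 r x = 0 := (Submodule.Quotient.mk_eq_zero _).2 hx
    rw [ascend, this]
    obtain ⟨Φ, hΦ⟩ := h.1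
    simp [hΦ]

theorem barD_ascend (ψ : (A ⧸ geq 𝒜 r) → (Fin n → A) → M) :
    barD k A A M n (ascend ψ) = ascend (barD k A (A ⧸ geq 𝒜 r) M n ψ) := by
  funext x a
  exact barD_comp ψ (quotMk 𝒜 r) (fun _ _ => rfl) x a

theorem descend_ascend {ψ : (A ⧸ geq 𝒜 r) → (Fin n → A) → M}
    (h : ψ ∈ cochains 𝒜 (quotGr 𝒜 r) ℳ n ℓ) : descend 𝒜 M r n (ascend ψ) = ψ := by
  funext x a
  induction x using Submodule.Quotient.induction_on with | _ x => ?_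
  rw [descend_mk (ascend_mem h)]
  rfl

theorem ascend_descend {φ : A → (Fin n → A) → M} (h : φ ∈ truncCochains 𝒜 ℳ r n ℓ) :
    ascend (descend 𝒜 M r n φ) = φ := by
  funext x a
  exact descend_mk h x a

theorem ascend_injective : Function.Injective
    (ascend : ((A ⧸ geq 𝒜 r) → (Fin n → A) → M) → A → (Fin n → A) → M) := by
  intro φ ψ h
  funext x a
  induction x using Submodule.Quotient.induction_on with | _ x => ?_
  exact congrFun (congrFun h x) a

theorem barD_descend {φ : A → (Fin n → A) → M} (h : φ ∈ truncCochains 𝒜 ℳ r n ℓ)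
    (hℳ : GradedAction 𝒜 ℳ) :
    barD k A (A ⧸ geq 𝒜 r) M n (descend 𝒜 M r n φ) = descend 𝒜 M r (n + 1) (barD k A A M n φ) := by
  apply ascend_injective
  rw [← barD_ascend, ascend_descend h, ascend_descend (barD_mem_trunc hℳ h)]

variable (𝒜 ℳ) in
/-- The cocycles of `A` with values in `M` which vanish on `A_{≥ r}`. -/
def truncCocycles (r n : ℕ) (ℓ : ℤ) : Submodule k (A → (Fin n → A) → M) :=
  truncCochains 𝒜 ℳ r n ℓ ⊓ LinearMap.ker (barD k A A M n)

theorem descend_mem_cocycles {φ : A → (Fin n → A) → M} (h : φ ∈ truncCocycles 𝒜 ℳ r n ℓ) :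
    descend 𝒜 M r n φ ∈ cocycles 𝒜 (quotGr 𝒜 r) ℳ n ℓ := by
  refine ⟨descend_mem h.1, ascend_injective ?_⟩
  rw [← barD_ascend, ascend_descend h.1, show barD k A A M n φ = 0 from h.2]
  rfl

variable (𝒜 ℳ) in
/-- The class in local cohomology of a cocycle which vanishes on `A_{≥ r}`. -/
def cls (r n : ℕ) (ℓ : ℤ) : truncCocycles 𝒜 ℳ r n ℓ →ₗ[k] LocalCohomology 𝒜 ℳ n ℓ :=
  Module.DirectLimit.of k ℕ (fun r => Ext 𝒜 (quotGr 𝒜 r) ℳ n ℓ) (trans 𝒜 ℳ n ℓ) r ∘ₗ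
    Submodule.mkQ _ ∘ₗ (descend 𝒜 M r n).restrict fun _ h => descend_mem_cocycles h

theorem cls_apply (z : truncCocycles 𝒜 ℳ r n ℓ) : cls 𝒜 ℳ r n ℓ z =
    Module.DirectLimit.of k ℕ (fun r => Ext 𝒜 (quotGr 𝒜 r) ℳ n ℓ) (trans 𝒜 ℳ n ℓ) r
      (Submodule.Quotient.mk ⟨descend 𝒜 M r n z, descend_mem_cocycles z.2⟩) := rfl

instance : DirectedSystem (fun r => Ext 𝒜 (quotGr 𝒜 r) ℳ n ℓ) (fun r r' h => trans 𝒜 ℳ n ℓ r r' h) where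
  map_self r x := by
    induction x using Submodule.Quotient.induction_on with | _ x => ?_
    apply congrArg Submodule.Quotient.mk
    apply Subtype.ext
    funext y a
    induction y using Submodule.Quotient.induction_on with | _ y => rfl
  map_map r s t hr hs x := by
    induction x using Submodule.Quotient.induction_on with | _ x => ?_
    apply congrArg Submodule.Quotient.mk
    apply Subtype.ext
    funext y a
    induction y using Submodule.Quotient.induction_on with | _ y => rfl

theorem exists_cls_eq (X : LocalCohomology 𝒜 ℳ n ℓ) :
    ∃ r, ∃ z : truncCocycles 𝒜 ℳ r n ℓ, cls 𝒜 ℳ r n ℓ z = X := by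
  obtain ⟨r, x, rfl⟩ := Module.DirectLimit.exists_of X
  induction x using Submodule.Quotient.induction_on with | _ x => ?_
  refine ⟨r, ⟨ascend x.1, ascend_mem x.2.1, ?_⟩, ?_⟩
  · change barD k A A M n _ = 0
    rw [barD_ascend, show barD k A (A ⧸ geq 𝒜 r) M n x.1 = 0 from x.2.2]
    rfl
  · rw [cls_apply]
    congr 2
    exact Subtype.ext (descend_ascend x.2.1)

theorem trans_mk {r' : ℕ} (h : r ≤ r') {φ : A → (Fin n → A) → M}
    (hφ : φ ∈ truncCocycles 𝒜 ℳ r n ℓ) (hφ' : φ ∈ truncCocycles 𝒜 ℳ r' n ℓ) :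
    trans 𝒜 ℳ n ℓ r r' h (Submodule.Quotient.mk ⟨descend 𝒜 M r n φ, descend_mem_cocycles hφ⟩)
      = Submodule.Quotient.mk ⟨descend 𝒜 M r' n φ, descend_mem_cocycles hφ'⟩ := by
  apply congrArg Submodule.Quotient.mk
  apply Subtype.ext
  apply ascend_injective
  funext x a
  exact (descend_mk hφ.1 x a).trans (descend_mk hφ'.1 x a).symm

theorem truncCocycles_mono {r' : ℕ} (h : r ≤ r') :
    truncCocycles 𝒜 ℳ r n ℓ ≤ truncCocycles 𝒜 ℳ r' n ℓ :=
  fun _ hφ => ⟨trunc_mono h _ hφ.1, hφ.2⟩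

theorem cls_mono {r' : ℕ} (h : r ≤ r') {φ : A → (Fin n → A) → M}
    (hφ : φ ∈ truncCocycles 𝒜 ℳ r n ℓ) :
    cls 𝒜 ℳ r' n ℓ ⟨φ, truncCocycles_mono h hφ⟩ = cls 𝒜 ℳ r n ℓ ⟨φ, hφ⟩ := by
  rw [cls_apply, cls_apply, ← trans_mk h hφ (truncCocycles_mono h hφ), Module.DirectLimit.of_f]

/-- Vanishing in a direct limit is witnessed at a finite stage, so the truncation `s` of the
primitive may exceed `r`. -/
theorem cls_eq_zero_iff (hℳ : GradedAction 𝒜 ℳ) (z : truncCocycles 𝒜 ℳ r (n + 1) ℓ) :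
    cls 𝒜 ℳ r (n + 1) ℓ z = 0 ↔
      ∃ s, ∃ η ∈ truncCochains 𝒜 ℳ s n ℓ, barD k A A M n η = z := by
  obtain ⟨z, hz⟩ := z
  constructor
  · intro h
    rw [cls_apply] at h
    obtain ⟨s, hs, h1⟩ := Module.DirectLimit.of.zero_exact h
    rw [trans_mk hs hz (truncCocycles_mono hs hz), Submodule.Quotient.mk_eq_zero] at h1
    obtain ⟨ψ, hψ, h2⟩ := h1
    refine ⟨s, ascend ψ, ascend_mem hψ, ?_⟩
    rw [barD_ascend, h2]
    exact ascend_descend (trunc_mono hs _ hz.1)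
  · rintro ⟨s, η, hη, rfl⟩
    have hη' := trunc_mono (le_max_right r s) ℓ hη
    rw [← cls_mono (le_max_left r s), cls_apply, (Submodule.Quotient.mk_eq_zero _).2, map_zero]
    exact ⟨descend 𝒜 M _ n η, descend_mem hη', barD_descend hη' hℳ⟩

/-- The `g`-conjugate `f ∘ z ∘ g⁻¹` of a cochain. -/
def conj {g : GradedAut 𝒜} (f : TwistedEnd ℳ g) (z : A → (Fin n → A) → M) :
    A → (Fin n → A) → M :=
  fun x a => f.toMap (z (g.toEquiv.symm x) fun i => g.toEquiv.symm (a i))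

theorem conj_ascend {g : GradedAut 𝒜} (f : TwistedEnd ℳ g)
    (ψ : (A ⧸ geq 𝒜 r) → (Fin n → A) → M) :
    ascend ((f.coeff r).onCochains n ψ) = conj f (ascend ψ) := rfl

theorem conj_mem {g : GradedAut 𝒜} (f : TwistedEnd ℳ g) {z : A → (Fin n → A) → M}
    (hz : z ∈ truncCocycles 𝒜 ℳ r n ℓ) : conj f z ∈ truncCocycles 𝒜 ℳ r n ℓ := by
  have h := (f.coeff r).onCochains_cocycles n ℓ ℓ (add_zero ℓ).symm _ (descend_mem_cocycles hz)
  rw [← ascend_descend hz.1, ← conj_ascend]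
  refine ⟨ascend_mem h.1, ?_⟩
  change barD k A A M n _ = 0
  rw [barD_ascend, show barD k A (A ⧸ geq 𝒜 r) M n _ = 0 from h.2]
  rfl

theorem onCohomology_cls {g : GradedAut 𝒜} (f : TwistedEnd ℳ g) {z : A → (Fin n → A) → M}
    (hz : z ∈ truncCocycles 𝒜 ℳ r n ℓ) :
    f.onCohomology n ℓ (cls 𝒜 ℳ r n ℓ ⟨z, hz⟩) = cls 𝒜 ℳ r n ℓ ⟨conj f z, conj_mem f hz⟩ := by
  rw [cls_apply, cls_apply, TwistedEnd.onCohomology, Module.DirectLimit.map_apply_of]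
  congr 1
  apply congrArg Submodule.Quotient.mk
  apply Subtype.ext
  apply ascend_injective
  change ascend ((f.coeff r).onCochains n (descend 𝒜 M r n z)) = ascend (descend 𝒜 M r n (conj f z))
  rw [conj_ascend, ascend_descend hz.1, ascend_descend (conj_mem f hz).1]

theorem translate_mem_cocycles {j : ℕ} {a : A} (ha : a ∈ 𝒜 j) {z : A → (Fin n → A) → M}
    (hz : z ∈ truncCocycles 𝒜 ℳ r n ℓ) : translate z a ∈ truncCocycles 𝒜 ℳ r n (ℓ + j) := by
  refine ⟨translate_mem (trunc_mono (Nat.le_add_left r j) _ hz.1) ha, ?_⟩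
  change barD k A A M n _ = 0
  rw [barD_translate, show barD k A A M n z = 0 from hz.2]
  rfl

theorem act_cls {j : ℕ} {a : A} (ha : a ∈ 𝒜 j) {z : A → (Fin n → A) → M}
    (hz : z ∈ truncCocycles 𝒜 ℳ r n ℓ) :
    LocalCohomology.act 𝒜 ℳ ha n ℓ (cls 𝒜 ℳ r n ℓ ⟨z, hz⟩)
      = cls 𝒜 ℳ r n (ℓ + j) ⟨translate z a, translate_mem_cocycles ha hz⟩ := by
  rw [cls_apply, cls_apply, LocalCohomology.act, Module.DirectLimit.map_apply_of]
  congr 1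
  apply congrArg Submodule.Quotient.mk
  apply Subtype.ext
  apply ascend_injective
  change ascend ((mulCoeff 𝒜 ℳ ha r).onCochains n (descend 𝒜 M r n z)) = _
  change translate (ascend (descend 𝒜 M r n z)) a = ascend (descend 𝒜 M r n (translate z a))
  rw [ascend_descend hz.1, ascend_descend (translate_mem_cocycles ha hz).1]

end Classes

/-! ### The second local cohomology as a space of residues -/

namespace KoszulFrame

variable {k A : Type*} [Field k] [Ring A] [Algebra k A] {𝒜 : ℕ → Submodule k A}
  [DirectSum.Decomposition 𝒜] [SetLike.GradedMonoid 𝒜]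
  {V B : Type*} [Fintype V] [DecidableEq V] [Fintype B] [DecidableEq B] {F : KoszulFrame 𝒜 V B}
  {M : Type*} [AddCommGroup M] [Module k M] [Module Aᵐᵒᵖ M] [IsScalarTower k Aᵐᵒᵖ M]
  {ℳ : ℤ → Submodule k M}

/-- The local cohomology of a regular module is concentrated in degree `2`. -/
theorem IsRegular.subsingleton_localCohomology (hM : F.IsRegular ℳ) {n : ℕ} (hn : n ≠ 2) (ℓ : ℤ) :
    Subsingleton (LocalCohomology 𝒜 ℳ n ℓ) := by
  refine subsingleton_of_forall_eq 0 fun X => ?_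
  obtain ⟨r, ⟨z, hz⟩, rfl⟩ := exists_cls_eq X
  match n, hn with
  | 0, _ =>
    have h := hM.mem_trunc_zero (r := 0) r (by rw [zero_add]; exact hz.1)
      (fun x _ a => congrFun (congrFun hz.2 x) a)
    have h0 : (⟨z, hz⟩ : truncCocycles 𝒜 ℳ r 0 ℓ) = 0 := Subtype.ext (eq_zero_of_mem_trunc_zero h)
    rw [h0, map_zero]
  | n + 1, hn =>
    rw [cls_eq_zero_iff hM.action]
    exact ⟨r, hM.exists_primitive (by omega) hz.1 hz.2⟩

variable (F ℳ) in
/-- The maps `A_q → M_0` which are compatible with the idempotents. -/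
def residueSpace (q : ℤ) : Submodule k (zgr 𝒜 q →ₗ[k] M) where
  carrier := {f | (∀ x, f x ∈ ℳ 0) ∧
    ∀ (x : zgr 𝒜 q) v (h : (x : A) * F.e v ∈ zgr 𝒜 q), f ⟨x * F.e v, h⟩ = op (F.e v) • f x}
  add_mem' h h' := ⟨fun x => Submodule.add_mem _ (h.1 x) (h'.1 x), fun x v hx => by
    rw [LinearMap.add_apply, LinearMap.add_apply, h.2 x v hx, h'.2 x v hx, smul_add]⟩
  zero_mem' := ⟨fun _ => Submodule.zero_mem _, fun _ _ _ => (smul_zero _).symm⟩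
  smul_mem' c f h := ⟨fun x => Submodule.smul_mem _ c (h.1 x), fun x v hx => by
    rw [LinearMap.smul_apply, LinearMap.smul_apply, h.2 x v hx, smul_comm]⟩

variable (F) in
/-- The residues of cocycles, as a linear map. -/
def residueMap (r : ℕ) (q ℓ : ℤ) : truncCocycles 𝒜 ℳ r 2 ℓ →ₗ[k] (zgr 𝒜 q →ₗ[k] M) where
  toFun z :=
    { toFun := fun x => F.residue z.1 x
      map_add' := fun x y => by
        simp only [residue, Submodule.coe_add, (isML_of_mem z.2.1.1).add_left,
          Finset.sum_add_distrib]
      map_smul' := fun c x => by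
        simp only [residue, Submodule.coe_smul, (isML_of_mem z.2.1.1).smul_left, Finset.smul_sum,
          RingHom.id_apply] }
  map_add' z w := by
    ext x
    simp [residue, Finset.sum_add_distrib]
  map_smul' c z := by
    ext x
    simp [residue, Finset.smul_sum]

/-- The truncation `(q + 1).toNat` is just large enough to see residues on `A_q`. For negative `q`
it is `0`, and then both the cocycle and `A_q` are zero. -/
theorem IsRegular.residueMap_mem (hM : F.IsRegular ℳ) {q ℓ : ℤ} (hq : q + ℓ + 2 = 0)
    (z : truncCocycles 𝒜 ℳ (q + 1).toNat 2 ℓ) :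
    F.residueMap (q + 1).toNat q ℓ z ∈ F.residueSpace ℳ q := by
  refine ⟨fun x => ?_, fun x v h => ?_⟩
  · have := F.residue_mem z.2.1.1 x.2
    rwa [show q + 2 + ℓ = 0 by omega] at this
  · cases q with
    | ofNat r =>
      exact hM.residue_mul_e (r := r) (by simpa using hq) z.2.1 z.2.2 x.2 v
    | negSucc r =>
      have h0 : x = 0 := Subtype.ext x.2
      have h1 : (⟨x * F.e v, h⟩ : zgr 𝒜 (Int.negSucc r)) = 0 := Subtype.ext h
      rw [h1, h0, map_zero, smul_zero]

/-- For `r = (q + 1).toNat` one has `r + ℓ + 2 > 0`, so every step from a larger truncation down to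
`r` is unobstructed. -/
theorem IsRegular.exists_cls_eq_two (hM : F.IsRegular ℳ) {q ℓ : ℤ} (hq : q + ℓ + 2 = 0)
    (X : LocalCohomology 𝒜 ℳ 2 ℓ) :
    ∃ z : truncCocycles 𝒜 ℳ (q + 1).toNat 2 ℓ, cls 𝒜 ℳ (q + 1).toNat 2 ℓ z = X := by
  obtain ⟨s, ⟨z, hz⟩, rfl⟩ := exists_cls_eq X
  set r := (q + 1).toNat with hr
  obtain ⟨η, hη, h⟩ := hM.exists_sub_barD_mem_two (r := r) s (by omega)
    (trunc_mono (Nat.le_add_left s r) _ hz.1) hz.2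
  have hz' : z - barD k A A M 1 η ∈ truncCocycles 𝒜 ℳ r 2 ℓ :=
    ⟨h, by
      change barD k A A M 2 _ = 0
      rw [map_sub, barD_barD, sub_zero]
      exact hz.2⟩
  refine ⟨⟨_, hz'⟩, ?_⟩
  rw [← cls_mono (Nat.le_add_right r s) hz', ← cls_mono (Nat.le_add_left s r) hz]
  have hd : -barD k A A M 1 η ∈ truncCocycles 𝒜 ℳ (r + s) 2 ℓ := by
    refine ⟨Submodule.neg_mem _ (barD_mem_trunc hM.action hη), ?_⟩
    change barD k A A M 2 _ = 0
    rw [map_neg, barD_barD, neg_zero]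
  have h0 : cls 𝒜 ℳ (r + s) 2 ℓ ⟨_, hd⟩ = 0 :=
    (cls_eq_zero_iff hM.action _).2 ⟨r + s, -η, Submodule.neg_mem _ hη, map_neg _ _⟩
  rw [← add_zero (cls 𝒜 ℳ (r + s) 2 ℓ ⟨z, _⟩), ← h0, ← map_add]
  congr 1
  exact Subtype.ext (sub_eq_add_neg _ _)

theorem IsRegular.cls_eq_zero_iff_residue (hM : F.IsRegular ℳ) {q ℓ : ℤ} (hq : q + ℓ + 2 = 0)
    (z : truncCocycles 𝒜 ℳ (q + 1).toNat 2 ℓ) :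
    cls 𝒜 ℳ (q + 1).toNat 2 ℓ z = 0 ↔ F.residueMap (q + 1).toNat q ℓ z = 0 := by
  rw [cls_eq_zero_iff hM.action]
  cases q with
  | ofNat r =>
    constructor
    · rintro ⟨s, η, hη, hd⟩
      ext x
      exact hM.residue_eq_zero (r := r) (by simp at hq; omega) z.2.1 hη hd x.2
    · intro h
      exact ⟨r + 1, hM.exists_primitive_two (r := r) (by simp at hq; omega) z.2.1 z.2.2
        fun x hx => LinearMap.congr_fun h ⟨x, hx⟩⟩
  | negSucc r =>
    have hr : (Int.negSucc r + 1).toNat = 0 := by omega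
    constructor
    · intro _
      ext x
      rw [show x = 0 from Subtype.ext x.2, map_zero, map_zero]
    · intro _
      refine ⟨0, 0, Submodule.zero_mem _, ?_⟩
      have hz := z.2.1
      simp only [hr] at hz
      rw [map_zero, eq_zero_of_mem_trunc_zero hz]

theorem IsRegular.exists_residueMap_eq (hM : F.IsRegular ℳ) {q ℓ : ℤ} (hq : q + ℓ + 2 = 0)
    {f : zgr 𝒜 q →ₗ[k] M} (hf : f ∈ F.residueSpace ℳ q) :
    ∃ z : truncCocycles 𝒜 ℳ (q + 1).toNat 2 ℓ, F.residueMap (q + 1).toNat q ℓ z = f := by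
  cases q with
  | ofNat r =>
    obtain ⟨f', hf'⟩ := LinearMap.exists_extend f
    have h1 : ∀ x (hx : x ∈ 𝒜 r), f' x = f ⟨x, hx⟩ := fun x hx => LinearMap.congr_fun hf' ⟨x, hx⟩
    obtain ⟨z, hz, hd, hres⟩ := hM.exists_residue_eq (r := r) (ℓ := ℓ) (by simpa using hq) f'
      (fun x hx => by rw [h1 x hx]; exact hf.1 _)
      (fun x hx v => by
        rw [h1 x hx, h1 _ (F.mul_e_mem hx v)]
        exact hf.2 ⟨x, hx⟩ v _)
    refine ⟨⟨z, hz, hd⟩, ?_⟩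
    ext x
    exact (hres x x.2).trans (h1 _ _)
  | negSucc r =>
    refine ⟨0, ?_⟩
    ext x
    rw [show x = 0 from Subtype.ext x.2, map_zero, map_zero]

/-- The second local cohomology of a regular module is identified by residues. -/
theorem IsRegular.exists_residueEquiv (hM : F.IsRegular ℳ) {q ℓ : ℤ} (hq : q + ℓ + 2 = 0) :
    ∃ Θ : LocalCohomology 𝒜 ℳ 2 ℓ ≃ₗ[k] F.residueSpace ℳ q,
      ∀ (z : A → (Fin 2 → A) → M) (hz : z ∈ truncCocycles 𝒜 ℳ (q + 1).toNat 2 ℓ) (x : zgr 𝒜 q),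
        (Θ (cls 𝒜 ℳ (q + 1).toNat 2 ℓ ⟨z, hz⟩) : zgr 𝒜 q →ₗ[k] M) x = F.residue z x := by
  obtain ⟨Θ, hΘ⟩ := LinearMap.exists_linearEquiv_of_ker_eq (cls 𝒜 ℳ (q + 1).toNat 2 ℓ)
    ((F.residueMap (q + 1).toNat q ℓ).codRestrict _ fun z => hM.residueMap_mem hq z)
    (fun X => hM.exists_cls_eq_two hq X)
    (fun f => by
      obtain ⟨z, hz⟩ := hM.exists_residueMap_eq hq f.2
      exact ⟨z, Subtype.ext hz⟩)
    (fun z => by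
      rw [hM.cls_eq_zero_iff_residue hq]
      exact ⟨fun h => Subtype.ext h, fun h => congrArg Subtype.val h⟩)
  exact ⟨Θ, fun z hz x => by rw [hΘ]; rfl⟩

end KoszulFrame

end GradedRight

namespace Preproj

open GradedRight

/-! ### The Koszul frame of a preprojective algebra -/

section Frame

variable {k : Type*} [Field k] {V E : Type*} [Fintype V] [DecidableEq V] [Fintype E]
  [DecidableEq E] {Q : FinQuiver V E}

/-- A homogeneous contraction of the left Koszul complex. -/
theorem exists_left_contraction (hsoc : ∀ x : Preproj k Q, (∀ β, x * dbl k Q β = 0) → x = 0) :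
    ∃ (σ : Preproj k Q →ₗ[k] (E ⊕ E → Preproj k Q)) (ρ : (E ⊕ E → Preproj k Q) →ₗ[k] Preproj k Q),
      (∀ a ∈ grading k Q 0, σ a = 0) ∧
      (∀ n, ∀ a ∈ grading k Q (n + 1), ∀ β, σ a β ∈ grading k Q n) ∧
      (∀ (n : ℕ) (y : E ⊕ E → Preproj k Q), (∀ β, y β ∈ grading k Q n) →
        ρ y ∈ zgr (grading k Q) ((n : ℤ) - 1)) ∧
      (∀ n, ∀ a ∈ grading k Q (n + 1), ∑ β, σ a β * codbl k Q β = a) ∧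
      (∀ y β, y β * vert k Q (Q.double.tgt β) =
        σ (∑ γ, y γ * codbl k Q γ) β + ρ y * dbl k Q β) ∧
      (∀ x, ρ (fun β => x * dbl k Q β) = x) ∧
      (∀ y, ρ (fun β => y β * vert k Q (Q.double.tgt β)) = ρ y) := by
  choose s t h1 h2 h3 _ h5 using fun n : ℕ =>
    koszul_contraction k Q n (by omega) fun x _ hx => hsoc x hx
  -- The contractions of the separate degrees are glued along the grading. Degree zero is the
  -- cokernel of the last Koszul map and has nothing to lift to, so `σ` is set to zero there.
  set σ : Preproj k Q →ₗ[k] (E ⊕ E → Preproj k Q) := ofComponents (grading k Q) fun n =>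
    match n with
    | 0 => 0
    | n + 1 => LinearMap.pi fun β => (zgr (grading k Q) n).subtype ∘ₗ LinearMap.proj β ∘ₗ t n
    with hσdef
  set ρ : (E ⊕ E → Preproj k Q) →ₗ[k] Preproj k Q := ∑ β, (ofComponents (grading k Q) fun n =>
    (zgr (grading k Q) ((n : ℤ) - 1)).subtype ∘ₗ s n ∘ₗ
      LinearMap.single k (fun _ => zgr (grading k Q) (n : ℤ)) β) ∘ₗ LinearMap.proj β with hρdef
  have hσ0 : ∀ a ∈ grading k Q 0, σ a = 0 := fun a ha => by
    rw [hσdef, ofComponents_of_mem _ _ ha]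
    rfl
  have hσ : ∀ n a (ha : a ∈ grading k Q (n + 1)) β, σ a β = t n ⟨a, ha⟩ β := fun n a ha β => by
    rw [hσdef, ofComponents_of_mem _ _ ha]
    rfl
  have hρ : ∀ (n : ℕ) (y : E ⊕ E → Preproj k Q) (hy : ∀ β, y β ∈ grading k Q n),
      ρ y = s n fun β => ⟨y β, hy β⟩ := fun n y hy => by
    rw [hρdef, LinearMap.sum_apply]
    have : (fun β => (⟨y β, hy β⟩ : zgr (grading k Q) n))
      = ∑ β, LinearMap.single k (fun _ => zgr (grading k Q) (n : ℤ)) β ⟨y β, hy β⟩ :=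
      (Finset.univ_sum_single _).symm
    rw [this, map_sum, Submodule.coe_sum]
    refine Finset.sum_congr rfl fun β _ => ?_
    rw [LinearMap.comp_apply, LinearMap.proj_apply, ofComponents_of_mem _ _ (hy β)]
    rfl
  -- The identities to be proved are additive in the tuple, so they may be checked on tuples whose
  -- entries share one degree.
  have hind : ∀ P : (E ⊕ E → Preproj k Q) → Prop, P 0 → (∀ y z, P y → P z → P (y + z)) →
      (∀ (n : ℕ) y, (∀ β, y β ∈ grading k Q n) → P y) → ∀ y, P y := by
    intro P h0 hadd hh y
    have : y = ∑ β, Pi.single β (y β) := (Finset.univ_sum_single y).symm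
    rw [this]
    refine Finset.sum_induction _ P hadd h0 fun β _ => ?_
    generalize y β = a
    induction a using homogeneous_induction (𝒜 := grading k Q) with
    | h0 => rwa [Pi.single_zero]
    | hadd a b ha hb => rw [Pi.single_add]; exact hadd _ _ ha hb
    | hh n a ha =>
      refine hh n _ fun γ => ?_
      by_cases hγ : γ = β
      · subst hγ; rwa [Pi.single_eq_same]
      · rw [Pi.single_eq_of_ne hγ]; exact Submodule.zero_mem _
  refine ⟨σ, ρ, hσ0, fun n a ha β => ?_, fun n y hy => ?_, fun n a ha => ?_, fun y β => ?_,
    fun x => ?_, fun y => ?_⟩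
  · rw [hσ n a ha]
    exact (t n ⟨a, ha⟩ β).2
  · rw [hρ n y hy]
    exact Subtype.prop _
  · simp only [hσ n a ha]
    rw [← koszulD₁_apply, h2]
  · revert y
    refine hind _ (by simp) (fun y z hy hz => ?_) (fun n y hy => ?_)
    · simp only [Pi.add_apply, add_mul, Finset.sum_add_distrib, map_add, hy, hz]
      abel
    · have hm : ∑ γ, y γ * codbl k Q γ ∈ grading k Q (n + 1) :=
        Submodule.sum_mem _ fun γ _ => SetLike.mul_mem_graded (hy γ) (codbl_mem k Q γ)
      have h := congrArg Subtype.val (congrFun (h3 n fun β => ⟨y β, hy β⟩) β)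
      rw [koszulProj_apply] at h
      refine h.trans ?_
      rw [hσ n _ hm, hρ n y hy, Pi.add_apply, Submodule.coe_add, koszulD₂_apply]
      congr 3
      exact congrFun (congrArg (t n) (Subtype.ext (koszulD₁_apply _ _ _ _))) β
  · induction x using homogeneous_induction (𝒜 := grading k Q) with
    | h0 => simp only [zero_mul]; exact map_zero ρ
    | hadd a b ha hb =>
      simp only [add_mul]
      exact (map_add ρ _ _).trans (by rw [ha, hb])
    | hh n a ha =>
      have ha' : a ∈ zgr (grading k Q) (((n + 1 : ℕ) : ℤ) - 1) := by
        rw [show ((n + 1 : ℕ) : ℤ) - 1 = n by push_cast; ring]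
        exact ha
      rw [hρ (n + 1) _ fun β => SetLike.mul_mem_graded ha (dbl_mem k Q β)]
      exact congrArg Subtype.val (h1 (n + 1) ⟨a, ha'⟩)
  · revert y
    refine hind _ (by simp only [Pi.zero_apply, zero_mul]; rfl) (fun y z hy hz => ?_)
      (fun n y hy => ?_)
    · simp only [Pi.add_apply, add_mul]
      exact (map_add ρ _ _).trans (by rw [hy, hz, map_add])
    · rw [hρ n y hy, hρ n _ fun β => mul_vert_mem _ (hy β)]
      exact congrArg Subtype.val (h5 n fun β => ⟨y β, hy β⟩)

/-- The linear involution of `⨁_β A` which exchanges the left and the right Koszul complex. -/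
def flipPi (k : Type*) [Field k] (Q : FinQuiver V E) :
    (E ⊕ E → Preproj k Q) →ₗ[k] (E ⊕ E → Preproj k Q) :=
  LinearMap.pi fun β => (sgn k β • flip k Q) ∘ₗ LinearMap.proj β

theorem flipPi_apply (y : E ⊕ E → Preproj k Q) (β : E ⊕ E) :
    flipPi k Q y β = sgn k β • flip k Q (y β) := rfl

theorem flipPi_flipPi (y : E ⊕ E → Preproj k Q) : flipPi k Q (flipPi k Q y) = y := by
  funext β
  rw [flipPi_apply, flipPi_apply, map_smul, smul_smul, sgn_mul_sgn, one_smul, flip_flip]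

theorem flip_codbl (β : E ⊕ E) : flip k Q (codbl k Q β) = sgn k β • dbl k Q β := by
  rw [codbl, map_smul, flip_dbl, Sum.swap_swap]

theorem flip_sum_dbl_mul (y : E ⊕ E → Preproj k Q) :
    flip k Q (∑ β, dbl k Q β * y β) = ∑ β, flipPi k Q y β * codbl k Q β := by
  rw [map_sum]
  refine Finset.sum_congr rfl fun β _ => ?_
  rw [flip_mul, flip_dbl, dbl_swap, flipPi_apply, smul_mul_assoc, mul_smul_comm]

theorem flipPi_codbl_mul (x : Preproj k Q) :
    flipPi k Q (fun β => codbl k Q β * x) = fun β => flip k Q x * dbl k Q β := by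
  funext β
  rw [flipPi_apply, flip_mul, flip_codbl, mul_smul_comm, smul_smul, sgn_mul_sgn, one_smul]

theorem flipPi_vert_mul (y : E ⊕ E → Preproj k Q) :
    flipPi k Q (fun β => vert k Q (Q.double.tgt β) * y β)
      = fun β => flipPi k Q y β * vert k Q (Q.double.tgt β) := by
  funext β
  rw [flipPi_apply, flip_mul, flip_vert, flipPi_apply, smul_mul_assoc]

theorem flip_mem_zgr {p : ℤ} {x : Preproj k Q} (hx : x ∈ zgr (grading k Q) p) :
    flip k Q x ∈ zgr (grading k Q) p := by
  cases p with
  | ofNat n => exact flip_mem k Q hx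
  | negSucc n =>
    have : x = 0 := hx
    rw [this, map_zero]
    exact Submodule.zero_mem _

theorem mul_vert_eq (i : V) {a : Preproj k Q} (ha : a ∈ grading k Q 0) :
    a * vert k Q i = aug k Q a i • vert k Q i := by
  conv_lhs => rw [eq_sum_aug k Q ha]
  simp [Finset.sum_mul, vert_mul_vert]

/-- The Koszul frame of a preprojective algebra without socle. -/
theorem exists_koszulFrame (hsoc : ∀ x : Preproj k Q, (∀ β, x * dbl k Q β = 0) → x = 0) :
    ∃ F : KoszulFrame (grading k Q) V (E ⊕ E), F.e = vert k Q ∧ F.b = dbl k Q ∧ F.b' = codbl k Q ∧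
      F.tgt = Q.double.tgt := by
  obtain ⟨σ, ρ, h0, h1, h2, h3, h4, h5, h6⟩ := exists_left_contraction hsoc
  -- The splitting of the left complex, applied to the flipped tuple and flipped back; the signs
  -- `sgn β` occur in pairs and cancel.
  have hsplit : ∀ (y : E ⊕ E → Preproj k Q) (β : E ⊕ E), vert k Q (Q.double.tgt β) * y β =
      (flipPi k Q ∘ₗ σ ∘ₗ flip k Q) (∑ γ, dbl k Q γ * y γ) β +
        codbl k Q β * (flip k Q ∘ₗ ρ ∘ₗ flipPi k Q) y := by
    intro y β
    have h := h4 (flipPi k Q y) β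
    have h' := congrArg (fun a => sgn k β • flip k Q a) h
    simp only [map_add, smul_add, flip_mul, flip_vert, flip_dbl] at h'
    rw [flipPi_apply, map_smul, flip_flip, mul_smul_comm, smul_smul, sgn_mul_sgn, one_smul,
      dbl_swap, smul_mul_assoc, smul_smul, sgn_mul_sgn, one_smul, ← flip_sum_dbl_mul] at h'
    exact h'
  have hmem : ∀ (n : ℕ) (y : E ⊕ E → Preproj k Q), (∀ β, y β ∈ grading k Q n) →
      (flip k Q ∘ₗ ρ ∘ₗ flipPi k Q) y ∈ zgr (grading k Q) ((n : ℤ) - 1) := fun n y hy =>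
    flip_mem_zgr (h2 n _ fun β => Submodule.smul_mem _ _ (flip_mem k Q (hy β)))
  refine ⟨{
    e := vert k Q
    b := dbl k Q
    b' := codbl k Q
    src := Q.double.src
    tgt := Q.double.tgt
    aug := fun v => LinearMap.proj v ∘ₗ (aug k Q).toLinearMap
    sec := flipPi k Q ∘ₗ σ ∘ₗ flip k Q
    ret := flip k Q ∘ₗ ρ ∘ₗ flipPi k Q
    e_mem := vert_mem k Q
    b_mem := dbl_mem k Q
    b'_mem := codbl_mem k Q
    sum_e := sum_vert k Q
    e_mul_e := vert_mul_vert k Q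
    e_mul := fun v a ha => vert_mul_eq v ha
    mul_e := fun v a ha => mul_vert_eq v ha
    e_mul_b := vert_mul_dbl k Q
    b_mul_e := dbl_vert k Q
    e_mul_b' := vert_codbl k Q
    b'_mul_e := codbl_mul_vert k Q
    sum_b_mul_b' := sum_dbl_codbl k Q
    sec_zero := fun a ha => by
      simp only [LinearMap.comp_apply, h0 _ (flip_mem k Q ha), map_zero]
    sec_mem := fun n a ha β =>
      Submodule.smul_mem _ _ (flip_mem k Q (h1 n _ (flip_mem k Q ha) β))
    ret_mem := hmem
    sum_b_sec := fun n a ha => by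
      rw [← flip_flip k Q (∑ β, _), flip_sum_dbl_mul]
      simp only [LinearMap.comp_apply, flipPi_flipPi]
      rw [h3 n _ (flip_mem k Q ha), flip_flip]
    split := hsplit
    ret_b' := fun x => by
      simp only [LinearMap.comp_apply]
      rw [flipPi_codbl_mul, h5, flip_flip]
    ret_e := fun y => by
      simp only [LinearMap.comp_apply]
      rw [flipPi_vert_mul, h6]
    -- The splitting identity for the basis vector at `β` with entry `e_{t(β)}`: its `ret` has
    -- degree `-1`, hence is zero.
    sec_b := fun β => by
      funext γ
      have hy : ∀ γ, (Pi.single β (vert k Q (Q.double.tgt β)) : E ⊕ E → Preproj k Q) γ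
          ∈ grading k Q 0 := fun γ => by
        by_cases hγ : γ = β
        · subst hγ; rw [Pi.single_eq_same]; exact vert_mem k Q _
        · rw [Pi.single_eq_of_ne hγ]; exact Submodule.zero_mem _
      have h := hsplit (Pi.single β (vert k Q (Q.double.tgt β))) γ
      have hr := hmem 0 _ hy
      rw [zgr_of_neg _ (by norm_num), Submodule.mem_bot] at hr
      have hs : ∑ γ, dbl k Q γ * (Pi.single β (vert k Q (Q.double.tgt β)) : E ⊕ E → Preproj k Q) γ
          = dbl k Q β := by
        rw [Finset.sum_eq_single β, Pi.single_eq_same, dbl_vert]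
        · intro γ _ hγ
          rw [Pi.single_eq_of_ne hγ, mul_zero]
        · simp
      rw [hr, mul_zero, add_zero, hs] at h
      rw [← h]
      by_cases hγ : γ = β
      · subst hγ; rw [Pi.single_eq_same, vert_idem]
      · rw [Pi.single_eq_of_ne hγ, mul_zero] }, rfl, rfl, rfl, rfl⟩

variable {F : KoszulFrame (grading k Q) V (E ⊕ E)}

theorem isRegular_zgr (he : F.e = vert k Q) (hb : F.b = dbl k Q) (hb' : F.b' = codbl k Q)
    (ht : F.tgt = Q.double.tgt)
    (hsoc : ∀ x : Preproj k Q, (∀ β, x * dbl k Q β = 0) → x = 0) :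
    F.IsRegular (zgr (grading k Q)) where
  action := gradedAction_zgr
  neg p hp := zgr_of_neg _ hp
  socle m hm := hsoc m fun β => by rw [← hb]; exact hm β
  exact p y hy hye h := by
    simp only [he, ht, hb', op_smul_eq_mul] at hye h
    obtain ⟨x, hx, h⟩ := exists_eq_mul_dbl_zgr k Q (p := p) rfl y hye h hy
    exact ⟨x, hx, fun β => by rw [hb]; exact h β⟩
  generated p hp m hm := by
    obtain ⟨y, hy, h⟩ := exists_sum_codbl_zgr k Q (p := p) rfl hp hm
    exact ⟨y, hy, by rw [hb']; exact h⟩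

theorem mem_eA_iff {i : V} {x : Preproj k Q} : x ∈ eA (vert k Q i) ↔ vert k Q i * x = x := by
  rw [eA, Submodule.mem_span_singleton]
  constructor
  · rintro ⟨a, rfl⟩
    rw [mul_smul_comm, vert_idem]
  · intro h
    exact ⟨op x, h⟩

/-- Left multiplication by `e_i` commutes with the Koszul maps, so the complex of `e_i A` is a
direct summand of that of `A`. -/
theorem isRegular_eAGr (he : F.e = vert k Q) (hb : F.b = dbl k Q) (hb' : F.b' = codbl k Q)
    (ht : F.tgt = Q.double.tgt)
    (hsoc : ∀ x : Preproj k Q, (∀ β, x * dbl k Q β = 0) → x = 0) (i : V) :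
    F.IsRegular (eAGr (grading k Q) (vert k Q i)) := by
  have hA := isRegular_zgr he hb hb' ht hsoc
  have hmem : ∀ x : Preproj k Q, vert k Q i * x ∈ eA (vert k Q i) := fun x =>
    mem_eA_iff.2 (by rw [← mul_assoc, vert_idem])
  have hdeg : ∀ (p : ℤ) (x : Preproj k Q), x ∈ zgr (grading k Q) p →
      vert k Q i * x ∈ zgr (grading k Q) p := fun p x hx => mul_zgr' _ (vert_mem k Q i) hx (by simp)
  refine ⟨fun n p a ha x hx => ?_, fun p hp => ?_, fun m hm => ?_, fun p y hy hye h => ?_,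
    fun p hp m hm => ?_⟩
  · exact hA.action n p a ha x.1 hx
  · rw [eq_bot_iff]
    intro x hx
    have h1 : (x : Preproj k Q) ∈ zgr (grading k Q) p := hx
    rw [hA.neg p hp] at h1
    exact Subtype.ext h1
  · exact Subtype.ext (hA.socle m.1 fun β => congrArg Subtype.val (hm β))
  · obtain ⟨x, hx, h1⟩ := hA.exact p (fun β => (y β : Preproj k Q)) hy
      (fun β => congrArg Subtype.val (hye β)) (by
        have := congrArg Subtype.val h
        rwa [Submodule.coe_sum] at this)
    refine ⟨⟨_, hmem x⟩, hdeg p x hx, fun β => Subtype.ext ?_⟩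
    have h2 := mem_eA_iff.1 (y β).2
    rw [h1, op_smul_eq_mul] at h2
    rw [h1, op_smul_eq_mul, ← h2, ← mul_assoc]
    rfl
  · obtain ⟨y, hy, h⟩ := hA.generated p hp m.1 hm
    refine ⟨fun β => ⟨_, hmem (y β)⟩, fun β => hdeg p _ (hy β), Subtype.ext ?_⟩
    rw [Submodule.coe_sum, ← mem_eA_iff.1 m.2, ← h, Finset.mul_sum]
    refine Finset.sum_congr rfl fun β _ => ?_
    simp only [op_smul_eq_mul, SetLike.val_smul, mul_assoc]

end Frame

end Preproj

namespace Preproj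

open GradedRight

theorem _root_.LinearMap.trace_conj_of_addCommMonoid {k X Y : Type*} [Field k] [AddCommMonoid X]
    [Module k X] [AddCommMonoid Y] [Module k Y] (f : X →ₗ[k] X) (e : X ≃ₗ[k] Y) :
    LinearMap.trace k Y (e.conj f) = LinearMap.trace k X f := by
  let _ : AddCommGroup X := Module.addCommMonoidToAddCommGroup k
  let _ : AddCommGroup Y := Module.addCommMonoidToAddCommGroup k
  exact LinearMap.trace_conj' f e

theorem _root_.LinearMap.trace_comp_comm_of_addCommMonoid {k X Y : Type*} [Field k]
    [AddCommMonoid X] [Module k X] [Module.Finite k X] [AddCommMonoid Y] [Module k Y]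
    [Module.Finite k Y] (f : X →ₗ[k] Y) (g : Y →ₗ[k] X) :
    LinearMap.trace k X (g ∘ₗ f) = LinearMap.trace k Y (f ∘ₗ g) := by
  let _ : AddCommGroup X := Module.addCommMonoidToAddCommGroup k
  let _ : AddCommGroup Y := Module.addCommMonoidToAddCommGroup k
  exact LinearMap.trace_comp_comm' f g

/-! ### Scaling of the preprojective relation -/

section Scalars

variable {k : Type*} [Field k] {V E : Type*} [Fintype V] [DecidableEq V] [Fintype E]
  [DecidableEq E] {Q : FinQuiver V E}

theorem vert_ne_zero (v : V) : vert k Q v ≠ 0 := by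
  intro h
  have h1 := congrFun (aug_vert k Q v) v
  rw [h, map_zero, Pi.single_eq_same] at h1
  exact zero_ne_one h1

/-- Otherwise the basis tuple at `β` with entry `e_{t(β)}` would be a syzygy of degree zero, and
exactness would give it a preimage in `A_{-1} = 0`. -/
theorem codbl_ne_zero (β : E ⊕ E) : codbl k Q β ≠ 0 := by
  intro h
  have hs : ∀ γ, (Pi.single β (vert k Q (Q.double.tgt β)) : E ⊕ E → Preproj k Q) γ =
      if γ = β then vert k Q (Q.double.tgt β) else 0 := fun γ => by rw [Pi.single_apply]
  obtain ⟨x, hx, h1⟩ := exists_eq_mul_dbl_zgr k Q (p := -1) (q := 0) (by norm_num)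
    (Pi.single β (vert k Q (Q.double.tgt β)))
    (fun γ => by
      rw [hs]
      split_ifs with hγ
      · rw [hγ, vert_idem]
      · rw [zero_mul])
    (by
      simp only [hs, ite_mul, zero_mul, Finset.sum_ite_eq', Finset.mem_univ, if_true]
      rw [vert_codbl, h])
    (fun γ => by
      rw [hs]
      split_ifs with hγ
      · exact vert_mem k Q _
      · exact Submodule.zero_mem _)
  rw [zgr_of_neg _ (by norm_num), Submodule.mem_bot] at hx
  have h2 := h1 β
  rw [hs, if_pos rfl, hx, zero_mul] at h2
  exact vert_ne_zero _ h2

theorem dbl_ne_zero (β : E ⊕ E) : dbl k Q β ≠ 0 := by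
  intro h
  apply codbl_ne_zero (k := k) (Q := Q) β.swap
  rw [codbl, Sum.swap_swap, h, smul_zero]

/-- Applying `g` to `e_v ∑ β β' = 0` gives a syzygy whose entry at an arrow `β` from `v` is `s_β
s_{β^*} β`. By exactness it is `(x β)_β` with `x ∈ A_0`, so each coefficient is the coordinate of
`x` at `v`. -/
theorem exists_scale_eq_src {g : GradedAut (grading k Q)} {s : E ⊕ E → k}
    (hv : ∀ v, g.toEquiv (vert k Q v) = vert k Q v)
    (hs : ∀ β, g.toEquiv (dbl k Q β) = s β • dbl k Q β) (v : V) :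
    ∃ q : k, ∀ β, Q.double.src β = v → s β * s β.swap = q := by
  have hrel : ∑ β, (if Q.double.src β = v then (s β * s β.swap) • dbl k Q β else 0) * codbl k Q β
      = 0 := by
    have h := congrArg (fun a => g.toEquiv (vert k Q v * a)) (sum_dbl_codbl k Q)
    simp only [mul_zero, map_zero, map_mul, map_sum, Finset.mul_sum] at h
    refine Eq.trans (Finset.sum_congr rfl fun β _ => ?_) h
    have hcod : g.toEquiv (codbl k Q β) = s β.swap • codbl k Q β := by
      rw [codbl, map_smul, hs, smul_comm]
    rw [hs, hcod, hv, smul_mul_smul_comm, mul_smul_comm, ← mul_assoc, vert_mul_dbl]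
    by_cases hβ : Q.double.src β = v
    · rw [if_pos hβ, if_pos hβ.symm, smul_mul_assoc]
    · rw [if_neg hβ, if_neg (Ne.symm hβ), zero_mul, smul_zero]
  obtain ⟨x, hx, h⟩ := exists_eq_mul_dbl_zgr k Q (p := 0) (q := 1) (by norm_num) _
    (fun β => by
      split_ifs
      · rw [smul_mul_assoc, dbl_vert]
      · rw [zero_mul]) hrel
    (fun β => by
      split_ifs
      · exact Submodule.smul_mem _ _ (dbl_mem k Q β)
      · exact Submodule.zero_mem _)
  refine ⟨aug k Q x v, fun β hβ => ?_⟩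
  subst hβ
  have h1 := h β
  rw [if_pos rfl, ← vert_dbl, ← mul_assoc, mul_vert_eq _ hx, smul_mul_assoc, vert_dbl] at h1
  exact smul_left_injective k (dbl_ne_zero β) h1

/-- An automorphism which scales the arrows of a connected quiver scales the relation. -/
theorem scalesArrows_of_connected {g : GradedAut (grading k Q)} {c t : E → k}
    (hv : ∀ v, g.toEquiv (vert k Q v) = vert k Q v)
    (hc : ∀ α, g.toEquiv (arrow k Q α) = c α • arrow k Q α)
    (ht : ∀ α, g.toEquiv (star k Q α) = t α • star k Q α)
    (hconn : ∀ f : V → k, (∀ α, f (Q.src α) = f (Q.tgt α)) → ∀ v w, f v = f w) (α₁ : E) :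
    ScalesArrows g (Sum.elim c t) (c α₁ * t α₁) := by
  have hs : ∀ β, g.toEquiv (dbl k Q β) = (Sum.elim c t : E ⊕ E → k) β • dbl k Q β := by
    rintro (α | α)
    · exact hc α
    · exact ht α
  choose f hf using exists_scale_eq_src hv hs
  have hf' : ∀ α, f (Q.src α) = f (Q.tgt α) := fun α => by
    have h1 : c α * t α = f (Q.src α) := hf _ (Sum.inl α) rfl
    have h2 : t α * c α = f (Q.tgt α) := hf _ (Sum.inr α) rfl
    rw [← h1, ← h2, mul_comm]
  refine ⟨hv, hs, fun β => ?_⟩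
  have h1 : c α₁ * t α₁ = f (Q.src α₁) := hf _ (Sum.inl α₁) rfl
  rw [hf _ β rfl, hconn f hf' _ (Q.src α₁), h1]

/-- The inverse of a graded automorphism. -/
def inv (g : GradedAut (grading k Q)) : GradedAut (grading k Q) :=
  ⟨g.toEquiv.symm, fun n a => by
    conv_rhs => rw [← g.toEquiv.apply_symm_apply a]
    exact (g.mem_iff n _).symm⟩

theorem ScalesArrows.ne_zero {g : GradedAut (grading k Q)} {s : E ⊕ E → k} {q : k}
    (hg : ScalesArrows g s q) (β : E ⊕ E) : s β ≠ 0 := by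
  intro h
  have h1 := hg.dbl β
  rw [h, zero_smul, map_eq_zero_iff _ g.toEquiv.injective] at h1
  exact dbl_ne_zero β h1

theorem ScalesArrows.inv {g : GradedAut (grading k Q)} {s : E ⊕ E → k} {q : k}
    (hg : ScalesArrows g s q) : ScalesArrows (inv g) (fun β => (s β)⁻¹) q⁻¹ where
  vert v := by
    change g.toEquiv.symm _ = _
    rw [AlgEquiv.symm_apply_eq, hg.vert]
  dbl β := by
    change g.toEquiv.symm _ = _
    rw [AlgEquiv.symm_apply_eq, map_smul, hg.dbl, inv_smul_smul₀ (hg.ne_zero β)]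
  mul β := by rw [← mul_inv, hg.mul]

end Scalars

/-! ### The action of `g` on residues -/

section Residues

variable {k : Type*} [Field k] {V E : Type*} [Fintype V] [DecidableEq V] [Fintype E]
  [DecidableEq E] {Q : FinQuiver V E} {F : KoszulFrame (grading k Q) V (E ⊕ E)}
  {M : Type*} [AddCommGroup M] [Module k M] [Module (Preproj k Q)ᵐᵒᵖ M]
  [IsScalarTower k (Preproj k Q)ᵐᵒᵖ M] {ℳ : ℤ → Submodule k M}
  {g : GradedAut (grading k Q)} {s : E ⊕ E → k} {q : k}

/-- `g⁻¹` scales `b_β` and `b'_β` by inverse factors with product `q⁻¹`, which is independent of `β`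
and leaves the sum. -/
theorem residue_conj (hb : F.b = dbl k Q) (hb' : F.b' = codbl k Q) (hg : ScalesArrows g s q)
    (f : TwistedEnd ℳ g) {z : Preproj k Q → (Fin 2 → Preproj k Q) → M} (hz : IsML k z)
    (x : Preproj k Q) :
    F.residue (conj f z) x = q⁻¹ • f.toMap (F.residue z (g.toEquiv.symm x)) := by
  simp only [KoszulFrame.residue, map_sum, Finset.smul_sum, hb, hb']
  refine Finset.sum_congr rfl fun β _ => ?_
  obtain ⟨Φ, hΦ⟩ := hz
  have h1 : (fun i => g.toEquiv.symm ((![dbl k Q β, codbl k Q β] : Fin 2 → Preproj k Q) i))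
      = fun i => (![(s β)⁻¹, (s β.swap)⁻¹] : Fin 2 → k) i •
        (![dbl k Q β, codbl k Q β] : Fin 2 → Preproj k Q) i := by
    funext i
    fin_cases i
    · exact hg.inv.dbl β
    · exact hg.inv.codbl β
  have hp : ∏ i, (![(s β)⁻¹, (s β.swap)⁻¹] : Fin 2 → k) i = q⁻¹ := by
    rw [Fin.prod_univ_two, ← hg.mul β, mul_inv]
    rfl
  rw [conj, h1, hΦ, hΦ, MultilinearMap.map_smul_univ, map_smul, hp]

theorem residueEquiv_onCohomology (hb : F.b = dbl k Q) (hb' : F.b' = codbl k Q)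
    (hg : ScalesArrows g s q) (hM : F.IsRegular ℳ) (f : TwistedEnd ℳ g) {n ℓ : ℤ}
    (hn : n + ℓ + 2 = 0)
    (Θ : LocalCohomology (grading k Q) ℳ 2 ℓ ≃ₗ[k] F.residueSpace ℳ n)
    (hΘ : ∀ (z : Preproj k Q → (Fin 2 → Preproj k Q) → M)
      (hz : z ∈ truncCocycles (grading k Q) ℳ (n + 1).toNat 2 ℓ) (x : zgr (grading k Q) n),
      (Θ (cls _ ℳ (n + 1).toNat 2 ℓ ⟨z, hz⟩) : zgr (grading k Q) n →ₗ[k] M) x = F.residue z x)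
    (X : LocalCohomology (grading k Q) ℳ 2 ℓ) (x : Preproj k Q) (hx : x ∈ zgr (grading k Q) n) :
    (Θ (f.onCohomology 2 ℓ X) : zgr (grading k Q) n →ₗ[k] M) ⟨x, hx⟩ =
      q⁻¹ • f.toMap ((Θ X : zgr (grading k Q) n →ₗ[k] M)
        ⟨g.toEquiv.symm x, g.symm_zgr_mem n x hx⟩) := by
  obtain ⟨⟨z, hz⟩, rfl⟩ := hM.exists_cls_eq_two hn X
  rw [onCohomology_cls, hΘ, hΘ, residue_conj hb hb' hg f hz.1.1.1]

end Residues

/-! ### The homological determinant -/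

section Determinant

variable {k : Type*} [Field k] {V E : Type*} [Fintype V] [DecidableEq V] [Fintype E]
  [DecidableEq E] {Q : FinQuiver V E} {F : KoszulFrame (grading k Q) V (E ⊕ E)}
  {g : GradedAut (grading k Q)} {s : E ⊕ E → k} {q : k}

variable (k Q) in
/-- The linear form `∑_v c_v e_v ↦ ∑_v c_v` on `A_0`, extended by zero. -/
def augSum : Preproj k Q →ₗ[k] k := ∑ v, LinearMap.proj v ∘ₗ (aug k Q).toLinearMap

theorem augSum_apply (a : Preproj k Q) : augSum k Q a = ∑ v, aug k Q a v := by
  simp [augSum]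

theorem augSum_vert (v : V) : augSum k Q (vert k Q v) = 1 := by
  rw [augSum_apply, aug_vert]
  simp

theorem residueSpace_apply_vert (he : F.e = vert k Q) {n : ℤ}
    (f : F.residueSpace (zgr (grading k Q)) n) (x : Preproj k Q) (hx : x ∈ zgr (grading k Q) n)
    (v : V) (hxv : x * vert k Q v ∈ zgr (grading k Q) n) :
    (f : zgr (grading k Q) n →ₗ[k] Preproj k Q) ⟨x * vert k Q v, hxv⟩
      = aug k Q ((f : zgr (grading k Q) n →ₗ[k] Preproj k Q) ⟨x, hx⟩) v • vert k Q v := by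
  have h := f.2.2 ⟨x, hx⟩ v (by rwa [he])
  simp only [he] at h
  rw [h, op_smul_eq_mul, mul_vert_eq _ (f.2.1 _)]

theorem mul_vert_mem_zgr {n : ℤ} {x : Preproj k Q} (hx : x ∈ zgr (grading k Q) n) (v : V) :
    x * vert k Q v ∈ zgr (grading k Q) n := zgr_mul _ (vert_mem k Q v) hx (by simp)

/-- Composition with the linear form `augSum` identifies the residues with the dual space. -/
theorem exists_residueSpace_equiv_dual (he : F.e = vert k Q) (n : ℤ) :
    ∃ Λ : F.residueSpace (zgr (grading k Q)) n ≃ₗ[k] Module.Dual k (zgr (grading k Q) n),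
      ∀ f x, Λ f x = augSum k Q ((f : zgr (grading k Q) n →ₗ[k] Preproj k Q) x) := by
  let Λ : F.residueSpace (zgr (grading k Q)) n →ₗ[k] Module.Dual k (zgr (grading k Q) n) :=
    LinearMap.compRight k (augSum k Q) ∘ₗ Submodule.subtype _
  have hΛ : ∀ f x, Λ f x = augSum k Q ((f : zgr (grading k Q) n →ₗ[k] Preproj k Q) x) :=
    fun _ _ => rfl
  refine ⟨LinearEquiv.ofBijective Λ ⟨?_, ?_⟩, fun f x => rfl⟩
  · rw [injective_iff_map_eq_zero]
    intro f hf
    refine Subtype.ext (LinearMap.ext fun x => ?_)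
    have h : ∀ v, aug k Q ((f : zgr (grading k Q) n →ₗ[k] Preproj k Q) x) v = 0 := fun v => by
      have h1 := LinearMap.congr_fun hf ⟨x * vert k Q v, mul_vert_mem_zgr x.2 v⟩
      rw [hΛ, residueSpace_apply_vert he f x x.2, map_smul, augSum_vert, smul_eq_mul, mul_one] at h1
      exact h1
    rw [eq_sum_aug k Q (f.2.1 x)]
    simp [h]
  · intro l
    let f : zgr (grading k Q) n →ₗ[k] Preproj k Q := ∑ v,
      LinearMap.toSpanSingleton k _ (vert k Q v) ∘ₗ l ∘ₗ
        (LinearMap.mulRight k (vert k Q v)).restrict fun x hx => mul_vert_mem_zgr hx v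
    have hf : ∀ x, f x = ∑ v, l ⟨x * vert k Q v, mul_vert_mem_zgr x.2 v⟩ • vert k Q v := by
      intro x
      rw [LinearMap.sum_apply]
      rfl
    have hmem : f ∈ F.residueSpace (zgr (grading k Q)) n := by
      refine ⟨fun x => ?_, fun x w h => ?_⟩
      · rw [hf]
        exact Submodule.sum_mem _ fun v _ => Submodule.smul_mem _ _ (vert_mem k Q v)
      · rw [hf, hf, op_smul_eq_mul, Finset.sum_mul]
        refine Finset.sum_congr rfl fun v _ => ?_
        simp only [he, smul_mul_assoc, vert_mul_vert]
        split_ifs with hv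
        · subst hv
          simp only [mul_assoc, vert_idem]
        · have : (⟨x * vert k Q w * vert k Q v,
              mul_vert_mem_zgr (mul_vert_mem_zgr x.2 w) v⟩ : zgr (grading k Q) n) = 0 := by
            apply Subtype.ext
            simp only [mul_assoc, vert_mul_vert, if_neg (Ne.symm hv), mul_zero]
            rfl
          rw [this, map_zero, zero_smul, smul_zero]
    refine ⟨⟨f, hmem⟩, LinearMap.ext fun x => ?_⟩
    rw [hΛ]
    change augSum k Q (f x) = _
    rw [hf, map_sum]
    simp only [map_smul, augSum_vert, smul_eq_mul, mul_one]
    rw [← map_sum]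
    congr 1
    apply Subtype.ext
    rw [Submodule.coe_sum]
    simp only
    rw [← Finset.mul_sum, sum_vert, mul_one]

theorem augSum_fix (hg : ScalesArrows g s q) {a : Preproj k Q} (ha : a ∈ grading k Q 0) :
    augSum k Q (g.toEquiv a) = augSum k Q a := by rw [hg.fix ha]

/-- The scalars of the homological determinant of an automorphism which scales the relation
by `q` are `q⁻¹`. -/
theorem hasHdetScalars (he : F.e = vert k Q) (hb : F.b = dbl k Q) (hb' : F.b' = codbl k Q)
    (hM : F.IsRegular (zgr (grading k Q))) (hg : ScalesArrows g s q) (u : kˣ)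
    (hu : (u : k) = q⁻¹) : HasHdetScalars (vert k Q) g 2 2 fun _ => u := by
  choose Θ hΘ using fun p : ℤ => hM.exists_residueEquiv (q := -(p + 2)) (ℓ := p) (by ring)
  choose Λ hΛ using fun p : ℤ => exists_residueSpace_equiv_dual he (-(p + 2))
  refine ⟨fun p => Θ p ≪≫ₗ Λ p, fun j a ha p X b hbm hab => ?_, fun v p X b hbm _ => ?_⟩
  · obtain ⟨⟨z, hz⟩, rfl⟩ := hM.exists_cls_eq_two (q := -(p + 2)) (by ring) X
    -- Translation by `a ∈ A_j` lowers the truncation by `j`, so the translate is already a cocycle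
    -- for the truncation attached to degree `p + j`, where its residues are read off.
    have hr : (-(p + 2) + 1).toNat ≤ j + (-(p + j + 2) + 1).toNat := by omega
    have hz' : translate z a ∈ truncCocycles (grading k Q) (zgr (grading k Q))
        (-(p + j + 2) + 1).toNat 2 (p + j) :=
      ⟨translate_mem (trunc_mono hr _ hz.1) ha, (translate_mem_cocycles ha hz).2⟩
    have hr' : (-(p + j + 2) + 1).toNat ≤ (-(p + 2) + 1).toNat := by omega
    rw [LinearEquiv.trans_apply, LinearEquiv.trans_apply, hΛ, hΛ, hΘ, act_cls ha hz,
      cls_mono hr' hz', hΘ]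
    rfl
  · rw [LinearEquiv.trans_apply, LinearEquiv.trans_apply, hΛ, hΛ,
      residueEquiv_onCohomology hb hb' hg hM g.regular (by ring) (Θ p) (hΘ p), map_smul, hu,
      smul_eq_mul]
    congr 1
    exact augSum_fix hg ((Θ p X).2.1 _)

/-- In degree `-2` the target is the dual of `A_0`, on which `g` is the identity, while `H²(g)` is
multiplication by `q⁻¹` on `H²(A)_{-2}` whatever `θ` is. The coordinate form at `v`, evaluated at
`e_v`, reads off `μ_v`. -/
theorem eq_of_hasHdetScalars (hb : F.b = dbl k Q) (hb' : F.b' = codbl k Q)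
    (hM : F.IsRegular (zgr (grading k Q))) (hg : ScalesArrows g s q) {μ : V → kˣ}
    (hμ : HasHdetScalars (vert k Q) g 2 2 μ) (v : V) : (μ v : k) = q⁻¹ := by
  obtain ⟨θ, -, h2⟩ := hμ
  obtain ⟨Θ, hΘ⟩ := hM.exists_residueEquiv (q := 0) (ℓ := -2) (by norm_num)
  let l : Module.Dual k (zgr (grading k Q) (-(-2 + 2))) :=
    (LinearMap.proj v ∘ₗ (aug k Q).toLinearMap) ∘ₗ Submodule.subtype _
  set X := (θ (-2)).symm l with hX
  have hH : g.regular.onCohomology 2 (-2) X = q⁻¹ • X := by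
    apply Θ.injective
    refine Subtype.ext (LinearMap.ext fun x => ?_)
    rw [residueEquiv_onCohomology hb hb' hg hM g.regular (by norm_num) Θ hΘ X x x.2, map_smul]
    have h1 : g.toEquiv.symm (x : Preproj k Q) = x := hg.inv.fix x.2
    have h3 : ∀ a ∈ grading k Q 0, g.regular.toMap a = a := fun a ha => hg.fix ha
    rw [h3 _ ((Θ X).2.1 _)]
    simp only [h1]
    rfl
  have hv : g.toEquiv.symm (vert k Q v) = vert k Q v := hg.inv.vert v
  have hvm : vert k Q v ∈ zgr (grading k Q) (-(-2 + 2)) := vert_mem k Q v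
  have h := h2 v (-2) X (vert k Q v) hvm (vert_idem k Q v)
  rw [hH, map_smul, LinearMap.smul_apply] at h
  simp only [hv, hX, LinearEquiv.apply_symm_apply] at h
  have hl : ∀ h, l ⟨vert k Q v, h⟩ = 1 := fun h => by
    change aug k Q (vert k Q v) v = 1
    rw [aug_vert, Pi.single_eq_same]
  rw [hl, smul_eq_mul, mul_one, mul_one] at h
  exact h.symm

theorem isHdet_iff (he : F.e = vert k Q) (hb : F.b = dbl k Q) (hb' : F.b' = codbl k Q)
    (hM : F.IsRegular (zgr (grading k Q))) (hg : ScalesArrows g s q) (hq : q ≠ 0)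
    (D : Matrix V V k) : IsHdet (vert k Q) g 2 2 D ↔ D = Matrix.diagonal fun _ => q := by
  constructor
  · rintro ⟨μ, hμ, rfl⟩
    congr 1
    funext v
    rw [eq_of_hasHdetScalars hb hb' hM hg hμ v, inv_inv]
  · rintro rfl
    refine ⟨fun _ => Units.mk0 q⁻¹ (inv_ne_zero hq), hasHdetScalars he hb hb' hM hg _ rfl, ?_⟩
    simp

theorem hdet_eq (he : F.e = vert k Q) (hb : F.b = dbl k Q) (hb' : F.b' = codbl k Q)
    (hM : F.IsRegular (zgr (grading k Q))) (hg : ScalesArrows g s q) (hq : q ≠ 0) :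
    Hdet (vert k Q) g 2 2 = Matrix.diagonal fun _ => q := by
  have h : ∃ D, IsHdet (vert k Q) g 2 2 D := ⟨_, (isHdet_iff he hb hb' hM hg hq _).2 rfl⟩
  rw [Hdet, dif_pos h]
  exact (isHdet_iff he hb hb' hM hg hq _).1 h.choose_spec

end Determinant

/-! ### Traces on `e_i A` and on its local cohomology -/

section Corner

variable {k : Type*} [Field k] {V E : Type*} [Fintype V] [DecidableEq V] [Fintype E]
  [DecidableEq E] {Q : FinQuiver V E} {F : KoszulFrame (grading k Q) V (E ⊕ E)}
  {g : GradedAut (grading k Q)} {s : E ⊕ E → k} {q : k}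

theorem sum_cornerMap_right (g : GradedAut (grading k Q)) (i : V) (n : ℤ)
    (x : zgr (grading k Q) n) :
    ((∑ v, cornerMap g i v n) x : Preproj k Q) = vert k Q i * g.toEquiv x := by
  rw [LinearMap.sum_apply, Submodule.coe_sum]
  simp only [cornerMap_apply]
  rw [← Finset.mul_sum, ← Finset.mul_sum, sum_vert, mul_one]

theorem sum_cornerMap_left (g : GradedAut (grading k Q)) (i : V) (n : ℤ)
    (x : zgr (grading k Q) n) :
    ((∑ v, cornerMap g v i n) x : Preproj k Q) = g.toEquiv x * vert k Q i := by
  rw [LinearMap.sum_apply, Submodule.coe_sum]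
  simp only [cornerMap_apply]
  rw [← Finset.sum_mul, sum_vert, one_mul]

/-- The inclusion `e A_n → A_n`. -/
def eAIncl (i : V) (n : ℤ) :
    eAGr (grading k Q) (vert k Q i) n →ₗ[k] zgr (grading k Q) n :=
  ((eA (vert k Q i)).subtype.restrictScalars k).restrict fun _ hx => hx

/-- The projection `A_n → e A_n`. -/
def eAProj (i : V) (n : ℤ) :
    zgr (grading k Q) n →ₗ[k] eAGr (grading k Q) (vert k Q i) n where
  toFun x := ⟨⟨vert k Q i * x, mem_eA_iff.2 (by rw [← mul_assoc, vert_idem])⟩,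
    mul_zgr' _ (vert_mem k Q i) x.2 (by simp)⟩
  map_add' x y := Subtype.ext (Subtype.ext (mul_add _ _ _))
  map_smul' c x := Subtype.ext (Subtype.ext (mul_smul_comm _ _ _))

theorem eAProj_eAIncl (i : V) (n : ℤ) (x : eAGr (grading k Q) (vert k Q i) n) :
    eAProj i n (eAIncl i n x) = x :=
  Subtype.ext (Subtype.ext (mem_eA_iff.1 x.1.2))

instance finite_eAGr (i : V) (n : ℤ) : Module.Finite k (eAGr (grading k Q) (vert k Q i) n) :=
  Module.Finite.of_surjective (eAProj i n) fun x => ⟨_, eAProj_eAIncl i n x⟩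

theorem trDefined_eAGr (i : V) : TrDefined (eAGr (grading k Q) (vert k Q i)) := by
  refine ⟨⟨-1, fun p hp => ?_⟩, fun p => finite_eAGr i p⟩
  rw [eq_bot_iff]
  intro x hx
  have h1 : (x : Preproj k Q) ∈ zgr (grading k Q) p := hx
  rw [zgr_of_neg _ (by omega)] at h1
  exact Subtype.ext h1

/-- `e_i A_n` is a retract of `A_n`, so the trace may be taken on `A_n`, where `e_i g` splits over
the right corners. -/
theorem trCoeff_onEA (hv : ∀ v, g.toEquiv (vert k Q v) = vert k Q v) (i : V) (n : ℤ) :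
    (g.onEA (vert k Q i) (hv i)).trCoeff n = ∑ v, cornerTrace g i v n := by
  set f := (g.onEA (vert k Q i) (hv i)).toMap.restrict
    ((g.onEA (vert k Q i) (hv i)).map_mem n) with hf
  have h1 : f = eAProj i n ∘ₗ (eAIncl i n ∘ₗ f) := LinearMap.ext fun x => (eAProj_eAIncl i n _).symm
  rw [TwistedEnd.trCoeff, ← hf, h1]
  refine (LinearMap.trace_comp_comm_of_addCommMonoid (eAIncl i n ∘ₗ f) (eAProj i n)).trans ?_
  simp only [cornerTrace]
  rw [← map_sum]
  congr 1
  refine LinearMap.ext fun x => Subtype.ext ?_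
  rw [sum_cornerMap_right]
  change g.toEquiv (vert k Q i * x) = _
  rw [map_mul, hv]

theorem vert_eA_mem (i : V) : vert k Q i ∈ eA (vert k Q i) := Submodule.mem_span_singleton_self _

/-- The linear form on `A_n` given by the residues of a class in `H²(e_i A)`. -/
def residueForm (F : KoszulFrame (grading k Q) V (E ⊕ E)) (i : V) (n : ℤ) :
    F.residueSpace (eAGr (grading k Q) (vert k Q i)) n →ₗ[k] Module.Dual k (zgr (grading k Q) n) :=
  LinearMap.compRight k (LinearMap.proj i ∘ₗ (aug k Q).toLinearMap ∘ₗ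
    (eA (vert k Q i)).subtype.restrictScalars k) ∘ₗ Submodule.subtype _

theorem residueForm_apply (i : V) (n : ℤ)
    (f : F.residueSpace (eAGr (grading k Q) (vert k Q i)) n) (x : zgr (grading k Q) n) :
    residueForm F i n f x = aug k Q ((f : zgr (grading k Q) n →ₗ[k] eA (vert k Q i)) x) i := rfl

theorem eq_aug_smul_vert {i : V} {m : eA (vert k Q i)}
    (hm : m ∈ eAGr (grading k Q) (vert k Q i) 0) :
    (m : Preproj k Q) = aug k Q m i • vert k Q i := by
  have h := vert_mul_eq (k := k) (Q := Q) i (a := (m : Preproj k Q)) hm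
  rwa [mem_eA_iff.1 m.2] at h

/-- The residues given by a linear form on `A_n`. -/
def ofForm (he : F.e = vert k Q) (i : V) (n : ℤ) :
    Module.Dual k (zgr (grading k Q) n) →ₗ[k]
      F.residueSpace (eAGr (grading k Q) (vert k Q i)) n where
  toFun l := ⟨LinearMap.toSpanSingleton k _ (⟨vert k Q i, vert_eA_mem i⟩ : eA (vert k Q i)) ∘ₗ l ∘ₗ
        (LinearMap.mulRight k (vert k Q i)).restrict fun x hx => mul_vert_mem_zgr hx i,
    fun x => Submodule.smul_mem _ _ (vert_mem k Q i), fun x v h => by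
      refine Subtype.ext ?_
      change l ⟨x * F.e v * vert k Q i, _⟩ • vert k Q i
        = (l ⟨x * vert k Q i, _⟩ • vert k Q i) * F.e v
      simp only [he, mul_assoc, smul_mul_assoc, vert_mul_vert]
      by_cases hv : v = i
      · subst hv
        simp only [if_true]
      · simp only [if_neg hv, if_neg (Ne.symm hv), mul_zero, smul_zero]
        exact smul_eq_zero_of_left (map_zero l) _⟩
  map_add' l l' := Subtype.ext (LinearMap.ext fun x => add_smul
    (l ⟨x * vert k Q i, mul_vert_mem_zgr x.2 i⟩) (l' ⟨x * vert k Q i, mul_vert_mem_zgr x.2 i⟩)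
    (⟨vert k Q i, vert_eA_mem i⟩ : eA (vert k Q i)))
  map_smul' c l := Subtype.ext (LinearMap.ext fun x => smul_assoc c
    (l ⟨x * vert k Q i, mul_vert_mem_zgr x.2 i⟩) (⟨vert k Q i, vert_eA_mem i⟩ : eA (vert k Q i)))

theorem ofForm_apply (he : F.e = vert k Q) (i : V) (n : ℤ)
    (l : Module.Dual k (zgr (grading k Q) n)) (x : zgr (grading k Q) n) :
    (((ofForm he i n l : zgr (grading k Q) n →ₗ[k] eA (vert k Q i)) x : eA (vert k Q i)) :
      Preproj k Q) = l ⟨x * vert k Q i, mul_vert_mem_zgr x.2 i⟩ • vert k Q i := rfl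

theorem ofForm_residueForm (he : F.e = vert k Q) (i : V) (n : ℤ)
    (f : F.residueSpace (eAGr (grading k Q) (vert k Q i)) n) :
    ofForm he i n (residueForm F i n f) = f := by
  refine Subtype.ext (LinearMap.ext fun x => Subtype.ext ?_)
  have h := f.2.2 x i (by rw [he]; exact mul_vert_mem_zgr x.2 i)
  simp only [he] at h
  rw [ofForm_apply, residueForm_apply, h]
  have h2 := eq_aug_smul_vert (f.2.1 x)
  conv_rhs => rw [h2]
  congr 2
  change aug k Q (((f : zgr (grading k Q) n →ₗ[k] eA (vert k Q i)) x : Preproj k Q) * vert k Q i) i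
    = _
  rw [mul_vert_eq (k := k) (Q := Q) i
    (a := (((f : zgr (grading k Q) n →ₗ[k] eA (vert k Q i)) x : eA (vert k Q i)) : Preproj k Q))
    (f.2.1 x), map_smul, aug_vert]
  simp

theorem finite_residueSpace (he : F.e = vert k Q) (i : V) (n : ℤ) :
    Module.Finite k (F.residueSpace (eAGr (grading k Q) (vert k Q i)) n) :=
  Module.Finite.of_surjective (ofForm he i n) fun f => ⟨_, ofForm_residueForm he i n f⟩

theorem brDefined_eAGr (he : F.e = vert k Q) {i : V}
    (hM : F.IsRegular (eAGr (grading k Q) (vert k Q i))) :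
    BrDefined (grading k Q) (eAGr (grading k Q) (vert k Q i)) := by
  -- For `p ≥ -1` the residues are maps out of a component of negative degree `-(p + 2)`.
  have hs : ∀ p ≥ (-1 : ℤ), Subsingleton
      (LocalCohomology (grading k Q) (eAGr (grading k Q) (vert k Q i)) 2 p) := by
    intro p hp
    obtain ⟨Θ, -⟩ := hM.exists_residueEquiv (q := -(p + 2)) (ℓ := p) (by ring)
    have : Subsingleton (zgr (grading k Q) (-(p + 2))) := by
      rw [zgr_of_neg _ (by omega)]
      infer_instance
    have : Subsingleton (F.residueSpace (eAGr (grading k Q) (vert k Q i)) (-(p + 2))) :=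
      ⟨fun f f' => Subtype.ext (LinearMap.ext fun x => by
        rw [Subsingleton.elim x 0, map_zero, map_zero])⟩
    exact Θ.toEquiv.subsingleton
  refine ⟨⟨3, fun n hn p => hM.subsingleton_localCohomology (by omega) p⟩, fun n => ?_⟩
  by_cases hn : n = 2
  · subst hn
    refine ⟨fun p => ?_, -1, hs⟩
    obtain ⟨Θ, -⟩ := hM.exists_residueEquiv (q := -(p + 2)) (ℓ := p) (by ring)
    have := finite_residueSpace he i (-(p + 2))
    exact Module.Finite.equiv Θ.symm
  · have h := hM.subsingleton_localCohomology hn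
    exact ⟨fun p => have := h p; inferInstance, 0, fun p _ => h p⟩

/-- Only `H²` contributes, with sign `+1`. Since `e_i A_0 = k e_i`, its residues are the linear
forms on `A_{-p-2} e_i`, and `H²(g)` acts on them as `q⁻¹` times the transpose of `g⁻¹`. -/
theorem brCoeff_onEA (he : F.e = vert k Q) (hb : F.b = dbl k Q) (hb' : F.b' = codbl k Q)
    (hv : ∀ v, g.toEquiv (vert k Q v) = vert k Q v) {i : V}
    (hM : F.IsRegular (eAGr (grading k Q) (vert k Q i))) (hg : ScalesArrows g s q) (p : ℤ) :
    (g.onEA (vert k Q i) (hv i)).brCoeff p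
      = q⁻¹ * ∑ v, cornerTrace (inv g) v i (-(p + 2)) := by
  rw [TwistedEnd.brCoeff, finsum_eq_single _ 2 fun n hn => by
    have := hM.subsingleton_localCohomology hn p
    rw [Subsingleton.elim ((g.onEA (vert k Q i) (hv i)).onCohomology n p) 0, map_zero, mul_zero]]
  obtain ⟨Θ, hΘ⟩ := hM.exists_residueEquiv (q := -(p + 2)) (ℓ := p) (by ring)
  set H := (g.onEA (vert k Q i) (hv i)).onCohomology 2 p with hH
  have := finite_residueSpace (F := F) he i (-(p + 2))
  rw [neg_one_sq, one_mul, ← LinearMap.trace_conj_of_addCommMonoid H Θ]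
  have h1 : Θ.conj H = ofForm he i (-(p + 2)) ∘ₗ (residueForm F i (-(p + 2)) ∘ₗ Θ.conj H) :=
    LinearMap.ext fun x => (ofForm_residueForm he i _ _).symm
  have h2 : (residueForm F i (-(p + 2)) ∘ₗ Θ.conj H) ∘ₗ ofForm he i (-(p + 2))
      = q⁻¹ • Module.Dual.transpose (R := k) (∑ v, cornerMap (inv g) v i (-(p + 2))) := by
    refine LinearMap.ext fun l => LinearMap.ext fun x => ?_
    change residueForm F i (-(p + 2)) (Θ (H (Θ.symm (ofForm he i (-(p + 2)) l)))) x = _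
    rw [residueForm_apply, residueEquiv_onCohomology hb hb' hg hM (g.onEA (vert k Q i) (hv i))
      (by ring) Θ hΘ _ x x.2, LinearEquiv.apply_symm_apply]
    change aug k Q (q⁻¹ • g.toEquiv (l ⟨g.toEquiv.symm x * vert k Q i, _⟩ • vert k Q i)) i = _
    rw [map_smul g.toEquiv, hv, map_smul, map_smul, aug_vert]
    have h3 : (∑ v, cornerMap (inv g) v i (-(p + 2))) x
        = ⟨g.toEquiv.symm x * vert k Q i, mul_vert_mem_zgr (g.symm_zgr_mem _ _ x.2) i⟩ :=
      Subtype.ext (sum_cornerMap_left (inv g) i _ x)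
    rw [LinearMap.smul_apply, LinearMap.smul_apply, Module.Dual.transpose_apply,
      LinearMap.comp_apply, h3]
    simp
  rw [h1, LinearMap.trace_comp_comm_of_addCommMonoid (residueForm F i (-(p + 2)) ∘ₗ Θ.conj H), h2, map_smul, LinearMap.trace_transpose', map_sum,
    smul_eq_mul]
  rfl

end Corner

end Preproj

namespace GradedRight

/-! ### Rational functions and the substitution of the inverse variable -/

section Expansion

variable {k : Type*} [Field k]

variable (k) in
/-- The substitution `t ↦ t⁻¹` on rational functions. -/
def ratInv : RatFunc k →+* RatFunc k :=
  RatFunc.liftRingHom (Polynomial.eval₂RingHom RatFunc.C (RatFunc.X)⁻¹) (by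
    intro p hp
    rw [Submonoid.mem_comap, mem_nonZeroDivisors_iff_ne_zero]
    intro h
    have ht : Transcendental k ((RatFunc.X : RatFunc k)⁻¹) := fun h =>
      RatFunc.transcendental_X (K := k) (IsAlgebraic.inv_iff.1 h)
    refine nonZeroDivisors.ne_zero hp ((transcendental_iff.1 ht) p ?_)
    rw [Polynomial.aeval_def]
    exact h)

/-- Evaluation at `X⁻¹` agrees with a ring homomorphism, so it can be applied entrywise to matrix
identities. -/
theorem ratInv_apply (R : RatFunc k) : ratInv k R = RatFunc.eval RatFunc.C (RatFunc.X)⁻¹ R := by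
  conv_lhs => rw [← RatFunc.num_div_denom R]
  rw [map_div₀, RatFunc.eval]
  simp only [ratInv, RatFunc.liftRingHom_algebraMap]
  rfl

theorem ratInv_C (a : k) : ratInv k (RatFunc.C a) = RatFunc.C a := by
  rw [ratInv_apply, RatFunc.eval_C]

theorem ratInv_X : ratInv k RatFunc.X = (RatFunc.X)⁻¹ := by
  rw [ratInv_apply, RatFunc.eval_X]

open scoped RatFunc in
variable (k) in
/-- The expansion of rational functions at zero. -/
def ratExpand : RatFunc k →+* LaurentSeries k := algebraMap (RatFunc k) (LaurentSeries k)

theorem ratExpand_apply (R : RatFunc k) : ratExpand k R = (R : LaurentSeries k) := rfl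

theorem ratExpand_X : ratExpand k RatFunc.X = HahnSeries.single 1 1 := RatFunc.coe_X

theorem ratExpand_C (a : k) : ratExpand k (RatFunc.C a) = HahnSeries.single 0 a := by
  have h := RatFunc.coe_coe (Polynomial.C a)
  rw [Polynomial.coe_C, PowerSeries.coe_C, RatFunc.coePolynomial, RatFunc.algebraMap_C] at h
  exact h.symm

variable {V : Type*} [Fintype V] [DecidableEq V]

/-- The matrix `1 - x C + q x²`. -/
def quadMatrix (C : Matrix V V k) (q : k) (x : RatFunc k) : Matrix V V (RatFunc k) :=
  fun i j => (if i = j then 1 else 0) - x * RatFunc.C (C i j)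
    + (if i = j then RatFunc.C q * x ^ 2 else 0)

theorem quadMatrix_map_ratInv (C : Matrix V V k) (q : k) :
    (quadMatrix C q RatFunc.X).map (ratInv k) = quadMatrix C q (RatFunc.X)⁻¹ := by
  ext i j
  simp only [Matrix.map_apply, quadMatrix]
  split_ifs <;> simp [ratInv_C, ratInv_X]

/-- `1 - C t⁻¹ + q t⁻² = q t⁻² (1 - q⁻¹ C t + q⁻¹ t²)`, and `q⁻¹ C` is the transpose of `C'`. -/
theorem quadMatrix_inv {C C' : Matrix V V k} {q : k} (hq : q ≠ 0)
    (hC : ∀ i j, C' j i = q⁻¹ * C i j) :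
    quadMatrix C q (RatFunc.X)⁻¹ =
      (RatFunc.C q * (RatFunc.X)⁻¹ ^ 2) • (quadMatrix C' q⁻¹ RatFunc.X).transpose := by
  have hX : (RatFunc.X : RatFunc k) ≠ 0 := RatFunc.X_ne_zero
  have hq' : (RatFunc.C q : RatFunc k) ≠ 0 := by simpa using hq
  ext i j
  simp only [Matrix.smul_apply, Matrix.transpose_apply, quadMatrix, hC, smul_eq_mul, map_mul,
    map_inv₀, eq_comm (a := j)]
  split_ifs <;> field_simp <;> ring

/-- The matrix of Laurent series with the coefficients `P n`. -/
def seriesMatrix (P : ℕ → Matrix V V k) : Matrix V V (LaurentSeries k) :=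
  fun i j => ((PowerSeries.mk fun n => P n i j : PowerSeries k) : LaurentSeries k)

theorem coeff_seriesMatrix {P : ℤ → Matrix V V k} (hP : ∀ n < 0, P n = 0) (i j : V) (n : ℤ) :
    (seriesMatrix (fun n : ℕ => P n) i j).coeff n = P n i j := by
  rw [seriesMatrix, PowerSeries.coeff_coe]
  split_ifs with h
  · rw [hP n h]; rfl
  · rw [PowerSeries.coeff_mk, Int.natAbs_of_nonneg (not_lt.1 h)]

/-- The coefficient of `tⁿ` in the product is `P_n - P_{n-1} C + q P_{n-2}`. For `n ≠ 0` it vanishes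
by the recursion at `n - 1`; the exceptional index `-1` corresponds to `n = 0`, where `P_0 = 1`
remains. -/
theorem seriesMatrix_mul {C : Matrix V V k} {q : k} {P : ℤ → Matrix V V k}
    (hP : ∀ n < 0, P n = 0) (hP0 : P 0 = 1)
    (hrec : ∀ n, n ≠ -1 → P (n + 1) + q • P (n - 1) = P n * C) :
    seriesMatrix (fun n : ℕ => P n) *
      (quadMatrix C q RatFunc.X).map (ratExpand k) = 1 := by
  have hs := coeff_seriesMatrix hP
  refine Matrix.ext fun i j => ?_
  have hN : ∀ w : V, (quadMatrix C q RatFunc.X).map (ratExpand k) w j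
      = (if w = j then 1 else 0) - HahnSeries.single 1 (C w j)
        + (if w = j then HahnSeries.single 2 q else 0) := by
    intro w
    simp only [Matrix.map_apply, quadMatrix]
    split_ifs <;>
      simp [ratExpand_X, ratExpand_C, HahnSeries.single_mul_single, pow_two]
  rw [Matrix.mul_apply]
  simp only [hN, mul_add, mul_sub, mul_ite, mul_one, mul_zero, Finset.sum_add_distrib,
    Finset.sum_sub_distrib, Finset.sum_ite_eq', Finset.mem_univ, if_true]
  ext n
  have hr : P n i j + q * P (n - 2) i j - ∑ w, P (n - 1) i w * C w j
      = if n = 0 then (1 : Matrix V V k) i j else 0 := by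
    by_cases hn : n = 0
    · subst hn
      rw [hP (0 - 2) (by norm_num), hP (0 - 1) (by norm_num), hP0]
      simp
    · have := congrFun (congrFun (hrec (n - 1) (by omega)) i) j
      rw [Matrix.mul_apply] at this
      rw [if_neg hn, ← this, sub_add_cancel, show n - 1 - 1 = n - 2 by ring]
      simp
  simp only [HahnSeries.coeff_add, HahnSeries.coeff_sub, HahnSeries.coeff_sum, hs, mul_comm _ (HahnSeries.single (_ : ℤ) _),
    HahnSeries.coeff_single_mul]
  have h1 : ((1 : Matrix V V (LaurentSeries k)) i j).coeff n
      = if n = 0 then (1 : Matrix V V k) i j else 0 := by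
    by_cases hij : i = j
    · subst hij
      rw [Matrix.one_apply_eq, Matrix.one_apply_eq, HahnSeries.coeff_one]
      by_cases hn : n = 0 <;> simp [hn]
    · rw [Matrix.one_apply_ne hij, Matrix.one_apply_ne hij]
      simp
  rw [h1, ← hr]
  simp only [mul_comm (C _ j)]
  ring

/-- Both series are inverses of quadratic matrices, and `t ↦ t⁻¹` exchanges these matrices up to
transposition and the factor `q t⁻²`. Inverting gives the functional equation `P(t⁻¹) = q⁻¹ t²
P'(t)ᵀ`. -/
theorem exists_rational_resolvent {C C' : Matrix V V k} {q : k} (hq : q ≠ 0)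
    (hC : ∀ i j, C' j i = q⁻¹ * C i j) {P P' : ℤ → Matrix V V k}
    (hP : ∀ n < 0, P n = 0) (hP0 : P 0 = 1)
    (hrec : ∀ n, n ≠ -1 → P (n + 1) + q • P (n - 1) = P n * C)
    (hP' : ∀ n < 0, P' n = 0) (hP0' : P' 0 = 1)
    (hrec' : ∀ n, n ≠ -1 → P' (n + 1) + q⁻¹ • P' (n - 1) = P' n * C') :
    ∃ R : Matrix V V (RatFunc k), (∀ i j n, (R i j : LaurentSeries k).coeff n = P n i j) ∧
      ∀ i j n, (ratInv k (R i j) : LaurentSeries k).coeff n = q⁻¹ * P' (n - 2) j i := by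
  have key : ∀ (C : Matrix V V k) (q : k) (P : ℤ → Matrix V V k), (∀ n < 0, P n = 0) → P 0 = 1 →
      (∀ n, n ≠ -1 → P (n + 1) + q • P (n - 1) = P n * C) →
      ∃ R : Matrix V V (RatFunc k), R * quadMatrix C q RatFunc.X = 1 ∧
        ∀ i j n, (R i j : LaurentSeries k).coeff n = P n i j := by
    intro C q P hP hP0 hrec
    have h := seriesMatrix_mul hP hP0 hrec
    set f := ratExpand k
    have hdet : (quadMatrix C q RatFunc.X).det ≠ 0 := by
      intro h0
      have h1 := congrArg Matrix.det h
      rw [Matrix.det_mul, ← RingHom.mapMatrix_apply, ← RingHom.map_det, h0, map_zero, mul_zero,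
        Matrix.det_one] at h1
      exact zero_ne_one h1
    have hR := Matrix.nonsing_inv_mul _ (isUnit_iff_ne_zero.2 hdet)
    refine ⟨_, hR, fun i j n => ?_⟩
    have hRf := congrArg (RingHom.mapMatrix f) hR
    rw [map_mul, map_one] at hRf
    have hS : f.mapMatrix (quadMatrix C q RatFunc.X)⁻¹ = seriesMatrix (fun n : ℕ => P n) := by
      have h' := mul_eq_one_comm.1 h
      calc _ = f.mapMatrix (quadMatrix C q RatFunc.X)⁻¹ *
            ((quadMatrix C q RatFunc.X).map f * seriesMatrix (fun n : ℕ => P n)) := by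
              rw [h', mul_one]
        _ = _ := by rw [← mul_assoc, ← RingHom.mapMatrix_apply, hRf, one_mul]
    rw [← coeff_seriesMatrix hP, ← hS]
    rfl
  obtain ⟨R, hR, hRP⟩ := key C q P hP hP0 hrec
  obtain ⟨R', hR', hRP'⟩ := key C' q⁻¹ P' hP' hP0' hrec'
  refine ⟨R, hRP, fun i j n => ?_⟩
  have hX : (RatFunc.X : RatFunc k) ≠ 0 := RatFunc.X_ne_zero
  have hq' : (RatFunc.C q : RatFunc k) ≠ 0 := by simpa using hq
  have h1 := congrArg (RingHom.mapMatrix (ratInv k)) hR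
  rw [map_mul, map_one, RingHom.mapMatrix_apply (M := quadMatrix C q RatFunc.X),
    quadMatrix_map_ratInv, quadMatrix_inv hq hC, Matrix.mul_smul] at h1
  have h2 : (quadMatrix C' q⁻¹ RatFunc.X).transpose * R'.transpose = 1 := by
    rw [← Matrix.transpose_mul, hR', Matrix.transpose_one]
  have h3 : (ratInv k).mapMatrix R = (RatFunc.C q⁻¹ * RatFunc.X ^ 2) • R'.transpose := by
    calc (ratInv k).mapMatrix R
        = (RatFunc.C q⁻¹ * RatFunc.X ^ 2) • (((RatFunc.C q * (RatFunc.X)⁻¹ ^ 2) •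
          ((ratInv k).mapMatrix R * (quadMatrix C' q⁻¹ RatFunc.X).transpose)) *
            R'.transpose) := by
          rw [Matrix.smul_mul, Matrix.mul_assoc, h2, mul_one, smul_smul]
          have : RatFunc.C q⁻¹ * RatFunc.X ^ 2 * (RatFunc.C q * (RatFunc.X : RatFunc k)⁻¹ ^ 2)
              = 1 := by
            rw [map_inv₀]; field_simp
          rw [this, one_smul]
      _ = _ := by rw [h1, one_mul]
  have h4 : ratInv k (R i j) = RatFunc.C q⁻¹ * RatFunc.X ^ 2 * R' j i :=
    congrFun (congrFun h3 i) j
  have h5 : ((RatFunc.C q⁻¹ * RatFunc.X ^ 2 * R' j i : RatFunc k) : LaurentSeries k)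
      = HahnSeries.single 2 q⁻¹ * (R' j i : LaurentSeries k) := by
    rw [← ratExpand_apply, map_mul, map_mul, map_pow, ratExpand_X, ratExpand_C, pow_two, HahnSeries.single_mul_single,
      HahnSeries.single_mul_single]
    simp only [mul_one]
    rfl
  rw [h4, h5, HahnSeries.coeff_single_mul, hRP']

end Expansion

end GradedRight

/-! ### Rationality of the trace series -/

namespace Preproj

open GradedRight

variable {k : Type*} [Field k] {V E : Type*} [Fintype V] [DecidableEq V] [Fintype E]
  [DecidableEq E] {Q : FinQuiver V E} {g : GradedAut (grading k Q)} {s : E ⊕ E → k} {q : k}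

variable (Q) in
/-- The matrix with entries `∑ s_{β^*}` over the arrows `β` from `v` to `w`. -/
def adjScale (s : E ⊕ E → k) : Matrix V V k :=
  fun w v => ∑ β, if Q.double.src β = v ∧ Q.double.tgt β = w then s β.swap else 0

/-- Reversing arrows exchanges source and target, and `(s_{β^*})⁻¹ = q⁻¹ s_β`. -/
theorem adjScale_inv (hg : ScalesArrows g s q) (v w : V) :
    adjScale Q (fun β => (s β)⁻¹) w v = q⁻¹ * adjScale Q s v w := by
  rw [adjScale, adjScale, Finset.mul_sum]
  refine Fintype.sum_equiv (Equiv.sumComm E E) _ _ fun β => ?_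
  have h1 : Q.double.src (Equiv.sumComm E E β) = Q.double.tgt β := Q.double_src_swap β
  have h2 : Q.double.tgt (Equiv.sumComm E E β) = Q.double.src β := Q.double_tgt_swap β
  have h3 : (Equiv.sumComm E E β) = β.swap := rfl
  rw [h1, h2, h3, Sum.swap_swap]
  by_cases h : Q.double.src β = v ∧ Q.double.tgt β = w
  · rw [if_pos h, if_pos h.symm, ← hg.mul β, mul_inv, mul_comm (s β)⁻¹, mul_assoc,
      inv_mul_cancel₀ (hg.ne_zero β), mul_one]
  · rw [if_neg h, if_neg fun h' => h h'.symm, mul_zero]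

theorem cornerTrace_recursion_matrix (hg : ScalesArrows g s q)
    (hsoc : ∀ x : Preproj k Q, (∀ β, x * dbl k Q β = 0) → x = 0) (n : ℤ) (hn : n ≠ -1) :
    (Matrix.of fun i v => cornerTrace g i v (n + 1)) +
      q • (Matrix.of fun i v => cornerTrace g i v (n - 1)) =
      (Matrix.of fun i v => cornerTrace g i v n) * adjScale Q s := by
  ext i v
  rw [Matrix.mul_apply]
  simp only [Matrix.add_apply, Matrix.smul_apply, Matrix.of_apply, smul_eq_mul]
  rw [cornerTrace_recursion hg n hn (fun x _ => hsoc x)]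
  simp only [adjScale, Finset.mul_sum]
  rw [Finset.sum_comm]
  refine Finset.sum_congr rfl fun β _ => ?_
  by_cases h : Q.double.src β = v
  · simp [h, mul_comm]
  · simp [h]

theorem exists_rational_cornerTrace (hg : ScalesArrows g s q) (hq : q ≠ 0)
    (hsoc : ∀ x : Preproj k Q, (∀ β, x * dbl k Q β = 0) → x = 0) :
    ∃ R : Matrix V V (RatFunc k),
      (∀ i j n, (R i j : LaurentSeries k).coeff n = cornerTrace g i j n) ∧
      ∀ i j n, (ratInv k (R i j) : LaurentSeries k).coeff n
        = q⁻¹ * cornerTrace (inv g) j i (n - 2) :=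
  exists_rational_resolvent (C := adjScale Q s) (C' := adjScale Q fun β => (s β)⁻¹) hq
    (fun i j => adjScale_inv hg i j)
    (P := fun n => Matrix.of fun i v => cornerTrace g i v n)
    (P' := fun n => Matrix.of fun i v => cornerTrace (inv g) i v n)
    (fun n hn => by ext i j; exact cornerTrace_of_neg g i j hn)
    (by ext i j; exact cornerTrace_zero hg i j)
    (cornerTrace_recursion_matrix hg hsoc)
    (fun n hn => by ext i j; exact cornerTrace_of_neg (inv g) i j hn)
    (by ext i j; exact cornerTrace_zero hg.inv i j)
    (cornerTrace_recursion_matrix hg.inv hsoc)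

/-- The coefficients of `Br` found from residues are those which the functional equation gives for
the expansion at infinity of the trace series, so one rational function serves for both. -/
theorem exists_rational_eA {F : KoszulFrame (grading k Q) V (E ⊕ E)}
    (he : F.e = vert k Q) (hb : F.b = dbl k Q) (hb' : F.b' = codbl k Q)
    (hv : ∀ v, g.toEquiv (vert k Q v) = vert k Q v) {i : V}
    (hM : F.IsRegular (eAGr (grading k Q) (vert k Q i))) (hg : ScalesArrows g s q) (hq : q ≠ 0)
    (hsoc : ∀ x : Preproj k Q, (∀ β, x * dbl k Q β = 0) → x = 0) :
    ∃ R : RatFunc k, IsExpansionAtZero R (g.onEA (vert k Q i) (hv i)).trCoeff ∧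
      IsExpansionAtInfty R (g.onEA (vert k Q i) (hv i)).brCoeff := by
  obtain ⟨R, h1, h2⟩ := exists_rational_cornerTrace hg hq hsoc
  have hsum : ∀ f : V → RatFunc k, ((∑ v, f v : RatFunc k) : LaurentSeries k)
      = ∑ v, (f v : LaurentSeries k) := fun f => map_sum (ratExpand k) f _
  refine ⟨∑ v, R i v, fun j => ?_, fun j => ?_⟩
  · rw [trCoeff_onEA hv, hsum, HahnSeries.coeff_sum]
    exact Finset.sum_congr rfl fun v _ => h1 i v j
  · rw [brCoeff_onEA he hb hb' hv hM hg, ← ratInv_apply, map_sum, hsum, HahnSeries.coeff_sum,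
      Finset.mul_sum]
    refine Finset.sum_congr rfl fun v _ => ?_
    rw [h2, show -(-j + 2) = j - 2 by ring]

end Preproj

/-! ### Extended Dynkin graphs: additive functions and connectedness -/

namespace FinQuiver

variable {V E : Type*} [Fintype V] [DecidableEq V] [Fintype E] {Q : FinQuiver V E}

theorem sum_double_of_shape {n : ℕ} {L : List (ℕ × ℕ)} (d : ℕ → ℕ) (v : V ≃ Fin n)
    (e : E ≃ Fin L.length)
    (h : ∀ α : E, s((v (Q.src α) : ℕ), (v (Q.tgt α) : ℕ)) = s((L.get (e α)).1, (L.get (e α)).2))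
    (x : V) :
    ∑ β, (if Q.double.src β = x then d (v (Q.double.tgt β)) else 0) =
      (L.map fun p : ℕ × ℕ => (if p.1 = v x then d p.2 else 0) +
        if p.2 = v x then d p.1 else 0).sum := by
  have hx : ∀ y : V, y = x ↔ (v y : ℕ) = v x := fun y => by
    rw [← Fin.ext_iff, v.apply_eq_iff_eq]
  rw [Fintype.sum_sum_type, ← Finset.sum_add_distrib]
  simp only [double, Sum.elim_inl, Sum.elim_inr, hx]
  have h2 : ∀ α : E, ((if (v (Q.src α) : ℕ) = v x then d (v (Q.tgt α)) else 0) +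
      if (v (Q.tgt α) : ℕ) = v x then d (v (Q.src α)) else 0) =
      (fun p : ℕ × ℕ => (if p.1 = v x then d p.2 else 0) + if p.2 = v x then d p.1 else 0)
        (L.get (e α)) := by
    intro α
    rcases Sym2.eq_iff.1 (h α) with ⟨h1, h2⟩ | ⟨h1, h2⟩
    · rw [h1, h2]
    · rw [h1, h2, add_comm]
  rw [Finset.sum_congr rfl fun α _ => h2 α]
  rw [e.sum_comp (fun i => (fun p : ℕ × ℕ => (if p.1 = v x then d p.2 else 0) +
    if p.2 = v x then d p.1 else 0) (L.get i)), ← List.sum_ofFn]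
  congr 1
  apply List.ext_getElem <;> simp

/-- The quiver is connected and has a positive vector in the radical of its Tits form. -/
def IsAffine (Q : FinQuiver V E) : Prop :=
  (∃ δ : V → ℕ, (∀ v, 0 < δ v) ∧
    ∀ v, ∑ β, (if Q.double.src β = v then δ (Q.double.tgt β) else 0) = 2 * δ v) ∧
  ∀ S : V → Prop, (∀ α, S (Q.src α) ↔ S (Q.tgt α)) → ∀ v w, S v → S w

theorem HasShape.isAffine {n : ℕ} {L : List (ℕ × ℕ)} (hL : Q.HasShape n L) (d : ℕ → ℕ)
    (hd : ∀ x < n, 0 < d x)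
    (hsum : ∀ x < n, (L.map fun p : ℕ × ℕ => (if p.1 = x then d p.2 else 0) +
      if p.2 = x then d p.1 else 0).sum = 2 * d x)
    (hconn : ∀ S : ℕ → Prop, (∀ p ∈ L, S p.1 ↔ S p.2) → ∀ x < n, (S x ↔ S 0)) :
    Q.IsAffine := by
  obtain ⟨v, e, h⟩ := hL
  refine ⟨⟨fun x => d (v x), fun x => hd _ (v x).2, fun x => ?_⟩, fun S hS => ?_⟩
  · rw [sum_double_of_shape d v e h x, hsum _ (v x).2]
  · let T : ℕ → Prop := fun x => ∃ y, (v y : ℕ) = x ∧ S y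
    have hT : ∀ y, T (v y) ↔ S y := fun y =>
      ⟨fun ⟨z, hz, hSz⟩ => v.injective (Fin.ext hz) ▸ hSz, fun hy => ⟨y, rfl, hy⟩⟩
    have hadj : ∀ p ∈ L, T p.1 ↔ T p.2 := by
      intro p hp
      obtain ⟨i, rfl⟩ := List.get_of_mem hp
      have h1 := h (e.symm i)
      rw [Equiv.apply_symm_apply] at h1
      have h2 := hS (e.symm i)
      rw [← hT, ← hT] at h2
      rcases Sym2.eq_iff.1 h1 with ⟨h3, h4⟩ | ⟨h3, h4⟩
      · rwa [h3, h4] at h2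
      · rw [h3, h4] at h2
        exact h2.symm
    intro x y hx
    rw [← hT, hconn T hadj _ (v _).2] at hx ⊢
    exact hx

/-- `r` is the parent function of a spanning tree rooted at `0`, each parent having a smaller index
than its child. -/
theorem connected_of_parent {n : ℕ} {L : List (ℕ × ℕ)} (r : ℕ → ℕ)
    (hr : ∀ x < n, x ≠ 0 → r x < x ∧ (r x, x) ∈ L) (S : ℕ → Prop)
    (hS : ∀ p ∈ L, S p.1 ↔ S p.2) : ∀ x < n, (S x ↔ S 0) := by
  intro x
  induction x using Nat.strong_induction_on with
  | _ x ih =>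
    intro hx
    by_cases h0 : x = 0
    · rw [h0]
    · obtain ⟨h1, h2⟩ := hr x hx h0
      rw [← ih (r x) h1 (by omega), hS _ h2]

theorem sum_map_range_ite (m a x : ℕ) (f : ℕ → ℕ) :
    ((List.range m).map fun i => if i + a = x then f i else 0).sum =
      if a ≤ x ∧ x < a + m then f (x - a) else 0 := by
  induction m with
  | zero => rw [if_neg (by omega)]; rfl
  | succ m ih =>
    rw [List.sum_range_succ, ih]
    by_cases h : m + a = x
    · subst h
      rw [if_neg (by omega), if_pos rfl, if_pos (by omega), zero_add, Nat.add_sub_cancel]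
    · rw [if_neg h, add_zero]
      exact if_congr (by omega) rfl rfl

theorem isAffine_cycle {n : ℕ} (hn : 2 ≤ n)
    (h : Q.HasShape n ((List.range n).map fun i => (i, (i + 1) % n))) : Q.IsAffine := by
  refine h.isAffine (fun _ => 1) (fun _ _ => Nat.one_pos) (fun x hx => ?_)
    (connected_of_parent (fun x => x - 1) fun x hx h0 => ⟨by omega, ?_⟩)
  · obtain ⟨m, rfl⟩ : ∃ m, n = m + 1 := ⟨n - 1, by omega⟩
    rw [List.map_map, List.sum_range_succ]
    have h1 : (List.range m).map ((fun p : ℕ × ℕ => (if p.1 = x then 1 else 0) +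
        if p.2 = x then 1 else 0) ∘ fun i => (i, (i + 1) % (m + 1))) =
        (List.range m).map fun i => (if i + 0 = x then 1 else 0) + if i + 1 = x then 1 else 0 := by
      refine List.map_congr_left fun i hi => ?_
      simp only [List.mem_range] at hi
      simp only [Function.comp_apply, Nat.mod_eq_of_lt (show i + 1 < m + 1 by omega), add_zero]
    rw [h1, List.sum_map_add, sum_map_range_ite m 0 x fun _ => 1,
      sum_map_range_ite m 1 x fun _ => 1]
    simp only [Function.comp_apply, Nat.mod_self]
    split_ifs <;> omega
  · rw [List.mem_map]
    refine ⟨x - 1, by simp; omega, ?_⟩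
    rw [Nat.sub_add_cancel (by omega), Nat.mod_eq_of_lt hx]

theorem isAffine_fork {n : ℕ} (hn : 5 ≤ n)
    (h : Q.HasShape n
      ((0, 2) :: (n - 3, n - 1) :: (List.range (n - 3)).map fun i => (i + 1, i + 2))) :
    Q.IsAffine := by
  -- The additive function of this graph: `1` at the four ends `0`, `1`, `n - 2`, `n - 1` and `2`
  -- along the chain between.
  obtain ⟨d, hd1, hd2⟩ : ∃ d : ℕ → ℕ, (∀ x, x ≤ 1 ∨ n - 2 ≤ x → d x = 1) ∧
      ∀ x, ¬(x ≤ 1 ∨ n - 2 ≤ x) → d x = 2 :=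
    ⟨fun x => if x ≤ 1 ∨ n - 2 ≤ x then 1 else 2, fun _ hx => if_pos hx, fun _ hx => if_neg hx⟩
  refine h.isAffine d (fun x _ => ?_) (fun x hx => ?_) fun S hS => ?_
  · by_cases hx : x ≤ 1 ∨ n - 2 ≤ x
    · rw [hd1 x hx]; exact Nat.one_pos
    · rw [hd2 x hx]; exact Nat.two_pos
  · rw [List.map_cons, List.map_cons, List.map_map, List.sum_cons, List.sum_cons]
    have h3 : ((List.range (n - 3)).map fun i => (if i + 1 = x then d (i + 2) else 0) +
        if i + 2 = x then d (i + 1) else 0).sum = _ :=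
      List.sum_map_add.trans (congrArg₂ (· + ·) (sum_map_range_ite (n - 3) 1 x fun i => d (i + 2))
        (sum_map_range_ite (n - 3) 2 x fun i => d (i + 1)))
    simp only [Function.comp_def]
    rw [h3]
    have e0 := hd1 0 (by omega)
    have e1 := hd2 2 (by omega)
    have e2 := hd1 (n - 1) (by omega)
    have e3 := hd2 (n - 3) (by omega)
    have a1 := hd1 (x - 1 + 2)
    have a2 := hd2 (x - 1 + 2)
    have b1 := hd1 (x - 2 + 1)
    have b2 := hd2 (x - 2 + 1)
    have c1 := hd1 x
    have c2 := hd2 x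
    generalize d (x - 1 + 2) = u at *
    generalize d (x - 2 + 1) = w at *
    generalize d x = y at *
    rw [e0, e1, e2, e3]
    clear hd1 hd2 e0 e1 e2 e3 h3 h
    split_ifs <;> omega
  · have h2 : S 0 ↔ S 2 := hS (0, 2) (by simp)
    have h3 : S (n - 3) ↔ S (n - 1) := hS (n - 3, n - 1) (by simp)
    have h4 : ∀ i < n - 3, S (i + 1) ↔ S (i + 2) := fun i hi =>
      hS (i + 1, i + 2) (by simp [hi])
    have h5 : ∀ i ≤ n - 3, (S (i + 1) ↔ S 0) := by
      intro i
      induction i with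
      | zero => intro _; rw [h2, h4 0 (by omega)]
      | succ i ih => intro hi; rw [← ih (by omega), h4 i (by omega)]
    intro x hx
    rcases Nat.eq_zero_or_pos x with rfl | h0
    · rfl
    · by_cases hx1 : x = n - 1
      · rw [hx1, ← h3, ← h5 (n - 4) (by omega), show n - 4 + 1 = n - 3 by omega]
      · rw [← h5 (x - 1) (by omega), Nat.sub_add_cancel h0]

theorem IsExtendedDynkin.isAffine (h : Q.IsExtendedDynkin) : Q.IsAffine := by
  rcases h with ⟨n, hn, h⟩ | ⟨n, hn, h⟩ | h | h | h
  · exact isAffine_cycle hn h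
  · exact isAffine_fork hn h
  -- In the three exceptional cases the first list gives the coefficients of the minimal imaginary
  -- root, and the second the parents in a spanning tree.
  · exact h.isAffine (fun x => [1, 2, 3, 2, 1, 2, 1].getD x 0) (by decide) (by decide)
      (connected_of_parent (fun x => [0, 0, 1, 2, 3, 2, 5].getD x 0) (by decide))
  · exact h.isAffine (fun x => [1, 2, 3, 4, 3, 2, 1, 2].getD x 0) (by decide) (by decide)
      (connected_of_parent (fun x => [0, 0, 1, 2, 3, 4, 5, 3].getD x 0) (by decide))
  · exact h.isAffine (fun x => [1, 2, 3, 4, 5, 6, 4, 2, 3].getD x 0) (by decide) (by decide)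
      (connected_of_parent (fun x => [0, 0, 1, 2, 3, 4, 5, 6, 5].getD x 0) (by decide))

end FinQuiver

theorem proposition5p3 {k : Type*} [Field k] [IsAlgClosed k] [CharZero k]
    {V E : Type*} [Fintype V] [DecidableEq V] [Fintype E]
    (Q : FinQuiver V E) (hQ : Q.IsExtendedDynkin)
    (g : GradedRight.GradedAut (Preproj.grading k Q))
    (hge : ∀ v, g.toEquiv (Preproj.vert k Q v) = Preproj.vert k Q v)
    (c t : E → k) (hc : ∀ α, c α ≠ 0) (ht : ∀ α, t α ≠ 0)
    (hgc : ∀ α, g.toEquiv (Preproj.arrow k Q α) = c α • Preproj.arrow k Q α)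
    (hgt : ∀ α, g.toEquiv (Preproj.star k Q α) = t α • Preproj.star k Q α)
    (i : V) (α₁ : E) :
    (∃! D : Matrix V V k, GradedRight.IsHdet (Preproj.vert k Q) g 2 2 D) ∧
    GradedRight.TrDefined (GradedRight.eAGr (Preproj.grading k Q) (Preproj.vert k Q i)) ∧
    GradedRight.BrDefined (Preproj.grading k Q)
      (GradedRight.eAGr (Preproj.grading k Q) (Preproj.vert k Q i)) ∧
    ∃ Tr Br : RatFunc k,
      GradedRight.IsExpansionAtZero Tr (g.onEA (Preproj.vert k Q i) (hge i)).trCoeff ∧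
      GradedRight.IsExpansionAtInfty Br (g.onEA (Preproj.vert k Q i) (hge i)).brCoeff ∧
      Br = RatFunc.C ((GradedRight.Hdet (Preproj.vert k Q) g 2 2 i i)⁻¹ * (c α₁ * t α₁)) * Tr := by
  classical
  obtain ⟨⟨δ, hpos, hδ⟩, hconn⟩ := hQ.isAffine
  have hsoc : ∀ x : Preproj k Q, (∀ β, x * Preproj.dbl k Q β = 0) → x = 0 :=
    Preproj.eq_zero_of_mul_dbl δ hpos hδ
  obtain ⟨F, he, hb, hb', htg⟩ := Preproj.exists_koszulFrame hsoc
  -- Connectedness is available for predicates, so it is applied to a level set of `f`.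
  have hg : Preproj.ScalesArrows g (Sum.elim c t) (c α₁ * t α₁) :=
    Preproj.scalesArrows_of_connected hge hgc hgt
      (fun f hf v w => (hconn (fun u => f u = f v) (fun α => by rw [hf α]) v w rfl).symm) α₁
  have hq : c α₁ * t α₁ ≠ 0 := mul_ne_zero (hc α₁) (ht α₁)
  have hA := Preproj.isRegular_zgr he hb hb' htg hsoc
  have hM := Preproj.isRegular_eAGr he hb hb' htg hsoc i
  have hD := Preproj.isHdet_iff he hb hb' hA hg hq
  obtain ⟨R, hTr, hBr⟩ := Preproj.exists_rational_eA he hb hb' hge hM hg hq hsoc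
  -- The same `R` is used for `Tr` and `Br`: the entry of `Hdet` at `i` is `q = c α₁ * t α₁`, so the
  -- factor in the formula is `1`.
  refine ⟨⟨_, (hD _).2 rfl, fun D hD' => (hD D).1 hD'⟩, Preproj.trDefined_eAGr i,
    Preproj.brDefined_eAGr he hM, R, R, hTr, hBr, ?_⟩
  rw [Preproj.hdet_eq he hb hb' hA hg hq, Matrix.diagonal_apply_eq, inv_mul_cancel₀ hq, map_one,
    one_mul]
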